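/- **Theorem.** Let $(M,g,\mathbb{Q})$ be a compact seven-dimensional quaternionic contact (qc) manifold: locally, the rank-four horizontal distribution $H$ is the common kernel of three smooth 1-forms $\eta_1,\eta_2,\eta_3$; $g$ is a metric on $H$; the rank-three bundle $\mathbb{Q}\subset \mathrm{End}(H)$ is spanned by $g$-orthogonal almost complex structures $I_1,I_2,I_3$ on $H$ with $I_1I_2=-I_2I_1=I_3$ and $2g(I_sX,Y)=d\eta_s(X,Y)$ for $X,Y\in H$; and there are Reeb vector fields $\xi_1,\xi_2,\xi_3$ with $\eta_s(\xi_t)=\delta_{st}$ and $(\xi_s\lrcorner d\eta_t)|_H=-(\xi_t\lrcorner d\eta_s)|_H$ for all $s,t$ (in particular $(\xi_s\lrcorner d\eta_s)|_H=0$). Let $V=\mathrm{span}\{\xi_1,\xi_2,\xi_3\}$, and extend $g$ to $TM$ so that $V\perp H$ and the $\xi_s$ are orthonormal. Let $\nabla$ be the Biquard connection, that is, the connection with torsion $T$ which preserves $H\oplus V$, the metric $g$ on $H$ and the bundle $\mathbb{Q}$, which satisfies $T(X,Y)=-[X,Y]_V$ for $X,Y\in H$, for which each $T_\xi=T(\xi,\cdot)|_H$,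 $\xi\in V$, is an endomorphism of $H$ orthogonal to $\mathfrak{sp}(1)\oplus \mathfrak{sp}(1)\subset\mathrm{End}(H)$ (the span of $\mathbb{Q}$ and of the skew endomorphisms commuting with $\mathbb{Q}$), and for which the identification $V\to\mathbb{Q}$, $\xi_s\mapsto I_s$, is parallel. Let $R(A,B)=[\nabla_A,\nabla_B]-\nabla_{[A,B]}$ be its curvature, and, for a local orthonormal frame $e_1,\dots,e_4$ of $H$, put $$24\,S=\sum_{a,b}g(R(e_b,e_a)e_a,e_b),\qquad T^0(X,Y)=g\Big(\sum_{s=1}^3T^0_{\xi_s}I_sX,Y\Big)\quad (X,Y\in H),$$ where $T^0_\xi$ is the symmetric part of $T_\xi$. For a smooth real function $f$ let $\nabla f\in H$ be the horizontal gradient, let $\nabla^2f(A,B)=A(Bf)-(\nabla_AB)f$ and $\nabla^3f=\nabla(\nabla^2f)$ (with the direction of the last derivative in the first slot), let $\triangle f=-\sum_a\nabla^2f(e_a,e_a)$ be the sub-Laplacian, and let $$P_f(X)=\sum_b\nabla^3f(X,e_b,e_b)+\sum_{t=1}^3\sum_b\nabla^3f(I_tX,e_b,I_te_b)-4S\,df(X)+4T^0(X,\nabla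 f)\qquad (X\in H).$$ The $P$-function of $f$ is $P_f(\nabla f)$; it is called non-negative if its integral exists and $-\int_MP_f(\nabla f)\,Vol_\eta\ge0$, where $Vol_\eta=\eta_1\wedge\eta_2\wedge\eta_3\wedge\omega_1\wedge\omega_1$, with $\omega_1(X,Y)=g(I_1X,Y)$ on $H$ and $\xi\lrcorner\omega_1=0$ for $\xi\in V$ (the volume form $Vol_\eta$ does not depend on the local choices). Suppose that there is a constant $k_0>0$ such that $$6S\,g(X,X)+10\,T^0(X,X)\ge k_0\,g(X,X)\qquad\text{for all }X\in H,$$ and that the $P$-function of every eigenfunction of the sub-Laplacian (a smooth real function $f\not\equiv0$ with $\triangle f=\mu f$ for some $\mu\in\mathbb{R}$) is non-negative. Then every nonzero eigenvalue $\lambda$ of the sub-Laplacian satisfies $$\lambda\ge\tfrac13k_0 .$$ -/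

import Mathlib

open Bundle Set MeasureTheory Filter
open scoped Manifold ContDiff Topology

noncomputable section

namespace QuaternionicContact

section Data

variable (M : Type*) [TopologicalSpace M] [ChartedSpace (EuclideanSpace ℝ (Fin 7)) M]

/-- Vector fields, with no regularity required. -/
abbrev VField : Type _ := Π x : M, TangentSpace (𝓡 7) x

/-- Fields of endomorphisms of the tangent spaces, with no regularity required. -/
abbrev EndField : Type _ := Π x : M, TangentSpace (𝓡 7) x →L[ℝ] TangentSpace (𝓡 7) x

/-- Fields of one-forms, with no regularity required. -/
abbrev OneForm : Type _ := Π x : M, TangentSpace (𝓡 7) x →L[ℝ] ℝ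

variable {M} [IsManifold (𝓡 7) ∞ M]

/-- A vector field is differentiable at a point. -/
def DiffAt (X : VField M) (x : M) : Prop :=
  MDifferentiableAt (𝓡 7) ((𝓡 7).prod 𝓘(ℝ, EuclideanSpace ℝ (Fin 7))) (T% X) x

/-- A vector field is smooth on a set. -/
def SmoothOn (X : VField M) (U : Set M) : Prop :=
  ContMDiffOn (𝓡 7) ((𝓡 7).prod 𝓘(ℝ, EuclideanSpace ℝ (Fin 7))) ∞ (T% X) U

/-- The differential of a real function. -/
abbrev df (f : M → ℝ) (x : M) : TangentSpace (𝓡 7) x →L[ℝ] ℝ := mvfderiv (𝓡 7) f x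

/-- The exterior derivative of a one-form evaluated on two vector fields,
`dα(X, Y) = X(α(Y)) - Y(α(X)) - α([X, Y])`. -/
def extDer (α : OneForm M) (X Y : VField M) (x : M) : ℝ :=
  df (fun y ↦ α y (Y y)) x (X x) - df (fun y ↦ α y (X y)) x (Y x)
    - α x (VectorField.mlieBracket (𝓡 7) X Y x)

variable (M)

/-- The tensors of a seven-dimensional quaternionic contact manifold, before any condition is
imposed: a horizontal distribution `H`, a metric `g`, and a bundle `Q` of endomorphisms.

The metric is carried as a Riemannian metric of the whole tangent bundle, and endomorphisms of `H`
are carried as endomorphisms of the tangent space which vanish on the `g`-orthogonal complement of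
`H`. The conditions in `LocalFrame` say that this complement is spanned by the Reeb fields, and that
these are orthonormal, so the extension is the canonical one. -/
structure QCData where
  /-- the metric -/
  g : ContMDiffRiemannianMetric (𝓡 7) ∞ (EuclideanSpace ℝ (Fin 7)) (fun x : M ↦ TangentSpace (𝓡 7) x)
  /-- the horizontal distribution -/
  H : ∀ x : M, Submodule ℝ (TangentSpace (𝓡 7) x)
  /-- the bundle generated by the almost complex structures -/
  Q : ∀ x : M, Submodule ℝ (TangentSpace (𝓡 7) x →L[ℝ] TangentSpace (𝓡 7) x)

variable {M}

/-- A local presentation of a quaternionic contact structure on an open set: contact forms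
`η₁, η₂, η₃`, almost complex structures `I₁, I₂, I₃` on `H`, Reeb fields `ξ₁, ξ₂, ξ₃`, and an
orthonormal frame `e₁, …, e₄` of `H`, all smooth. -/
structure QCData.LocalFrame (D : QCData M) where
  /-- the open set on which the frame is defined -/
  dom : Set M
  isOpen_dom : IsOpen dom
  /-- the contact forms -/
  η : Fin 3 → OneForm M
  /-- the almost complex structures on the horizontal space -/
  I : Fin 3 → EndField M
  /-- the Reeb vector fields -/
  ξ : Fin 3 → VField M
  /-- an orthonormal frame of the horizontal space -/
  e : Fin 4 → VField M
  smooth_η : ∀ s, ContMDiffOn (𝓡 7) ((𝓡 7).prod 𝓘(ℝ, EuclideanSpace ℝ (Fin 7) →L[ℝ] ℝ)) ∞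
    (fun x ↦ TotalSpace.mk' (EuclideanSpace ℝ (Fin 7) →L[ℝ] ℝ)
      (E := fun y : M ↦ TangentSpace (𝓡 7) y →L[ℝ] ℝ) x (η s x)) dom
  smooth_I : ∀ s, ContMDiffOn (𝓡 7)
    ((𝓡 7).prod 𝓘(ℝ, EuclideanSpace ℝ (Fin 7) →L[ℝ] EuclideanSpace ℝ (Fin 7))) ∞
    (fun x ↦ TotalSpace.mk' (EuclideanSpace ℝ (Fin 7) →L[ℝ] EuclideanSpace ℝ (Fin 7))
      (E := fun y : M ↦ TangentSpace (𝓡 7) y →L[ℝ] TangentSpace (𝓡 7) y) x (I s x)) dom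
  smooth_ξ : ∀ s, SmoothOn (ξ s) dom
  smooth_e : ∀ a, SmoothOn (e a) dom
  /-- `H` is the kernel of `η = (η₁, η₂, η₃)` -/
  mem_H_iff : ∀ x ∈ dom, ∀ v : TangentSpace (𝓡 7) x, v ∈ D.H x ↔ ∀ s, η s x v = 0
  e_mem : ∀ x ∈ dom, ∀ a, e a x ∈ D.H x
  e_orthonormal : ∀ x ∈ dom, ∀ a b, D.g.inner x (e a x) (e b x) = if a = b then 1 else 0
  /-- `Q` is generated by `I₁, I₂, I₃` -/
  Q_eq : ∀ x ∈ dom, D.Q x = Submodule.span ℝ (Set.range fun s ↦ I s x)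
  /-- the `I_s` are endomorphisms of `H`, extended by zero to the Reeb directions -/
  I_mem : ∀ x ∈ dom, ∀ s, ∀ v ∈ D.H x, I s x v ∈ D.H x
  I_ξ : ∀ x ∈ dom, ∀ s t, I s x (ξ t x) = 0
  /-- the identities of the imaginary unit quaternions -/
  I_sq : ∀ x ∈ dom, ∀ s, ∀ v ∈ D.H x, I s x (I s x v) = -v
  I_zero_one : ∀ x ∈ dom, ∀ v ∈ D.H x, I 0 x (I 1 x v) = I 2 x v
  I_one_zero : ∀ x ∈ dom, ∀ v ∈ D.H x, I 1 x (I 0 x v) = -I 2 x v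
  /-- the metric is Hermitian on `H` -/
  g_I_I : ∀ x ∈ dom, ∀ s, ∀ v ∈ D.H x, ∀ w ∈ D.H x,
    D.g.inner x (I s x v) (I s x w) = D.g.inner x v w
  /-- `2 g(I_s X, Y) = dη_s(X, Y)` on `H` -/
  compat : ∀ x ∈ dom, ∀ s, ∀ X Y : VField M, DiffAt X x → DiffAt Y x →
    X x ∈ D.H x → Y x ∈ D.H x → 2 * D.g.inner x (I s x (X x)) (Y x) = extDer (η s) X Y x
  /-- the Reeb conditions -/
  η_ξ : ∀ x ∈ dom, ∀ s t, η s x (ξ t x) = if s = t then 1 else 0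
  reeb_self : ∀ x ∈ dom, ∀ s, ∀ X : VField M, DiffAt X x → X x ∈ D.H x →
    extDer (η s) (ξ s) X x = 0
  reeb_skew : ∀ x ∈ dom, ∀ s t, ∀ X : VField M, DiffAt X x → X x ∈ D.H x →
    extDer (η t) (ξ s) X x = -extDer (η s) (ξ t) X x
  /-- the extension of the metric from `H` to the tangent bundle -/
  g_ξ_ξ : ∀ x ∈ dom, ∀ s t, D.g.inner x (ξ s x) (ξ t x) = if s = t then 1 else 0
  g_ξ_H : ∀ x ∈ dom, ∀ s, ∀ v ∈ D.H x, D.g.inner x (ξ s x) v = 0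

variable (M)

/-- A quaternionic contact structure in dimension seven (with Reeb vector fields). -/
structure QCStructure extends QCData M where
  exists_frame : ∀ x : M, ∃ F : toQCData.LocalFrame, x ∈ F.dom

end Data

namespace QCStructure

variable {M : Type*} [TopologicalSpace M] [ChartedSpace (EuclideanSpace ℝ (Fin 7)) M]
  [IsManifold (𝓡 7) ∞ M] (A : QCStructure M)

/-- A local frame around a given point. The quantities defined through it below do not depend on
which one is taken. -/
def frameAt (x : M) : A.toQCData.LocalFrame := (A.exists_frame x).choose

lemma mem_frameAt_dom (x : M) : x ∈ (A.frameAt x).dom := (A.exists_frame x).choose_spec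

/-- The vertical space, the orthogonal complement of `H`; it is spanned by the Reeb fields. -/
def V (x : M) : Submodule ℝ (TangentSpace (𝓡 7) x) where
  carrier := {v | ∀ w ∈ A.H x, A.g.inner x v w = 0}
  add_mem' := by
    intro a b ha hb w hw
    rw [map_add, add_apply, ha w hw, hb w hw, add_zero]
  zero_mem' := by
    intro w _
    rw [map_zero, zero_apply]
  smul_mem' := by
    intro c a ha w hw
    rw [map_smul, smul_apply, ha w hw, smul_zero]

/-- The inner product `⟨B, C⟩ = ∑ₐ g(B eₐ, C eₐ)` of endomorphisms of `H x`. -/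
def endInner (x : M) (B C : TangentSpace (𝓡 7) x →L[ℝ] TangentSpace (𝓡 7) x) : ℝ :=
  ∑ a, A.g.inner x (B ((A.frameAt x).e a x)) (C ((A.frameAt x).e a x))

/-- The restriction of `B` to `H x` belongs to `sp(1)`, that is to `Q x`. -/
def MemSpOne (x : M) (B : TangentSpace (𝓡 7) x →L[ℝ] TangentSpace (𝓡 7) x) : Prop :=
  ∃ C ∈ A.Q x, ∀ v ∈ A.H x, B v = C v

/-- The restriction of `B` to `H x` belongs to `sp(n)` (`n = 1`): it is a skew-symmetric
endomorphism of `H x` which commutes with `Q x`. -/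
def MemSpN (x : M) (B : TangentSpace (𝓡 7) x →L[ℝ] TangentSpace (𝓡 7) x) : Prop :=
  (∀ v ∈ A.H x, B v ∈ A.H x) ∧
  (∀ v ∈ A.H x, ∀ w ∈ A.H x, A.g.inner x (B v) w = -A.g.inner x v (B w)) ∧
  (∀ C ∈ A.Q x, ∀ v ∈ A.H x, B (C v) = C (B v))

/-- The defining properties of the Biquard connection. In Mathlib's argument order `cov Y x u` is
the derivative `(∇_u Y)(x)`. -/
structure IsBiquard (cov : CovariantDerivative (𝓡 7) (EuclideanSpace ℝ (Fin 7)) (fun x : M ↦ TangentSpace (𝓡 7) x)) :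
    Prop where
  smooth : CovariantDerivative.ContMDiffCovariantDerivative cov ∞
  /-- `∇` preserves `H` -/
  preserves_H : ∀ (x : M) (Y : VField M), DiffAt Y x → (∀ᶠ y in 𝓝 x, Y y ∈ A.H y) →
    ∀ u, cov Y x u ∈ A.H x
  /-- `∇` preserves `V` -/
  preserves_V : ∀ (x : M) (Y : VField M), DiffAt Y x → (∀ᶠ y in 𝓝 x, Y y ∈ A.V y) →
    ∀ u, cov Y x u ∈ A.V x
  /-- `∇ g = 0` on `H` -/
  metric : ∀ (x : M) (X Y : VField M), DiffAt X x → DiffAt Y x →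
    (∀ᶠ y in 𝓝 x, X y ∈ A.H y) → (∀ᶠ y in 𝓝 x, Y y ∈ A.H y) → ∀ u,
    df (fun y ↦ A.g.inner y (X y) (Y y)) x u
      = A.g.inner x (cov X x u) (Y x) + A.g.inner x (X x) (cov Y x u)
  /-- `∇ σ` is a section of `Q` for every section `σ` of `Q` -/
  preserves_Q : ∀ (x : M) (σ : EndField M),
    ContMDiffAt (𝓡 7)
    ((𝓡 7).prod 𝓘(ℝ, EuclideanSpace ℝ (Fin 7) →L[ℝ] EuclideanSpace ℝ (Fin 7))) ∞
    (fun z ↦ TotalSpace.mk' (EuclideanSpace ℝ (Fin 7) →L[ℝ] EuclideanSpace ℝ (Fin 7))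
      (E := fun y : M ↦ TangentSpace (𝓡 7) y →L[ℝ] TangentSpace (𝓡 7) y) z (σ z)) x →
    (∀ᶠ y in 𝓝 x, σ y ∈ A.Q y) → ∀ u, ∃ τ ∈ A.Q x, ∀ X : VField M, DiffAt X x →
      cov (fun y ↦ σ y (X y)) x u - σ x (cov X x u) = τ (X x)
  /-- `T(X, Y) = -[X, Y]_V` for horizontal `X, Y`: the torsion is vertical -/
  torsion_mem_V : ∀ (x : M), ∀ v ∈ A.H x, ∀ w ∈ A.H x, cov.torsion x v w ∈ A.V x
  /-- `T(X, Y) = -[X, Y]_V` for horizontal `X, Y`: the vertical part of `T(X, Y) + [X, Y]` is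
  zero -/
  torsion_add_bracket : ∀ (x : M) (X Y : VField M), DiffAt X x → DiffAt Y x →
    (∀ᶠ y in 𝓝 x, X y ∈ A.H y) → (∀ᶠ y in 𝓝 x, Y y ∈ A.H y) →
    cov.torsion x (X x) (Y x) + VectorField.mlieBracket (𝓡 7) X Y x ∈ A.H x
  /-- for vertical `v`, the torsion `T(v, ·)` is an endomorphism of `H` -/
  torsion_vertical_mem : ∀ (x : M), ∀ v ∈ A.V x, ∀ w ∈ A.H x, cov.torsion x v w ∈ A.H x
  /-- for vertical `v`, the endomorphism `T(v, ·)` of `H` is orthogonal to `sp(n) ⊕ sp(1)` -/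
  torsion_orthogonal : ∀ (x : M), ∀ v ∈ A.V x, ∀ B, A.MemSpN x B ∨ A.MemSpOne x B →
    A.endInner x (cov.torsion x v) B = 0
  /-- the identification `φ : V → Q`, `φ(ξ_s) = I_s`, is parallel -/
  parallel_φ : ∀ (F : A.toQCData.LocalFrame), ∀ x ∈ F.dom, ∀ s u, ∀ X : VField M,
    DiffAt X x →
    cov (fun y ↦ F.I s y (X y)) x u - F.I s x (cov X x u)
      = ∑ t, F.η t x (cov (F.ξ s) x u) • F.I t x (X x)

section Operators

variable (cov : CovariantDerivative (𝓡 7) (EuclideanSpace ℝ (Fin 7)) (fun x : M ↦ TangentSpace (𝓡 7) x))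

/-- `∇_X Y` -/
def nabla (X Y : VField M) : VField M := fun x ↦ cov Y x (X x)

/-- The curvature `R(X, Y)Z = ∇_X ∇_Y Z - ∇_Y ∇_X Z - ∇_{[X, Y]} Z`. -/
def curvature (X Y Z : VField M) : VField M :=
  nabla cov X (nabla cov Y Z) - nabla cov Y (nabla cov X Z)
    - nabla cov (VectorField.mlieBracket (𝓡 7) X Y) Z

/-- `∇²f(X, Y) = X(Y f) - (∇_X Y) f` -/
def hess (f : M → ℝ) (X Y : VField M) (x : M) : ℝ :=
  df (fun y ↦ df f y (Y y)) x (X x) - df f x (nabla cov X Y x)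

/-- `∇³f(X, Y, Z) = X(∇²f(Y, Z)) - ∇²f(∇_X Y, Z) - ∇²f(Y, ∇_X Z)` -/
def third (f : M → ℝ) (X Y Z : VField M) (x : M) : ℝ :=
  df (hess cov f Y Z) x (X x) - hess cov f (nabla cov X Y) Z x - hess cov f Y (nabla cov X Z) x

/-- The horizontal gradient, `∇f = ∑ₐ df(eₐ) eₐ`. -/
def hgrad (f : M → ℝ) : VField M := fun x ↦
  ∑ a, (df f x ((A.frameAt x).e a x)) • (A.frameAt x).e a x

/-- The sub-Laplacian `△f = -∑ₐ ∇²f(eₐ, eₐ)`. -/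
def subLaplacian (f : M → ℝ) (x : M) : ℝ :=
  -∑ a, hess cov f ((A.frameAt x).e a) ((A.frameAt x).e a) x

/-- The normalized qc-scalar curvature, `8n(n+2) S = ∑ R(e_b, e_a, e_a, e_b)` with `n = 1`, where
`R(A, B, C, D) = g(R(A, B)C, D)`. -/
def S (x : M) : ℝ :=
  (1 / 24 : ℝ) * ∑ a, ∑ b, A.g.inner x
    (curvature cov ((A.frameAt x).e b) ((A.frameAt x).e a) ((A.frameAt x).e a) x)
    ((A.frameAt x).e b x)

/-- For a vertical `v` and horizontal `X, Y`, the form `g(T⁰_v X, Y)` of the symmetric part `T⁰_v`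
of the torsion endomorphism `T_v = T(v, ·)` of `H`. -/
def symmTorsion (x : M) (v X Y : TangentSpace (𝓡 7) x) : ℝ :=
  (1 / 2 : ℝ) * (A.g.inner x (cov.torsion x v X) Y + A.g.inner x X (cov.torsion x v Y))

/-- `T⁰(X, Y) = g((T⁰_{ξ₁} I₁ + T⁰_{ξ₂} I₂ + T⁰_{ξ₃} I₃) X, Y)` for horizontal `X, Y`. -/
def T0 (x : M) (X Y : TangentSpace (𝓡 7) x) : ℝ :=
  ∑ s, A.symmTorsion cov x ((A.frameAt x).ξ s x) ((A.frameAt x).I s x X) Y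

/-- The `P`-form of `f` (for `n = 1`), evaluated on a horizontal vector field. -/
def PForm (f : M → ℝ) (X : VField M) (x : M) : ℝ :=
  ∑ b, third cov f X ((A.frameAt x).e b) ((A.frameAt x).e b) x
    + ∑ t, ∑ b, third cov f (fun y ↦ (A.frameAt x).I t y (X y)) ((A.frameAt x).e b)
        (fun y ↦ (A.frameAt x).I t y ((A.frameAt x).e b y)) x
    - 4 * A.S cov x * df f x (X x) + 4 * A.T0 cov x (X x) (A.hgrad f x)

/-- The `P`-function `P_f(∇f)`. -/
def PFunction (f : M → ℝ) (x : M) : ℝ := A.PForm cov f (A.hgrad f) x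

/-- `f` is an eigenfunction of the sub-Laplacian with eigenvalue `lam`. -/
def IsEigenfunction (lam : ℝ) (f : M → ℝ) : Prop :=
  ContMDiff (𝓡 7) 𝓘(ℝ) ∞ f ∧ f ≠ 0 ∧ ∀ x, A.subLaplacian cov f x = lam * f x

end Operators

section Volume

/-- The fundamental two-forms `ω_s(X, Y) = g(I_s X, Y)` in a local frame; they vanish on vertical
vectors because `I_s` does. -/
def omega {D : QCData M} (F : D.LocalFrame) (s : Fin 3) (x : M) (v w : TangentSpace (𝓡 7) x) : ℝ :=
  D.g.inner x (F.I s x v) w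

/-- The volume form `η₁ ∧ η₂ ∧ η₃ ∧ ω₁ ∧ ω₁` evaluated on seven tangent vectors: the wedge product
of forms of degrees `1, 1, 1, 2, 2` is the alternating sum over all permutations divided by
`1! 1! 1! 2! 2!`. -/
def volForm (x : M) (v : Fin 7 → TangentSpace (𝓡 7) x) : ℝ :=
  (1 / 4 : ℝ) * ∑ p : Equiv.Perm (Fin 7), ((Equiv.Perm.sign p : ℤ) : ℝ) *
    ((A.frameAt x).η 0 x (v (p 0)) * (A.frameAt x).η 1 x (v (p 1)) * (A.frameAt x).η 2 x (v (p 2))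
      * omega (A.frameAt x) 0 x (v (p 3)) (v (p 4)) * omega (A.frameAt x) 0 x (v (p 5)) (v (p 6)))

/-- The coordinate vector field `∂ᵢ` of the chart at `c`, at the point with coordinates `z`. -/
def coordVector (c : M) (z : EuclideanSpace ℝ (Fin 7)) (i : Fin 7) : TangentSpace (𝓡 7) ((extChartAt (𝓡 7) c).symm z) :=
  mfderiv 𝓘(ℝ, EuclideanSpace ℝ (Fin 7)) (𝓡 7) (extChartAt (𝓡 7) c).symm z (EuclideanSpace.single i (1 : ℝ) : EuclideanSpace ℝ (Fin 7))

variable [MeasurableSpace M]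

/-- The measure `|Vol_η(∂₁, …, ∂₇)| dz₁ ⋯ dz₇` on the domain of the chart at `c`, as a measure on
`M` that is zero outside of this domain. -/
def chartMeasure (c : M) : Measure M :=
  Measure.map (extChartAt (𝓡 7) c).symm
    ((volume.restrict (extChartAt (𝓡 7) c).target).withDensity
      (fun z ↦ ENNReal.ofReal
        |A.volForm ((extChartAt (𝓡 7) c).symm z) (coordVector c z)|))

/-- The measure on `M` of the volume form `Vol_η`. The chart measures agree on the overlaps of the
charts, so the smallest measure that dominates all of them is the measure which restricts to each
of them on the domain of the chart. -/
def qcVolume : Measure M := ⨆ c : M, A.chartMeasure c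

/-- The `P`-function of `f` is non-negative: the integral of `P_f(∇f)` exists, and
`-∫ P_f(∇f) Vol_η ≥ 0`. -/
def PFunctionNonneg (cov : CovariantDerivative (𝓡 7) (EuclideanSpace ℝ (Fin 7)) (fun x : M ↦ TangentSpace (𝓡 7) x))
    (f : M → ℝ) : Prop :=
  Integrable (A.PFunction cov f) A.qcVolume ∧ 0 ≤ -∫ x, A.PFunction cov f x ∂A.qcVolume

end Volume

end QCStructure

end QuaternionicContact

end

/-! Write G for the horizontal gradient of an eigenfunction f with △f = λf, D = ∇G for its covariant
derivative, and φ_s = df(ξ_s). The proof is a Bochner argument in which a multiple of the P-function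
absorbs the mixed derivatives ∇²f(ξ_s, I_s G) that the vertical torsion creates. Three identities
enter.

Commuting derivatives in the divergence of ∇_G G (`divg_nabla_hgrad`) gives div(∇_G G) = |D|² − 8
Σφ_s² + Ric(G, G) − λ|G|² + 2 Σ∇²f(ξ_s, I_s G), where |D| is the norm of D on H. By `ricci_eq` the
horizontal Ricci form is Ric(G, G) = 4T⁰(G, G) + 6S|G|². For the field Σφ_s I_s G, `divg_reebGrad`
gives the divergence Σ∇²f(ξ_s, I_s G) + T⁰(G, G) + 4 Σφ_s². Finally `pFunction_eq` reduces P_f(∇f)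
to −λ|G|² − 4 Σ∇²f(ξ_s, I_s G) − 4S|G|².

In the sum of (3/4)P_f(∇f) and the divergence of ∇_G G + Σφ_s I_s G + (λ/4) f G the mixed
derivatives cancel (2 + 1 − 3 = 0), and what remains is (|D|² − 4 Σφ_s² − (λf)²/4) + ½(6S|G|² +
10T⁰(G, G)) − (3/2)λ|G|². The first bracket is non-negative by `bessel`: the Hessian is projected to
the span of the identity and I_1, I_2, I_3, where its components are the trace −λf and the Reeb
derivatives φ_s, because the skew part of the Hessian is the torsion. The curvature hypothesis
bounds the second term below by ½k₀|G|². This is `pointwise_inequality`.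

Divergences of smooth horizontal fields integrate to zero (`integral_divg`) and the integral of the
P-function is at most zero, so ½(k₀ − 3λ)∫|G|² ≤ 0. If λ < k₀/3 then G = 0, hence λf = △f = 0 and f
= 0, a contradiction.

Two ingredients need real work. The Ricci formula is linear algebra in the quadruple v, I_1 v, I_2
v, I_3 v, fed by the first Bianchi identity, by the commutator of the curvature with I_s, and by the
symmetry of T_ξ on H (`torsion_symm`), which follows from so(4) = sp(1) ⊕ sp(1). The divergence
theorem rests on |Vol_η| being a constant times the Riemannian density, on the connection being
metric on all of TM, and on the vanishing of the trace of T(X, ·) for horizontal X, which makes the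
trace of ∇X the usual divergence. -/

noncomputable section

set_option linter.unusedSectionVars false

/-! ### Calculus of functions and vector fields on an open set. -/

namespace QuaternionicContact

section Calculus

variable {M : Type*} [TopologicalSpace M] [ChartedSpace (EuclideanSpace ℝ (Fin 7)) M]
  [IsManifold (𝓡 7) ∞ M]

/-- A real function is smooth on a set. -/
def FunOn (u : M → ℝ) (U : Set M) : Prop := ContMDiffOn (𝓡 7) 𝓘(ℝ) ∞ u U

variable {U : Set M} {u v : M → ℝ} {X Y Z : VField M} {x : M}

lemma SmoothOn.contMDiffAt (h : SmoothOn X U) (hU : IsOpen U) (hx : x ∈ U) :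
    ContMDiffAt (𝓡 7) ((𝓡 7).prod 𝓘(ℝ, EuclideanSpace ℝ (Fin 7))) ∞ (T% X) x :=
  ContMDiffOn.contMDiffAt h (hU.mem_nhds hx)

lemma SmoothOn.diffAt (h : SmoothOn X U) (hU : IsOpen U) (hx : x ∈ U) : DiffAt X x :=
  (h.contMDiffAt hU hx).mdifferentiableAt (by simp)

lemma FunOn.mdiffAt (h : FunOn u U) (hU : IsOpen U) (hx : x ∈ U) :
    MDifferentiableAt (𝓡 7) 𝓘(ℝ) u x :=
  (ContMDiffOn.contMDiffAt h (hU.mem_nhds hx)).mdifferentiableAt (by simp)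

lemma FunOn.const (c : ℝ) : FunOn (fun _ : M ↦ c) U := contMDiffOn_const

lemma FunOn.sub (hu : FunOn u U) (hv : FunOn v U) : FunOn (fun y ↦ u y - v y) U :=
  ContMDiffOn.sub hu hv

lemma FunOn.mul (hu : FunOn u U) (hv : FunOn v U) : FunOn (fun y ↦ u y * v y) U :=
  ContMDiffOn.mul hu hv

lemma FunOn.sum {ι : Type*} {s : Finset ι} {w : ι → M → ℝ} (h : ∀ i ∈ s, FunOn (w i) U) :
    FunOn (fun y ↦ ∑ i ∈ s, w i y) U :=
  contMDiffOn_finsetSum h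

lemma FunOn.congr (hu : FunOn u U) (h : ∀ y ∈ U, v y = u y) : FunOn v U :=
  ContMDiffOn.congr hu h

lemma FunOn.mono {V : Set M} (hu : FunOn u U) (h : V ⊆ U) : FunOn u V :=
  ContMDiffOn.mono hu h

lemma SmoothOn.mono {V : Set M} (hu : SmoothOn X U) (h : V ⊆ U) : SmoothOn X V :=
  ContMDiffOn.mono hu h

lemma SmoothOn.add (hX : SmoothOn X U) (hY : SmoothOn Y U) : SmoothOn (fun y ↦ X y + Y y) U :=
  ContMDiffOn.add_section hX hY

lemma SmoothOn.sub (hX : SmoothOn X U) (hY : SmoothOn Y U) : SmoothOn (fun y ↦ X y - Y y) U :=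
  ContMDiffOn.sub_section hX hY

lemma SmoothOn.smul (hu : FunOn u U) (hX : SmoothOn X U) : SmoothOn (fun y ↦ u y • X y) U :=
  ContMDiffOn.smul_section hu hX

lemma SmoothOn.const_smul (c : ℝ) (hX : SmoothOn X U) : SmoothOn (fun y ↦ c • X y) U :=
  ContMDiffOn.const_smul_section hX

lemma SmoothOn.sum {ι : Type*} {s : Finset ι} {W : ι → VField M}
    (h : ∀ i ∈ s, SmoothOn (W i) U) : SmoothOn (fun y ↦ ∑ i ∈ s, W i y) U :=
  ContMDiffOn.sum_section h

lemma SmoothOn.congr (hX : SmoothOn X U) (h : ∀ y ∈ U, Y y = X y) : SmoothOn Y U :=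
  ContMDiffOn.congr hX (fun y hy ↦ by simp only [h y hy])

lemma SmoothOn.clm {B : EndField M} (hB : ContMDiffOn (𝓡 7)
    ((𝓡 7).prod 𝓘(ℝ, EuclideanSpace ℝ (Fin 7) →L[ℝ] EuclideanSpace ℝ (Fin 7))) ∞
    (fun x ↦ TotalSpace.mk' (EuclideanSpace ℝ (Fin 7) →L[ℝ] EuclideanSpace ℝ (Fin 7))
      (E := fun y : M ↦ TangentSpace (𝓡 7) y →L[ℝ] TangentSpace (𝓡 7) y) x (B x)) U)
    (hX : SmoothOn X U) : SmoothOn (fun y ↦ B y (X y)) U :=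
  ContMDiffOn.clm_bundle_apply hB hX

lemma FunOn.inner (g : ContMDiffRiemannianMetric (𝓡 7) ∞ (EuclideanSpace ℝ (Fin 7))
    (fun x : M ↦ TangentSpace (𝓡 7) x)) (hX : SmoothOn X U) (hY : SmoothOn Y U) :
    FunOn (fun y ↦ g.inner y (X y) (Y y)) U := by
  have h := ContMDiffOn.clm_bundle_apply₂ (E₃ := Bundle.Trivial M ℝ) (g.contMDiff.contMDiffOn) hX hY
  intro y hy
  have := h y hy
  rw [contMDiffWithinAt_totalSpace] at this
  exact this.2

/-- The derivative of `u` along `X` is the fibre part of the tangent map of `u` composed with `X`,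
viewed as a map into the tangent bundle. -/
lemma FunOn.df (hu : FunOn u U) (hU : IsOpen U) (hX : SmoothOn X U) :
    FunOn (fun y ↦ df u y (X y)) U := by
  have h1 : ContMDiffOn (𝓡 7).tangent 𝓘(ℝ).tangent ∞ (tangentMapWithin (𝓡 7) 𝓘(ℝ) u U)
      (TotalSpace.proj ⁻¹' U) :=
    ContMDiffOn.contMDiffOn_tangentMapWithin hu (by simp) hU.uniqueMDiffOn
  have h2 := h1.comp (t := TotalSpace.proj ⁻¹' U) hX (fun y hy ↦ hy)
  have h3 := (contMDiff_snd_tangentBundle_modelSpace ℝ 𝓘(ℝ) (n := ∞)).comp_contMDiffOn h2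
  refine ContMDiffOn.congr h3 fun y hy ↦ ?_
  simp only [Function.comp, tangentMapWithin, mfderivWithin_of_isOpen hU hy]
  rfl

lemma df_add (hu : MDifferentiableAt (𝓡 7) 𝓘(ℝ) u x) (hv : MDifferentiableAt (𝓡 7) 𝓘(ℝ) v x)
    (w : TangentSpace (𝓡 7) x) : df (fun y ↦ u y + v y) x w = df u x w + df v x w := by
  rw [df, mvfderiv_fun_add hu hv]; rfl

lemma df_mul (hu : MDifferentiableAt (𝓡 7) 𝓘(ℝ) u x) (hv : MDifferentiableAt (𝓡 7) 𝓘(ℝ) v x)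
    (w : TangentSpace (𝓡 7) x) :
    df (fun y ↦ u y * v y) x w = u x * df v x w + v x * df u x w := by
  rw [df, mvfderiv_fun_mul hu hv]; rfl

lemma df_const (c : ℝ) (w : TangentSpace (𝓡 7) x) : df (fun _ : M ↦ c) x w = 0 := by
  rw [df, mvfderiv_const]; rfl

lemma df_const_mul (c : ℝ) (hu : MDifferentiableAt (𝓡 7) 𝓘(ℝ) u x) (w : TangentSpace (𝓡 7) x) :
    df (fun y ↦ c * u y) x w = c * df u x w := by
  rw [df_mul mdifferentiableAt_const hu, df_const]; ring

lemma df_sum {ι : Type*} {s : Finset ι} {f : ι → M → ℝ}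
    (h : ∀ i ∈ s, MDifferentiableAt (𝓡 7) 𝓘(ℝ) (f i) x) (w : TangentSpace (𝓡 7) x) :
    df (fun y ↦ ∑ i ∈ s, f i y) x w = ∑ i ∈ s, df (f i) x w := by
  classical
  induction s using Finset.induction_on with
  | empty => simpa using df_const 0 w
  | insert i s hi ih =>
    simp only [Finset.sum_insert hi]
    rw [df_add (h i (by simp)), ih fun j hj ↦ h j (by simp [hj])]
    have : ContMDiffAt (𝓡 7) 𝓘(ℝ) 1 (fun y : M ↦ (0:ℝ)) x := contMDiffAt_const
    have h' : ∀ i ∈ s, MDifferentiableAt (𝓡 7) 𝓘(ℝ) (f i) x := fun j hj ↦ h j (by simp [hj])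
    clear ih h hi
    induction s using Finset.induction_on with
    | empty => simpa using mdifferentiableAt_const
    | insert j s hj ih =>
      simp only [Finset.sum_insert hj]
      exact (h' j (by simp)).add (ih fun k hk ↦ h' k (by simp [hk]))

lemma df_congr (h : ∀ᶠ y in 𝓝 x, u y = v y) : df u x = df v x := by
  have h' : u =ᶠ[𝓝 x] v := h
  unfold df mvfderiv
  rw [h'.mfderiv_eq]
  congr 1

lemma df_congr_on (hU : IsOpen U) (hx : x ∈ U) (h : ∀ y ∈ U, u y = v y) : df u x = df v x :=
  df_congr (eventually_of_mem (hU.mem_nhds hx) h)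

lemma bracket_congr {X' Y' : VField M} (hU : IsOpen U) (hx : x ∈ U) (hX : ∀ y ∈ U, X y = X' y)
    (hY : ∀ y ∈ U, Y y = Y' y) :
    VectorField.mlieBracket (𝓡 7) X Y x = VectorField.mlieBracket (𝓡 7) X' Y' x :=
  Filter.EventuallyEq.mlieBracket_vectorField_eq (eventually_of_mem (hU.mem_nhds hx) hX)
    (eventually_of_mem (hU.mem_nhds hx) hY)

lemma SmoothOn.bracket (hU : IsOpen U) (hX : SmoothOn X U) (hY : SmoothOn Y U) :
    SmoothOn (VectorField.mlieBracket (𝓡 7) X Y) U := by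
  intro y hy
  apply ContMDiffAt.contMDiffWithinAt
  have hi : IsManifold (𝓡 7) (((⊤ : ℕ∞) : WithTop ℕ∞) + 1) M := by simpa using ‹IsManifold (𝓡 7) ∞ M›
  have hi2 : IsManifold (𝓡 7) (minSmoothness ℝ 2) M := by
    simp only [minSmoothness_of_isRCLikeNormedField]; infer_instance
  exact ContMDiffAt.mlieBracket_vectorField (m := ⊤) (n := ⊤) (hX.contMDiffAt hU hy)
    (hY.contMDiffAt hU hy) (by simp)

lemma bracket_smul_right (hu : MDifferentiableAt (𝓡 7) 𝓘(ℝ) u x) (hY : DiffAt Y x) :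
    VectorField.mlieBracket (𝓡 7) X (fun y ↦ u y • Y y) x
      = df u x (X x) • Y x + u x • VectorField.mlieBracket (𝓡 7) X Y x :=
  VectorField.mlieBracket_smul_right hu hY

lemma bracket_smul_left (hu : MDifferentiableAt (𝓡 7) 𝓘(ℝ) u x) (hX : DiffAt X x) :
    VectorField.mlieBracket (𝓡 7) (fun y ↦ u y • X y) Y x
      = -df u x (Y x) • X x + u x • VectorField.mlieBracket (𝓡 7) X Y x :=
  VectorField.mlieBracket_smul_left hu hX

lemma bracket_jacobi (hU : IsOpen U) (hX : SmoothOn X U) (hY : SmoothOn Y U) (hZ : SmoothOn Z U)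
    (hx : x ∈ U) :
    VectorField.mlieBracket (𝓡 7) X (VectorField.mlieBracket (𝓡 7) Y Z) x
      = VectorField.mlieBracket (𝓡 7) (VectorField.mlieBracket (𝓡 7) X Y) Z x
        + VectorField.mlieBracket (𝓡 7) Y (VectorField.mlieBracket (𝓡 7) X Z) x := by
  have hi : IsManifold (𝓡 7) (minSmoothness ℝ 3) M := by
    simp only [minSmoothness_of_isRCLikeNormedField]; infer_instance
  have h2 : minSmoothness ℝ 2 ≤ (∞ : WithTop ℕ∞) := by
    simp only [minSmoothness_of_isRCLikeNormedField]
    exact WithTop.coe_le_coe.2 (le_top (a := (2 : ℕ∞)))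
  exact VectorField.leibniz_identity_mlieBracket_apply ((hX.contMDiffAt hU hx).of_le h2)
    ((hY.contMDiffAt hU hx).of_le h2) ((hZ.contMDiffAt hU hx).of_le h2)

/-- The bracket of two vector fields acts on functions as the commutator of the derivations. -/
lemma df_bracket (hU : IsOpen U) (hX : SmoothOn X U) (hY : SmoothOn Y U) (hu : FunOn u U)
    (hx : x ∈ U) (hZ : SmoothOn Z U) (hZx : Z x ≠ 0) :
    df u x (VectorField.mlieBracket (𝓡 7) X Y x)
      = df (fun y ↦ df u y (Y y)) x (X x) - df (fun y ↦ df u y (X y)) x (Y x) := by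
  have huZ := SmoothOn.smul hu hZ
  -- Jacobi for X, Y and uZ: after the Leibniz rule and Jacobi for X, Y, Z, all that survives is an
  -- identity between multiples of Z x, and Z x ≠ 0 allows its coefficient to be read off.
  have key := bracket_jacobi hU hX hY huZ hx
  have e (W : VField M) (y : M) (hy : y ∈ U) :
      VectorField.mlieBracket (𝓡 7) W (fun y ↦ u y • Z y) y
      = df u y (W y) • Z y + u y • VectorField.mlieBracket (𝓡 7) W Z y :=
    bracket_smul_right (hu.mdiffAt hU hy) (hZ.diffAt hU hy)
  have e2 (V W : VField M) (hV : SmoothOn V U) (hW : SmoothOn W U) :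
      VectorField.mlieBracket (𝓡 7) V (VectorField.mlieBracket (𝓡 7) W (fun y ↦ u y • Z y)) x
      = df (fun y ↦ df u y (W y)) x (V x) • Z x
        + df u x (W x) • VectorField.mlieBracket (𝓡 7) V Z x
        + (df u x (V x) • VectorField.mlieBracket (𝓡 7) W Z x
        + u x • VectorField.mlieBracket (𝓡 7) V (VectorField.mlieBracket (𝓡 7) W Z) x) := by
    rw [bracket_congr hU hx (fun _ _ ↦ rfl) (e W)]
    have hd := hu.df hU hW
    have h1 := SmoothOn.smul hd hZ
    have hb := SmoothOn.bracket hU hW hZ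
    have h2 := SmoothOn.smul hu hb
    have := VectorField.mlieBracket_add_right (V := V) (h1.diffAt hU hx) (h2.diffAt hU hx)
    refine this.trans ?_
    rw [bracket_smul_right (hd.mdiffAt hU hx) (hZ.diffAt hU hx),
      bracket_smul_right (hu.mdiffAt hU hx) (hb.diffAt hU hx)]
  rw [e2 X Y hX hY, e2 Y X hY hX, e _ x hx, bracket_jacobi hU hX hY hZ hx] at key
  have : (df u x (VectorField.mlieBracket (𝓡 7) X Y x)
      - (df (fun y ↦ df u y (Y y)) x (X x) - df (fun y ↦ df u y (X y)) x (Y x))) • Z x = 0 := by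
    rw [sub_smul, sub_smul]
    rw [← sub_eq_zero] at key
    rw [← neg_eq_zero, ← key]
    module
  rcases smul_eq_zero.1 this with h | h
  · linarith
  · exact absurd h hZx

end Calculus

end QuaternionicContact

/-! ### Covariant derivatives, and tensoriality of the curvature. -/

namespace QuaternionicContact

section Connection

variable {M : Type*} [TopologicalSpace M] [ChartedSpace (EuclideanSpace ℝ (Fin 7)) M]
  [IsManifold (𝓡 7) ∞ M]
  (cov : CovariantDerivative (𝓡 7) (EuclideanSpace ℝ (Fin 7)) (fun x : M ↦ TangentSpace (𝓡 7) x))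

open QCStructure

variable {cov} {U : Set M} {u v : M → ℝ} {X Y Z X' Y' Z' : VField M} {x : M}

lemma cov_congr (hU : IsOpen U) (hx : x ∈ U) (hX : DiffAt X x) (hX' : DiffAt X' x)
    (h : ∀ y ∈ U, X y = X' y) : cov X x = cov X' x :=
  cov.isCovariantDerivativeOnUniv.congr_of_eventuallyEq hX hX' univ_mem
    (eventually_of_mem (hU.mem_nhds hx) h)

lemma cov_add (hX : DiffAt X x) (hY : DiffAt Y x) (w : TangentSpace (𝓡 7) x) :
    cov (fun y ↦ X y + Y y) x w = cov X x w + cov Y x w := by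
  have := cov.isCovariantDerivativeOnUniv.add hX hY
  exact congrArg (fun L ↦ L w) this

lemma cov_smul (hu : MDifferentiableAt (𝓡 7) 𝓘(ℝ) u x) (hX : DiffAt X x)
    (w : TangentSpace (𝓡 7) x) :
    cov (fun y ↦ u y • X y) x w = u x • cov X x w + df u x w • X x := by
  have := cov.isCovariantDerivativeOnUniv.leibniz hX hu
  exact congrArg (fun L ↦ L w) this

lemma cov_const_smul (c : ℝ) (hX : DiffAt X x) (w : TangentSpace (𝓡 7) x) :
    cov (fun y ↦ c • X y) x w = c • cov X x w := by
  rw [cov_smul (u := fun _ ↦ c) mdifferentiableAt_const hX, df_const]; simp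

lemma DiffAt.const_smul (c : ℝ) (hX : DiffAt X x) : DiffAt (fun y ↦ c • X y) x :=
  MDifferentiableAt.smul_const_section hX

lemma cov_neg (hX : DiffAt X x) (w : TangentSpace (𝓡 7) x) :
    cov (fun y ↦ -X y) x w = -cov X x w := by
  have := cov_const_smul (cov := cov) (-1) hX w
  simpa only [neg_smul, one_smul] using this

lemma cov_sub (hX : DiffAt X x) (hY : DiffAt Y x) (w : TangentSpace (𝓡 7) x) :
    cov (fun y ↦ X y - Y y) x w = cov X x w - cov Y x w := by
  have h : DiffAt (fun y ↦ - Y y) x := mdifferentiableAt_neg_section hY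
  have := cov_add (cov := cov) hX h w
  rw [cov_neg hY] at this
  simpa only [sub_eq_add_neg] using this

lemma cov_sum {ι : Type*} {s : Finset ι} {W : ι → VField M} (h : ∀ i ∈ s, DiffAt (W i) x)
    (w : TangentSpace (𝓡 7) x) :
    cov (fun y ↦ ∑ i ∈ s, W i y) x w = ∑ i ∈ s, cov (W i) x w := by
  classical
  induction s using Finset.induction_on with
  | empty =>
    have := congrArg (fun L ↦ L x w) (cov.zero)
    exact this
  | insert i s hi ih =>
    simp only [Finset.sum_insert hi]
    rw [cov_add (h i (by simp)), ih fun j hj ↦ h j (by simp [hj])]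
    exact MDifferentiableAt.sum_section fun j hj ↦ h j (by simp [hj])

lemma nabla_smul_left (u : M → ℝ) (x : M) :
    nabla cov (fun y ↦ u y • X y) Y x = u x • nabla cov X Y x := by
  simp [nabla]

/-- Smoothness of the connection is a statement about globally smooth sections, so the local field
is first multiplied by a bump function that is one near the point and supported in `U`; locality of
the connection removes the bump again. -/
lemma SmoothOn.nabla [T2Space M] (hc : CovariantDerivative.ContMDiffCovariantDerivative cov ∞)
    (hU : IsOpen U) (hX : SmoothOn X U) (hY : SmoothOn Y U) : SmoothOn (nabla cov X Y) U := by
  intro x hx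
  apply ContMDiffAt.contMDiffWithinAt
  obtain ⟨φ, -, hφ⟩ := (SmoothBumpFunction.nhds_basis_tsupport (I := 𝓡 7) x).mem_iff.1
    (hU.mem_nhds hx)
  have hg : ContMDiff (𝓡 7) ((𝓡 7).prod 𝓘(ℝ, EuclideanSpace ℝ (Fin 7))) ∞
      (T% (fun y ↦ φ y • Y y)) := by
    exact ContMDiffOn.smul_section_of_tsupport φ.contMDiff.contMDiffOn hU hφ hY
  have h1 := hc.contMDiff.contMDiff (σ := fun y ↦ φ y • Y y) (contMDiffOn_univ.2 hg)
  have h2 := (contMDiffOn_univ.1 h1).contMDiffAt (x := x)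
  have h3 := h2.clm_bundle_apply (hX.contMDiffAt hU hx)
  refine h3.congr_of_eventuallyEq ?_
  have := φ.eventuallyEq_one.eventuallyEq_nhds
  filter_upwards [this, hU.mem_nhds hx] with y hy hyU
  have : cov (fun y ↦ φ y • Y y) y = cov Y y := by
    refine cov.isCovariantDerivativeOnUniv.congr_of_eventuallyEq
      (hg.contMDiffAt.mdifferentiableAt (by simp)) (hY.diffAt hU hyU) univ_mem ?_
    filter_upwards [hy] with z hz
    simp [hz]
  simp only [QCStructure.nabla]
  congr 1
  rw [← this]

lemma torsion_eq (hX : DiffAt X x) (hY : DiffAt Y x) :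
    cov.torsion x (X x) (Y x) = nabla cov X Y x - nabla cov Y X x
      - VectorField.mlieBracket (𝓡 7) X Y x :=
  cov.torsion_apply hX hY

lemma curvature_swap (x : M) : curvature cov X Y Z x = -curvature cov Y X Z x := by
  have : VectorField.mlieBracket (𝓡 7) X Y x = -VectorField.mlieBracket (𝓡 7) Y X x :=
    VectorField.mlieBracket_swap_apply
  simp only [curvature, Pi.sub_apply, nabla, this, map_neg]
  abel

variable [T2Space M] (hc : CovariantDerivative.ContMDiffCovariantDerivative cov ∞)
  (hU : IsOpen U)

include hc hU

omit hc in
-- The mixed first-order terms are symmetric in X and Y and therefore drop out of the curvature;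
-- only the second derivative of `u` is left to be matched with the bracket term.
lemma cov_cov_smul (hYZ : SmoothOn (nabla cov Y Z) U) (hY : SmoothOn Y U)
    (hZ : SmoothOn Z U) (hu : FunOn u U) (hx : x ∈ U) :
    nabla cov X (nabla cov Y (fun y ↦ u y • Z y)) x
      = u x • nabla cov X (nabla cov Y Z) x + df u x (X x) • nabla cov Y Z x
        + (df u x (Y x) • nabla cov X Z x + df (fun y ↦ df u y (Y y)) x (X x) • Z x) := by
  have e : ∀ y ∈ U, nabla cov Y (fun y ↦ u y • Z y) y
      = u y • nabla cov Y Z y + df u y (Y y) • Z y := fun y hy ↦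
    cov_smul (hu.mdiffAt hU hy) (hZ.diffAt hU hy) _
  have h1 := SmoothOn.smul hu hYZ
  have h2 := SmoothOn.smul (hu.df hU hY) hZ
  have h3 := h1.add h2
  rw [nabla, cov_congr hU hx ((h3.congr e).diffAt hU hx) (h3.diffAt hU hx) e,
    cov_add (h1.diffAt hU hx) (h2.diffAt hU hx),
    cov_smul (hu.mdiffAt hU hx) (hYZ.diffAt hU hx),
    cov_smul ((hu.df hU hY).mdiffAt hU hx) (hZ.diffAt hU hx)]
  rfl

lemma curvature_smul_third (hX : SmoothOn X U) (hY : SmoothOn Y U) (hZ : SmoothOn Z U)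
    (hu : FunOn u U) (hx : x ∈ U) :
    curvature cov X Y (fun y ↦ u y • Z y) x = u x • curvature cov X Y Z x := by
  have e1 := cov_cov_smul (X := X) hU (SmoothOn.nabla hc hU hY hZ) hY hZ hu hx
  have e2 := cov_cov_smul (X := Y) hU (SmoothOn.nabla hc hU hX hZ) hX hZ hu hx
  have e3 : nabla cov (VectorField.mlieBracket (𝓡 7) X Y) (fun y ↦ u y • Z y) x
      = u x • nabla cov (VectorField.mlieBracket (𝓡 7) X Y) Z x
        + df u x (VectorField.mlieBracket (𝓡 7) X Y x) • Z x :=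
    cov_smul (hu.mdiffAt hU hx) (hZ.diffAt hU hx) _
  simp only [curvature, Pi.sub_apply]
  rw [e1, e2, e3]
  -- `df_bracket` needs a field that does not vanish at x. Z serves when it can; otherwise the terms
  -- in question carry the factor Z x.
  by_cases hz : Z x = 0
  · rw [hz]; module
  · rw [df_bracket hU hX hY hu hx hZ hz]; module

lemma curvature_smul_first (hX : SmoothOn X U) (hZ : SmoothOn Z U) (hu : FunOn u U) (hx : x ∈ U) :
    curvature cov (fun y ↦ u y • X y) Y Z x = u x • curvature cov X Y Z x := by
  have hXZ := SmoothOn.nabla hc hU hX hZ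
  have e2 : nabla cov Y (nabla cov (fun y ↦ u y • X y) Z) x
      = u x • nabla cov Y (nabla cov X Z) x + df u x (Y x) • nabla cov X Z x := by
    have e : nabla cov (fun y ↦ u y • X y) Z = fun y ↦ u y • nabla cov X Z y :=
      funext fun y ↦ nabla_smul_left u y
    rw [e]
    exact cov_smul (hu.mdiffAt hU hx) (hXZ.diffAt hU hx) _
  have e3 : nabla cov (VectorField.mlieBracket (𝓡 7) (fun y ↦ u y • X y) Y) Z x
      = -df u x (Y x) • nabla cov X Z x
        + u x • nabla cov (VectorField.mlieBracket (𝓡 7) X Y) Z x := by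
    simp only [nabla]
    rw [bracket_smul_left (hu.mdiffAt hU hx) (hX.diffAt hU hx), map_add, map_smul, map_smul]
  simp only [curvature, Pi.sub_apply]
  rw [e2, e3, nabla_smul_left]
  module

lemma curvature_add_third (hX : SmoothOn X U) (hY : SmoothOn Y U) (hZ : SmoothOn Z U)
    (hZ' : SmoothOn Z' U) (hx : x ∈ U) :
    curvature cov X Y (fun y ↦ Z y + Z' y) x = curvature cov X Y Z x + curvature cov X Y Z' x := by
  have e (X Y : VField M) (hX : SmoothOn X U) (hY : SmoothOn Y U) :
      nabla cov X (nabla cov Y (fun y ↦ Z y + Z' y)) x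
      = nabla cov X (nabla cov Y Z) x + nabla cov X (nabla cov Y Z') x := by
    have e : ∀ y ∈ U, nabla cov Y (fun y ↦ Z y + Z' y) y
        = nabla cov Y Z y + nabla cov Y Z' y := fun y hy ↦
      cov_add (hZ.diffAt hU hy) (hZ'.diffAt hU hy) _
    have h1 := SmoothOn.nabla hc hU hY hZ
    have h2 := SmoothOn.nabla hc hU hY hZ'
    have h3 := h1.add h2
    rw [nabla, cov_congr hU hx ((h3.congr e).diffAt hU hx) (h3.diffAt hU hx) e,
      cov_add (h1.diffAt hU hx) (h2.diffAt hU hx)]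
    rfl
  have e3 : nabla cov (VectorField.mlieBracket (𝓡 7) X Y) (fun y ↦ Z y + Z' y) x
      = nabla cov (VectorField.mlieBracket (𝓡 7) X Y) Z x
        + nabla cov (VectorField.mlieBracket (𝓡 7) X Y) Z' x :=
    cov_add (hZ.diffAt hU hx) (hZ'.diffAt hU hx) _
  simp only [curvature, Pi.sub_apply]
  rw [e X Y hX hY, e Y X hY hX, e3]
  abel

lemma curvature_add_first (hX : SmoothOn X U) (hX' : SmoothOn X' U) (hZ : SmoothOn Z U)
    (hx : x ∈ U) :
    curvature cov (fun y ↦ X y + X' y) Y Z x = curvature cov X Y Z x + curvature cov X' Y Z x := by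
  have e2 : nabla cov Y (nabla cov (fun y ↦ X y + X' y) Z) x
      = nabla cov Y (nabla cov X Z) x + nabla cov Y (nabla cov X' Z) x := by
    have e : nabla cov (fun y ↦ X y + X' y) Z = fun y ↦ nabla cov X Z y + nabla cov X' Z y :=
      funext fun y ↦ by simp [nabla]
    rw [e]
    exact cov_add ((SmoothOn.nabla hc hU hX hZ).diffAt hU hx)
      ((SmoothOn.nabla hc hU hX' hZ).diffAt hU hx) _
  have e3 : VectorField.mlieBracket (𝓡 7) (fun y ↦ X y + X' y) Y x
      = VectorField.mlieBracket (𝓡 7) X Y x + VectorField.mlieBracket (𝓡 7) X' Y x :=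
    VectorField.mlieBracket_add_left (hX.diffAt hU hx) (hX'.diffAt hU hx)
  simp only [curvature, Pi.sub_apply]
  rw [e2]
  simp only [nabla, e3, map_add]
  abel

lemma curvature_congr (hX : SmoothOn X U) (hY : SmoothOn Y U) (hZ : SmoothOn Z U)
    (hXX : ∀ y ∈ U, X y = X' y) (hYY : ∀ y ∈ U, Y y = Y' y) (hZZ : ∀ y ∈ U, Z y = Z' y)
    (hx : x ∈ U) : curvature cov X Y Z x = curvature cov X' Y' Z' x := by
  have hX' : SmoothOn X' U := hX.congr fun y hy ↦ (hXX y hy).symm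
  have hY' : SmoothOn Y' U := hY.congr fun y hy ↦ (hYY y hy).symm
  have hZ' : SmoothOn Z' U := hZ.congr fun y hy ↦ (hZZ y hy).symm
  have e (A B : VField M) (hAB : ∀ y ∈ U, A y = B y) (hA : SmoothOn A U) (hB : SmoothOn B U)
      (y : M) (hy : y ∈ U) : nabla cov A Z y = nabla cov B Z' y := by
    rw [nabla, nabla, cov_congr hU hy (hZ.diffAt hU hy) (hZ'.diffAt hU hy) hZZ, hAB y hy]
  have e2 (A B C D : VField M) (hAB : ∀ y ∈ U, A y = B y) (hA : SmoothOn A U) (hB : SmoothOn B U)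
      (hCD : C x = D x) : nabla cov C (nabla cov A Z) x = nabla cov D (nabla cov B Z') x := by
    rw [nabla, nabla, cov_congr hU hx ((SmoothOn.nabla hc hU hA hZ).diffAt hU hx)
      ((SmoothOn.nabla hc hU hB hZ').diffAt hU hx) (e A B hAB hA hB), hCD]
  simp only [curvature, Pi.sub_apply]
  rw [e2 Y Y' X X' hYY hY hY' (hXX x hx), e2 X X' Y Y' hXX hX hX' (hYY x hx)]
  congr 1
  rw [nabla, nabla, cov_congr hU hx (hZ.diffAt hU hx) (hZ'.diffAt hU hx) hZZ,
    bracket_congr hU hx hXX hYY]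

/-- The curvature of a frame expansion. -/
lemma curvature_sum {ι : Type*} [Fintype ι] {E : ι → VField M} (hE : ∀ i, SmoothOn (E i) U)
    {a b c : ι → M → ℝ} (ha : ∀ i, FunOn (a i) U) (hb : ∀ i, FunOn (b i) U)
    (hcc : ∀ i, FunOn (c i) U) (hx : x ∈ U) :
    curvature cov (fun y ↦ ∑ i, a i y • E i y) (fun y ↦ ∑ i, b i y • E i y)
      (fun y ↦ ∑ i, c i y • E i y) x
      = ∑ i, ∑ j, ∑ k, (a i x * b j x * c k x) • curvature cov (E i) (E j) (E k) x := by
  classical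
  have hz : SmoothOn (fun _ : M ↦ (0 : TangentSpace (𝓡 7) _)) U := by
    have := SmoothOn.sum (U := U) (s := (∅ : Finset ι)) (W := E) (by simp)
    simpa using this
  have h0 (X Y : VField M) : curvature cov X Y (fun _ ↦ 0) x = 0 := by
    have h (X : VField M) : nabla cov X (fun _ ↦ 0) = fun _ ↦ 0 := by
      funext y
      exact congrArg (fun L ↦ L y (X y)) cov.zero
    simp only [curvature, Pi.sub_apply, h, sub_zero]
  have h0' (Y Z : VField M) : curvature cov (fun _ ↦ 0) Y Z x = 0 := by
    have h (X : VField M) : nabla cov X (fun _ ↦ 0) = fun _ ↦ 0 := by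
      funext y
      exact congrArg (fun L ↦ L y (X y)) cov.zero
    have h' (X : VField M) : nabla cov (fun _ ↦ 0) X = fun _ ↦ 0 := by
      funext y
      simp [nabla]
    have hb : VectorField.mlieBracket (𝓡 7) (fun _ ↦ 0) Y = fun _ ↦ 0 :=
      VectorField.mlieBracket_zero_left
    simp only [curvature, Pi.sub_apply, hb, h', h, sub_zero]
  have h3 (X Y : VField M) (hX : SmoothOn X U) (hY : SmoothOn Y U) (s : Finset ι) :
      curvature cov X Y (fun y ↦ ∑ i ∈ s, c i y • E i y) x
        = ∑ k ∈ s, c k x • curvature cov X Y (E k) x := by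
    induction s using Finset.induction_on with
    | empty => simpa using h0 X Y
    | insert k s hk ih =>
      simp only [Finset.sum_insert hk]
      rw [curvature_add_third hc hU hX hY (SmoothOn.smul (hcc k) (hE k))
        (SmoothOn.sum fun i _ ↦ SmoothOn.smul (hcc i) (hE i)) hx, ih,
        curvature_smul_third hc hU hX hY (hE k) (hcc k) hx]
  have h1 (Y Z : VField M) (hY : SmoothOn Y U) (hZ : SmoothOn Z U) {a : ι → M → ℝ}
      (ha : ∀ i, FunOn (a i) U) (s : Finset ι) :
      curvature cov (fun y ↦ ∑ i ∈ s, a i y • E i y) Y Z x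
        = ∑ i ∈ s, a i x • curvature cov (E i) Y Z x := by
    induction s using Finset.induction_on with
    | empty => simpa using h0' Y Z
    | insert k s hk ih =>
      simp only [Finset.sum_insert hk]
      rw [curvature_add_first hc hU (SmoothOn.smul (ha k) (hE k))
        (SmoothOn.sum fun i _ ↦ SmoothOn.smul (ha i) (hE i)) hZ hx, ih,
        curvature_smul_first hc hU (hE k) hZ (ha k) hx]
  have hS {a : ι → M → ℝ} (ha : ∀ i, FunOn (a i) U) :
      SmoothOn (fun y ↦ ∑ i, a i y • E i y) U :=
    SmoothOn.sum fun i _ ↦ SmoothOn.smul (ha i) (hE i)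
  rw [h1 _ _ (hS hb) (hS hcc) ha]
  refine Finset.sum_congr rfl fun i _ ↦ ?_
  -- Linearity in the second slot is linearity in the first slot after a swap.
  rw [curvature_swap, h1 _ _ (hE i) (hS hcc) hb, ← Finset.sum_neg_distrib, Finset.smul_sum]
  refine Finset.sum_congr rfl fun j _ ↦ ?_
  rw [← smul_neg, ← curvature_swap, h3 _ _ (hE i) (hE j), Finset.smul_sum, Finset.smul_sum]
  refine Finset.sum_congr rfl fun k _ ↦ ?_
  rw [smul_smul, smul_smul, mul_assoc]

end Connection

end QuaternionicContact

/-! ### Torsion, the first Bianchi identity, and the asymmetry of the Hessian. -/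

namespace QuaternionicContact

section Identities

variable {M : Type*} [TopologicalSpace M] [ChartedSpace (EuclideanSpace ℝ (Fin 7)) M]
  [IsManifold (𝓡 7) ∞ M] [T2Space M]
  {cov : CovariantDerivative (𝓡 7) (EuclideanSpace ℝ (Fin 7)) (fun x : M ↦ TangentSpace (𝓡 7) x)}

open QCStructure

variable {U : Set M} {u v : M → ℝ} {X Y Z W : VField M} {x : M}

variable (cov) in
/-- The torsion of two vector fields. -/
def torsionField (X Y : VField M) : VField M := fun y ↦ cov.torsion y (X y) (Y y)

variable (hc : CovariantDerivative.ContMDiffCovariantDerivative cov ∞) (hU : IsOpen U)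

include hc hU

lemma SmoothOn.torsionField (hX : SmoothOn X U) (hY : SmoothOn Y U) :
    SmoothOn (torsionField cov X Y) U :=
  (((SmoothOn.nabla hc hU hX hY).sub (SmoothOn.nabla hc hU hY hX)).sub
    (SmoothOn.bracket hU hX hY)).congr fun _ hy ↦ torsion_eq (hX.diffAt hU hy) (hY.diffAt hU hy)

/-- The first Bianchi identity for a connection with torsion. -/
lemma bianchi (hX : SmoothOn X U) (hY : SmoothOn Y U) (hZ : SmoothOn Z U) (hx : x ∈ U) :
    curvature cov X Y Z x + curvature cov Y Z X x + curvature cov Z X Y x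
      = (cov.torsion x (X x) (VectorField.mlieBracket (𝓡 7) Y Z x)
          + nabla cov X (torsionField cov Y Z) x)
        + (cov.torsion x (Y x) (VectorField.mlieBracket (𝓡 7) Z X x)
          + nabla cov Y (torsionField cov Z X) x)
        + (cov.torsion x (Z x) (VectorField.mlieBracket (𝓡 7) X Y x)
          + nabla cov Z (torsionField cov X Y) x) := by
  -- ∇_X(T(Y, Z)) contains −∇_X[Y, Z], which T(X, [Y, Z]) cancels; that torsion also supplies
  -- −∇_{[Y,Z]}X and −[X, [Y, Z]]. In the cyclic sum the former completes the curvatures and the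
  -- latter vanishes by Jacobi.
  have e1 (X Y Z : VField M) (hX : SmoothOn X U) (hY : SmoothOn Y U) (hZ : SmoothOn Z U) :
      nabla cov X (torsionField cov Y Z) x = nabla cov X (nabla cov Y Z) x
        - nabla cov X (nabla cov Z Y) x - nabla cov X (VectorField.mlieBracket (𝓡 7) Y Z) x := by
    have a := SmoothOn.nabla hc hU hY hZ
    have b := SmoothOn.nabla hc hU hZ hY
    have c := SmoothOn.bracket hU hY hZ
    rw [nabla, cov_congr hU hx ((SmoothOn.torsionField hc hU hY hZ).diffAt hU hx)
      (((a.sub b).sub c).diffAt hU hx)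
      (fun y hy ↦ torsion_eq (hY.diffAt hU hy) (hZ.diffAt hU hy)),
      cov_sub ((a.sub b).diffAt hU hx) (c.diffAt hU hx), cov_sub (a.diffAt hU hx) (b.diffAt hU hx)]
    rfl
  have e2 (X Y Z : VField M) (hX : SmoothOn X U) (hY : SmoothOn Y U) (hZ : SmoothOn Z U) :=
    torsion_eq (cov := cov) (hX.diffAt hU hx) ((SmoothOn.bracket hU hY hZ).diffAt hU hx)
  have j := bracket_jacobi hU hX hY hZ hx
  have s1 : VectorField.mlieBracket (𝓡 7) Z (VectorField.mlieBracket (𝓡 7) X Y) x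
      = -VectorField.mlieBracket (𝓡 7) (VectorField.mlieBracket (𝓡 7) X Y) Z x :=
    VectorField.mlieBracket_swap_apply
  have s2 : VectorField.mlieBracket (𝓡 7) Y (VectorField.mlieBracket (𝓡 7) Z X) x
      = -VectorField.mlieBracket (𝓡 7) Y (VectorField.mlieBracket (𝓡 7) X Z) x := by
    rw [VectorField.mlieBracket_swap_apply, VectorField.mlieBracket_swap (V := Z)]
    have h := SmoothOn.bracket hU hX hZ
    have := VectorField.mlieBracket_const_smul_left (W := Y) (c := (-1 : ℝ)) (h.diffAt hU hx)
    rw [show (-VectorField.mlieBracket (𝓡 7) X Z) = (-1 : ℝ) • VectorField.mlieBracket (𝓡 7) X Z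
      by simp, this, VectorField.mlieBracket_swap_apply]
    simp
  rw [e1 X Y Z hX hY hZ, e1 Y Z X hY hZ hX, e1 Z X Y hZ hX hY, e2 X Y Z hX hY hZ,
    e2 Y Z X hY hZ hX, e2 Z X Y hZ hX hY, j, s1, s2]
  simp only [curvature, Pi.sub_apply]
  abel

lemma FunOn.hess (hu : FunOn u U) (hX : SmoothOn X U) (hY : SmoothOn Y U) :
    FunOn (hess cov u X Y) U :=
  ((hu.df hU hY).df hU hX).sub (hu.df hU (SmoothOn.nabla hc hU hX hY))

variable (hW : SmoothOn W U) (hWx : ∀ y ∈ U, W y ≠ 0)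

include hW hWx

omit hc in
-- The second derivatives differ by [X, Y]u, the first-order terms by ∇_X Y − ∇_Y X. The field `W`
-- is auxiliary: it provides the nonzero vector for `df_bracket`.
lemma hess_sub_hess (hu : FunOn u U) (hX : SmoothOn X U) (hY : SmoothOn Y U) (hx : x ∈ U) :
    hess cov u X Y x - hess cov u Y X x = - df u x (cov.torsion x (X x) (Y x)) := by
  rw [torsion_eq (hX.diffAt hU hx) (hY.diffAt hU hx), map_sub, map_sub,
    df_bracket hU hX hY hu hx hW (hWx x hx)]
  simp only [hess]
  ring

end Identities

end QuaternionicContact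

/-! ### Linear algebra in a local frame: metric, horizontal space, quaternionic quadruples. -/

namespace QuaternionicContact

namespace QCStructure

variable {M : Type*} [TopologicalSpace M] [ChartedSpace (EuclideanSpace ℝ (Fin 7)) M]
  [IsManifold (𝓡 7) ∞ M] {A : QCStructure M}

section Metric

variable {x : M}

lemma inner_sum_left {ι : Type*} (s : Finset ι) (f : ι → TangentSpace (𝓡 7) x)
    (w : TangentSpace (𝓡 7) x) :
    A.g.inner x (∑ i ∈ s, f i) w = ∑ i ∈ s, A.g.inner x (f i) w := by
  simp [map_sum]

lemma inner_smul_left (c : ℝ) (v w : TangentSpace (𝓡 7) x) :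
    A.g.inner x (c • v) w = c * A.g.inner x v w := by
  simp

lemma inner_add_left (u v w : TangentSpace (𝓡 7) x) :
    A.g.inner x (u + v) w = A.g.inner x u w + A.g.inner x v w := by
  simp

lemma inner_sub_left (u v w : TangentSpace (𝓡 7) x) :
    A.g.inner x (u - v) w = A.g.inner x u w - A.g.inner x v w := by
  simp

lemma inner_neg_left (v w : TangentSpace (𝓡 7) x) :
    A.g.inner x (-v) w = -A.g.inner x v w := by
  simp

lemma inner_self_nonneg (v : TangentSpace (𝓡 7) x) : 0 ≤ A.g.inner x v v := by
  by_cases h : v = 0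
  · simp [h]
  · exact (A.g.pos x v h).le

lemma inner_self_eq_zero {v : TangentSpace (𝓡 7) x} (h : A.g.inner x v v = 0) : v = 0 := by
  by_contra hv
  exact (A.g.pos x v hv).ne' h

end Metric

variable (F : A.toQCData.LocalFrame) {x : M} (hx : x ∈ F.dom)

/-- The seven vector fields of a local frame. -/
def _root_.QuaternionicContact.QCData.LocalFrame.fr {D : QCData M} (F : D.LocalFrame) :
    Fin 4 ⊕ Fin 3 → VField M := Sum.elim F.e F.ξ

lemma smooth_fr (i : Fin 4 ⊕ Fin 3) : SmoothOn (F.fr i) F.dom := by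
  rcases i with a | s
  · exact F.smooth_e a
  · exact F.smooth_ξ s

include hx

lemma inner_e_ξ (a : Fin 4) (s : Fin 3) : A.g.inner x (F.e a x) (F.ξ s x) = 0 := by
  rw [A.g.symm]; exact F.g_ξ_H x hx s _ (F.e_mem x hx a)

lemma fr_orthonormal (i j : Fin 4 ⊕ Fin 3) :
    A.g.inner x (F.fr i x) (F.fr j x) = if i = j then 1 else 0 := by
  rcases i with a | s <;> rcases j with b | t
  · simpa [QCData.LocalFrame.fr] using F.e_orthonormal x hx a b
  · simpa [QCData.LocalFrame.fr] using inner_e_ξ F hx a t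
  · simpa [QCData.LocalFrame.fr] using F.g_ξ_H x hx s _ (F.e_mem x hx b)
  · simpa [QCData.LocalFrame.fr] using F.g_ξ_ξ x hx s t

lemma fr_linearIndependent : LinearIndependent ℝ (fun i ↦ F.fr i x) := by
  rw [Fintype.linearIndependent_iff]
  intro c hc j
  have := congrArg (fun v ↦ A.g.inner x v (F.fr j x)) hc
  simpa [inner_sum_left, fr_orthonormal F hx, -Fintype.sum_sum_type] using this

/-- The basis of the tangent space given by a local frame. -/
def frBasis : Module.Basis (Fin 4 ⊕ Fin 3) ℝ (TangentSpace (𝓡 7) x) :=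
  haveI : FiniteDimensional ℝ (TangentSpace (𝓡 7) x) :=
    inferInstanceAs (FiniteDimensional ℝ (EuclideanSpace ℝ (Fin 7)))
  basisOfLinearIndependentOfCardEqFinrank (fr_linearIndependent F hx) (by
    have : Module.finrank ℝ (TangentSpace (𝓡 7) x) = 7 :=
      finrank_euclideanSpace_fin (𝕜 := ℝ) (n := 7)
    rw [this]; rfl)

lemma frBasis_apply (i : Fin 4 ⊕ Fin 3) : frBasis F hx i = F.fr i x := by
  simp [frBasis]

lemma frBasis_repr (v : TangentSpace (𝓡 7) x) (i : Fin 4 ⊕ Fin 3) :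
    (frBasis F hx).repr v i = A.g.inner x v (F.fr i x) := by
  conv_rhs => rw [← (frBasis F hx).sum_repr v]
  simp only [inner_sum_left, inner_smul_left, frBasis_apply, fr_orthonormal F hx]
  simp

lemma fr_expand (v : TangentSpace (𝓡 7) x) :
    v = ∑ i, A.g.inner x v (F.fr i x) • F.fr i x := by
  conv_lhs => rw [← (frBasis F hx).sum_repr v]
  simp only [frBasis_apply, frBasis_repr]

lemma expand (v : TangentSpace (𝓡 7) x) :
    v = ∑ a, A.g.inner x v (F.e a x) • F.e a x + ∑ s, A.g.inner x v (F.ξ s x) • F.ξ s x := by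
  have := fr_expand F hx v
  rwa [Fintype.sum_sum_type] at this

lemma η_eq (s : Fin 3) (v : TangentSpace (𝓡 7) x) : F.η s x v = A.g.inner x v (F.ξ s x) := by
  conv_lhs => rw [expand F hx v]
  have h (a : Fin 4) : F.η s x (F.e a x) = 0 := (F.mem_H_iff x hx _).1 (F.e_mem x hx a) s
  simp [h, F.η_ξ x hx]

lemma mem_H_iff_inner (v : TangentSpace (𝓡 7) x) :
    v ∈ A.H x ↔ ∀ s, A.g.inner x v (F.ξ s x) = 0 := by
  simp only [← η_eq F hx]
  exact F.mem_H_iff x hx v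

lemma expand_H {v : TangentSpace (𝓡 7) x} (hv : v ∈ A.H x) :
    v = ∑ a, A.g.inner x v (F.e a x) • F.e a x := by
  conv_lhs => rw [expand F hx v]
  simp [(mem_H_iff_inner F hx v).1 hv]

lemma expand_V {v : TangentSpace (𝓡 7) x} (hv : v ∈ A.V x) :
    v = ∑ s, A.g.inner x v (F.ξ s x) • F.ξ s x := by
  conv_lhs => rw [expand F hx v]
  have h (a : Fin 4) : A.g.inner x v (F.e a x) = 0 := hv _ (F.e_mem x hx a)
  simp [h]

lemma ξ_mem_V (s : Fin 3) : F.ξ s x ∈ A.V x := fun w hw ↦ F.g_ξ_H x hx s w hw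

lemma inner_H_V {v w : TangentSpace (𝓡 7) x} (hv : v ∈ A.H x) (hw : w ∈ A.V x) :
    A.g.inner x v w = 0 := by
  rw [A.g.symm]; exact hw v hv

lemma inner_H {v : TangentSpace (𝓡 7) x} (hv : v ∈ A.H x) (w : TangentSpace (𝓡 7) x) :
    A.g.inner x v w = ∑ a, A.g.inner x v (F.e a x) * A.g.inner x w (F.e a x) := by
  conv_lhs => rw [expand_H F hx hv]
  simp only [inner_sum_left, inner_smul_left, A.g.symm x w]

lemma inner_fr (v w : TangentSpace (𝓡 7) x) :
    A.g.inner x v w = ∑ i, A.g.inner x v (F.fr i x) * A.g.inner x w (F.fr i x) := by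
  conv_lhs => rw [fr_expand F hx v]
  simp only [inner_sum_left, inner_smul_left, A.g.symm x w]

lemma ext_H {v w : TangentSpace (𝓡 7) x} (hv : v ∈ A.H x) (hw : w ∈ A.H x)
    (h : ∀ a, A.g.inner x v (F.e a x) = A.g.inner x w (F.e a x)) : v = w := by
  rw [expand_H F hx hv, expand_H F hx hw]
  simp only [h]

lemma I_skew (s : Fin 3) {v w : TangentSpace (𝓡 7) x} (hv : v ∈ A.H x) (hw : w ∈ A.H x) :
    A.g.inner x (F.I s x v) w = -A.g.inner x v (F.I s x w) := by
  rw [← F.g_I_I x hx s _ (F.I_mem x hx s v hv) w hw, F.I_sq x hx s v hv, inner_neg_left]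

/-- The indices live in `Fin 3`, so that `s`, `s + 1`, `s + 2` run cyclically. All six products
follow from the two given ones together with I_s² = −1. -/
lemma I_mul (s : Fin 3) {v : TangentSpace (𝓡 7) x} (hv : v ∈ A.H x) :
    F.I s x (F.I (s + 1) x v) = F.I (s + 2) x v ∧ F.I (s + 1) x (F.I s x v) = -F.I (s + 2) x v := by
  have h01 := F.I_zero_one x hx
  have h10 := F.I_one_zero x hx
  have hm := fun s ↦ F.I_mem x hx s v hv
  have q (s) := F.I_sq x hx s v hv
  have e12 : F.I 1 x (F.I 2 x v) = F.I 0 x v := by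
    have h2 : F.I 2 x v = -F.I 1 x (F.I 0 x v) := by rw [h10 v hv, neg_neg]
    rw [h2, map_neg, F.I_sq x hx 1 _ (hm 0), neg_neg]
  have e21 : F.I 2 x (F.I 1 x v) = -F.I 0 x v := by
    rw [← h01 _ (hm 1), q 1, map_neg]
  have e02 : F.I 0 x (F.I 2 x v) = -F.I 1 x v := by
    rw [← h01 v hv, F.I_sq x hx 0 _ (hm 1)]
  have e20 : F.I 2 x (F.I 0 x v) = F.I 1 x v := by
    have := h10 _ (hm 0)
    rw [q 0, map_neg] at this
    exact (neg_injective this).symm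
  fin_cases s
  · exact ⟨h01 v hv, h10 v hv⟩
  · exact ⟨e12, e21⟩
  · exact ⟨e20, e02⟩

lemma I_inner_I (s t : Fin 3) {v : TangentSpace (𝓡 7) x} (hv : v ∈ A.H x) :
    A.g.inner x (F.I s x v) (F.I t x v) = if s = t then A.g.inner x v v else 0 := by
  have h0 (s : Fin 3) : A.g.inner x v (F.I s x v) = 0 := by
    have := I_skew F hx s hv hv
    rw [A.g.symm] at this
    linarith
  have h (s : Fin 3) : A.g.inner x (F.I s x v) (F.I (s + 1) x v) = 0 := by
    rw [I_skew F hx s hv (F.I_mem x hx _ v hv), (I_mul F hx s hv).1, h0, neg_zero]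
  split_ifs with hst
  · subst hst; exact F.g_I_I x hx s v hv v hv
  · fin_cases s <;> fin_cases t <;> first | exact absurd rfl hst | skip
    · exact h 0
    · rw [A.g.symm]; exact h 2
    · rw [A.g.symm]; exact h 0
    · exact h 1
    · exact h 2
    · rw [A.g.symm]; exact h 1

lemma inner_I_self (s : Fin 3) {v : TangentSpace (𝓡 7) x} (hv : v ∈ A.H x) :
    A.g.inner x v (F.I s x v) = 0 := by
  have := I_skew F hx s hv hv
  rw [A.g.symm] at this
  linarith

omit hx in
/-- The quadruple `v, I₁ v, I₂ v, I₃ v`. -/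
def quad (x : M) (v : TangentSpace (𝓡 7) x) : Fin 4 → TangentSpace (𝓡 7) x :=
  Fin.cons v fun s ↦ F.I s x v

lemma quad_mem {v : TangentSpace (𝓡 7) x} (hv : v ∈ A.H x) (i : Fin 4) : quad F x v i ∈ A.H x := by
  refine Fin.cases ?_ (fun s ↦ ?_) i
  · exact hv
  · exact F.I_mem x hx s v hv

lemma quad_inner {v : TangentSpace (𝓡 7) x} (hv : v ∈ A.H x) (i j : Fin 4) :
    A.g.inner x (quad F x v i) (quad F x v j) = if i = j then A.g.inner x v v else 0 := by
  refine Fin.cases ?_ (fun s ↦ ?_) i <;> refine Fin.cases ?_ (fun t ↦ ?_) j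
  · simp [quad]
  · simpa [quad, (Fin.succ_ne_zero t).symm] using inner_I_self F hx t hv
  · simpa [quad, A.g.symm x (F.I s x v)] using inner_I_self F hx s hv
  · simpa [quad] using I_inner_I F hx s t hv

/-- The coefficient matrix B of the quadruple in the frame `e` satisfies B Bᵀ = |v|²·1. A one-sided
inverse of a square matrix is two-sided, hence Bᵀ B = |v|²·1 as well. Keeping the factor |v|² avoids
normalizing v. -/
lemma quad_complete {v : TangentSpace (𝓡 7) x} (hv : v ∈ A.H x) (a c : Fin 4) :
    ∑ i, A.g.inner x (quad F x v i) (F.e a x) * A.g.inner x (quad F x v i) (F.e c x)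
      = if a = c then A.g.inner x v v else 0 := by
  by_cases hv0 : v = 0
  · have : ∀ i, quad F x v i = 0 := fun i ↦ by
      refine Fin.cases ?_ (fun s ↦ ?_) i <;> simp [quad, hv0]
    simp only [this]
    simp [hv0]
  set N := A.g.inner x v v with hN
  have hN0 : N ≠ 0 := (A.g.pos x v hv0).ne'
  let B : Matrix (Fin 4) (Fin 4) ℝ := fun i a ↦ A.g.inner x (quad F x v i) (F.e a x)
  have hB (i a) : B i a = A.g.inner x (quad F x v i) (F.e a x) := rfl
  have h1 : B * (N⁻¹ • B.transpose) = 1 := by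
    rw [Matrix.mul_smul]
    ext i j
    have := inner_H F hx (quad_mem F hx hv i) (quad F x v j)
    rw [quad_inner F hx hv] at this
    simp only [Matrix.smul_apply, Matrix.mul_apply, Matrix.transpose_apply, smul_eq_mul, hB, ← this]
    by_cases hij : i = j
    · simp [hij, ← hN, hN0, Matrix.one_apply]
    · simp [hij]
  have h2 := mul_eq_one_comm.1 h1
  rw [Matrix.smul_mul] at h2
  have h3 := congrFun (congrFun h2 a) c
  simp only [Matrix.smul_apply, Matrix.mul_apply, Matrix.transpose_apply, smul_eq_mul] at h3
  rw [inv_mul_eq_iff_eq_mul₀ hN0] at h3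
  simp only [hB] at h3
  rw [h3, Matrix.one_apply]
  simp

/-- The trace of a bilinear form on `H`, computed in the quadruple of a horizontal vector. -/
lemma trace_quad {v : TangentSpace (𝓡 7) x} (hv : v ∈ A.H x)
    (β : TangentSpace (𝓡 7) x →ₗ[ℝ] TangentSpace (𝓡 7) x →ₗ[ℝ] ℝ) :
    ∑ i, β (quad F x v i) (quad F x v i) = A.g.inner x v v * ∑ a, β (F.e a x) (F.e a x) := by
  have h (i : Fin 4) : β (quad F x v i) (quad F x v i) = ∑ a, ∑ c,
      A.g.inner x (quad F x v i) (F.e a x) * A.g.inner x (quad F x v i) (F.e c x)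
        * β (F.e a x) (F.e c x) := by
    conv_lhs => rw [expand_H F hx (quad_mem F hx hv i)]
    simp only [map_sum, map_smul, LinearMap.sum_apply, LinearMap.smul_apply, smul_eq_mul,
      Finset.mul_sum]
    rw [Finset.sum_comm]
    refine Finset.sum_congr rfl fun a _ ↦ Finset.sum_congr rfl fun c _ ↦ by ring
  simp only [h]
  rw [Finset.sum_comm]
  rw [Finset.mul_sum]
  refine Finset.sum_congr rfl fun a _ ↦ ?_
  rw [Finset.sum_comm]
  simp only [← Finset.sum_mul, quad_complete F hx hv]
  simp

lemma quad_expand {v w : TangentSpace (𝓡 7) x} (hv : v ∈ A.H x) (hw : w ∈ A.H x) :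
    A.g.inner x v v • w = ∑ i, A.g.inner x w (quad F x v i) • quad F x v i := by
  have hs : ∑ i, A.g.inner x w (quad F x v i) • quad F x v i ∈ A.H x :=
    Submodule.sum_mem _ fun i _ ↦ Submodule.smul_mem _ _ (quad_mem F hx hv i)
  refine ext_H F hx (Submodule.smul_mem _ _ hw) hs fun c ↦ ?_
  simp only [inner_sum_left, inner_smul_left]
  have h (i : Fin 4) : A.g.inner x w (quad F x v i) = ∑ a, A.g.inner x w (F.e a x) *
      A.g.inner x (quad F x v i) (F.e a x) := inner_H F hx hw _
  simp only [h, Finset.sum_mul, mul_assoc]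
  rw [Finset.sum_comm]
  simp only [← Finset.mul_sum, quad_complete F hx hv]
  simp [mul_comm]

end QCStructure

end QuaternionicContact

/-! ### First consequences of the Biquard axioms: metric connection and horizontal torsion. -/

namespace QuaternionicContact

namespace QCStructure

variable {M : Type*} [TopologicalSpace M] [ChartedSpace (EuclideanSpace ℝ (Fin 7)) M]
  [IsManifold (𝓡 7) ∞ M] [T2Space M] {A : QCStructure M}
  {cov : CovariantDerivative (𝓡 7) (EuclideanSpace ℝ (Fin 7)) (fun x : M ↦ TangentSpace (𝓡 7) x)}
  (hcov : A.IsBiquard cov) (F : A.toQCData.LocalFrame) {x : M} (hx : x ∈ F.dom)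
  {X Y Z W : VField M}

section FirstOrder

lemma smooth_I (s : Fin 3) (hX : SmoothOn X F.dom) : SmoothOn (fun y ↦ F.I s y (X y)) F.dom :=
  SmoothOn.clm (F.smooth_I s) hX

include hx

lemma e_ne_zero (a : Fin 4) : F.e a x ≠ 0 := by
  intro h
  have := F.e_orthonormal x hx a a
  simp [h] at this

include hcov

lemma cov_mem_H (hX : SmoothOn X F.dom) (hH : ∀ y ∈ F.dom, X y ∈ A.H y)
    (u : TangentSpace (𝓡 7) x) : cov X x u ∈ A.H x :=
  hcov.preserves_H x X (hX.diffAt F.isOpen_dom hx)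
    (eventually_of_mem (F.isOpen_dom.mem_nhds hx) hH) u

lemma cov_mem_V (hX : SmoothOn X F.dom) (hV : ∀ y ∈ F.dom, X y ∈ A.V y)
    (u : TangentSpace (𝓡 7) x) : cov X x u ∈ A.V x :=
  hcov.preserves_V x X (hX.diffAt F.isOpen_dom hx)
    (eventually_of_mem (F.isOpen_dom.mem_nhds hx) hV) u

omit hcov hx in
variable (cov) in
/-- The connection forms of the vertical frame. -/
def conn (s t : Fin 3) (x : M) (u : TangentSpace (𝓡 7) x) : ℝ :=
  A.g.inner x (cov (F.ξ s) x u) (F.ξ t x)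

lemma cov_ξ (s : Fin 3) (u : TangentSpace (𝓡 7) x) :
    cov (F.ξ s) x u = ∑ t, conn cov F s t x u • F.ξ t x :=
  expand_V F hx (cov_mem_V hcov F hx (F.smooth_ξ s) (fun _ hy ↦ ξ_mem_V F hy s) u)

lemma cov_I (s : Fin 3) (hX : SmoothOn X F.dom) (u : TangentSpace (𝓡 7) x) :
    cov (fun y ↦ F.I s y (X y)) x u
      = F.I s x (cov X x u) + ∑ t, conn cov F s t x u • F.I t x (X x) := by
  have := hcov.parallel_φ F x hx s u X (hX.diffAt F.isOpen_dom hx)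
  simp only [η_eq F hx] at this
  exact eq_add_of_sub_eq' this

lemma metric_H (hX : SmoothOn X F.dom) (hXH : ∀ y ∈ F.dom, X y ∈ A.H y)
    (hY : SmoothOn Y F.dom) (hYH : ∀ y ∈ F.dom, Y y ∈ A.H y) (u : TangentSpace (𝓡 7) x) :
    df (fun y ↦ A.g.inner y (X y) (Y y)) x u
      = A.g.inner x (cov X x u) (Y x) + A.g.inner x (X x) (cov Y x u) :=
  hcov.metric x X Y (hX.diffAt F.isOpen_dom hx) (hY.diffAt F.isOpen_dom hx)
    (eventually_of_mem (F.isOpen_dom.mem_nhds hx) hXH)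
    (eventually_of_mem (F.isOpen_dom.mem_nhds hx) hYH) u

/-- Through the parallel identification ξ_s ↦ I_s the connection forms of V also govern ∇I_s.
Differentiating the constants g(I_s e, I_t e) = δ_st for the unit field e = e_0 then shows that they
are skew, so the connection is metric on V although this is not among the axioms. -/
lemma conn_skew (s t : Fin 3) (u : TangentSpace (𝓡 7) x) :
    conn cov F s t x u = -conn cov F t s x u := by
  have he := F.smooth_e 0
  have heH : ∀ y ∈ F.dom, F.e 0 y ∈ A.H y := fun y hy ↦ F.e_mem y hy 0
  have h (s : Fin 3) : ∀ y ∈ F.dom, F.I s y (F.e 0 y) ∈ A.H y :=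
    fun y hy ↦ F.I_mem y hy s _ (heH y hy)
  have hm := metric_H hcov F hx (smooth_I F s he) (h s) (smooth_I F t he) (h t) u
  have h0 : ∀ y ∈ F.dom, A.g.inner y (F.I s y (F.e 0 y)) (F.I t y (F.e 0 y))
      = if s = t then 1 else 0 := fun y hy ↦ by
    rw [I_inner_I F hy s t (heH y hy), F.e_orthonormal y hy]; simp
  rw [df_congr_on F.isOpen_dom hx h0, df_const, cov_I hcov F hx s he, cov_I hcov F hx t he] at hm
  have hcH := cov_mem_H hcov F hx he heH u
  have he1 : A.g.inner x (F.e 0 x) (F.e 0 x) = 1 := by simp [F.e_orthonormal x hx]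
  have hee : A.g.inner x (cov (F.e 0) x u) (F.e 0 x) = 0 := by
    have := metric_H hcov F hx he heH he heH u
    rw [df_congr_on F.isOpen_dom hx (v := fun _ ↦ 1)
      (fun y hy ↦ by simp [F.e_orthonormal y hy]), df_const,
      A.g.symm x (F.e 0 x) (cov (F.e 0) x u)] at this
    linarith
  -- Polarization of `I_inner_I` at the pair ∇e, e, which is orthogonal because e has constant
  -- length; it removes every term containing ∇e.
  have hpol : A.g.inner x (F.I s x (cov (F.e 0) x u)) (F.I t x (F.e 0 x))
      + A.g.inner x (F.I s x (F.e 0 x)) (F.I t x (cov (F.e 0) x u)) = 0 := by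
    have h1 := I_inner_I F hx s t (Submodule.add_mem _ hcH (heH x hx))
    have h2 := I_inner_I F hx s t hcH
    have h3 := I_inner_I F hx s t (heH x hx)
    simp only [map_add, add_apply, h2, h3] at h1
    rw [A.g.symm x (F.e 0 x) (cov (F.e 0) x u), hee] at h1
    split_ifs at h1 <;> linarith
  simp only [map_add, map_sum, map_smul, add_apply, sum_apply, smul_apply,
    I_inner_I F hx _ _ (heH x hx), he1, smul_eq_mul] at hm
  simp only [mul_ite, mul_one, mul_zero, Finset.sum_ite_eq', Finset.sum_ite_eq,
    Finset.mem_univ, if_true] at hm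
  linarith

/-- The connection matrix of the frame is skew-symmetric. -/
lemma fr_skew (i j : Fin 4 ⊕ Fin 3) (u : TangentSpace (𝓡 7) x) :
    A.g.inner x (cov (F.fr i) x u) (F.fr j x) = -A.g.inner x (cov (F.fr j) x u) (F.fr i x) := by
  have heH (a : Fin 4) : ∀ y ∈ F.dom, F.e a y ∈ A.H y := fun y hy ↦ F.e_mem y hy a
  have hξV (s : Fin 3) : ∀ y ∈ F.dom, F.ξ s y ∈ A.V y := fun y hy ↦ ξ_mem_V F hy s
  have hm (a : Fin 4) (s : Fin 3) : A.g.inner x (cov (F.e a) x u) (F.ξ s x) = 0 :=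
    inner_H_V F hx (cov_mem_H hcov F hx (F.smooth_e a) (heH a) u) (hξV s x hx)
  have hm' (a : Fin 4) (s : Fin 3) : A.g.inner x (cov (F.ξ s) x u) (F.e a x) = 0 :=
    cov_mem_V hcov F hx (F.smooth_ξ s) (hξV s) u _ (heH a x hx)
  rcases i with a | s <;> rcases j with b | t <;> simp only [QCData.LocalFrame.fr, Sum.elim_inl,
    Sum.elim_inr]
  · have := metric_H hcov F hx (F.smooth_e a) (heH a) (F.smooth_e b) (heH b) u
    rw [df_congr_on F.isOpen_dom hx (fun y hy ↦ F.e_orthonormal y hy a b), df_const,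
      A.g.symm x (F.e a x)] at this
    linarith
  · rw [hm, hm', neg_zero]
  · rw [hm, hm', neg_zero]
  · exact conn_skew hcov F hx s t u

/-- The connection is metric on the whole tangent bundle. -/
lemma metric (hX : SmoothOn X F.dom) (hY : SmoothOn Y F.dom) (u : TangentSpace (𝓡 7) x) :
    df (fun y ↦ A.g.inner y (X y) (Y y)) x u
      = A.g.inner x (cov X x u) (Y x) + A.g.inner x (X x) (cov Y x u) := by
  have hf {X : VField M} (hX : SmoothOn X F.dom) (i) :
    FunOn (fun y ↦ A.g.inner y (X y) (F.fr i y)) F.dom := FunOn.inner A.g hX (smooth_fr F i)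
  have hd {X : VField M} (hX : SmoothOn X F.dom) (i) := (hf hX i).mdiffAt F.isOpen_dom hx
  have h1 : df (fun y ↦ A.g.inner y (X y) (Y y)) x u
      = ∑ i, (A.g.inner x (X x) (F.fr i x) * df (fun y ↦ A.g.inner y (Y y) (F.fr i y)) x u
        + A.g.inner x (Y x) (F.fr i x) * df (fun y ↦ A.g.inner y (X y) (F.fr i y)) x u) := by
    rw [df_congr_on F.isOpen_dom hx (fun y hy ↦ inner_fr F hy (X y) (Y y)), df_sum]
    · exact Finset.sum_congr rfl fun i _ ↦ df_mul (hd hX i) (hd hY i) u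
    · exact fun i _ ↦ ((hf hX i).mul (hf hY i)).mdiffAt F.isOpen_dom hx
  have h2 {X : VField M} (hX : SmoothOn X F.dom) : cov X x u
      = ∑ i, (A.g.inner x (X x) (F.fr i x) • cov (F.fr i) x u
        + df (fun y ↦ A.g.inner y (X y) (F.fr i y)) x u • F.fr i x) := by
    have hs (i) := SmoothOn.smul (hf hX i) (smooth_fr F i)
    rw [cov_congr F.isOpen_dom hx (hX.diffAt F.isOpen_dom hx)
      ((SmoothOn.sum fun i (_ : i ∈ Finset.univ) ↦ hs i).diffAt F.isOpen_dom hx)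
      (fun y hy ↦ fr_expand F hy (X y)), cov_sum fun i _ ↦ (hs i).diffAt F.isOpen_dom hx]
    exact Finset.sum_congr rfl fun i _ ↦ cov_smul (hd hX i)
      ((smooth_fr F i).diffAt F.isOpen_dom hx) u
  have h3 {X Y : VField M} (hX : SmoothOn X F.dom) : A.g.inner x (cov X x u) (Y x)
      = ∑ i, ∑ j, A.g.inner x (X x) (F.fr i x) * A.g.inner x (Y x) (F.fr j x)
          * A.g.inner x (cov (F.fr i) x u) (F.fr j x)
        + ∑ i, A.g.inner x (Y x) (F.fr i x) * df (fun y ↦ A.g.inner y (X y) (F.fr i y)) x u := by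
    rw [h2 hX]
    simp only [inner_sum_left, inner_add_left, inner_smul_left, Finset.sum_add_distrib]
    congr 1
    · refine Finset.sum_congr rfl fun i _ ↦ ?_
      rw [inner_fr F hx (cov (F.fr i) x u) (Y x), Finset.mul_sum]
      exact Finset.sum_congr rfl fun j _ ↦ by ring
    · exact Finset.sum_congr rfl fun i _ ↦ by rw [A.g.symm x (F.fr i x), mul_comm]
  rw [h1, A.g.symm x (X x), h3 hX, h3 hY, Finset.sum_add_distrib]
  -- The connection matrix enters once for X and once for Y with the roles of i and j exchanged;
  -- skewness makes the two contributions cancel.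
  have h4 : ∑ i, ∑ j, A.g.inner x (X x) (F.fr i x) * A.g.inner x (Y x) (F.fr j x)
        * A.g.inner x (cov (F.fr i) x u) (F.fr j x)
      = -∑ i, ∑ j, A.g.inner x (Y x) (F.fr i x) * A.g.inner x (X x) (F.fr j x)
        * A.g.inner x (cov (F.fr i) x u) (F.fr j x) := by
    rw [Finset.sum_comm, ← Finset.sum_neg_distrib]
    refine Finset.sum_congr rfl fun i _ ↦ ?_
    rw [← Finset.sum_neg_distrib]
    refine Finset.sum_congr rfl fun j _ ↦ ?_
    rw [fr_skew hcov F hx j i]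
    ring
  rw [h4]
  ring

/-- The torsion of horizontal vectors. -/
lemma torsion_H {v w : TangentSpace (𝓡 7) x} (hv : v ∈ A.H x) (hw : w ∈ A.H x) :
    cov.torsion x v w = ∑ s, (2 * A.g.inner x (F.I s x v) w) • F.ξ s x := by
  have hU := F.isOpen_dom
  have hs (v : TangentSpace (𝓡 7) x) :
      SmoothOn (fun y ↦ ∑ a, A.g.inner x v (F.e a x) • F.e a y) F.dom :=
    SmoothOn.sum fun a _ ↦ SmoothOn.const_smul _ (F.smooth_e a)
  have hH (v : TangentSpace (𝓡 7) x) (y : M) (hy : y ∈ F.dom) :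
      ∑ a, A.g.inner x v (F.e a x) • F.e a y ∈ A.H y :=
    Submodule.sum_mem _ fun a _ ↦ Submodule.smul_mem _ _ (F.e_mem y hy a)
  rw [expand_V F hx (hcov.torsion_mem_V x v hv w hw)]
  refine Finset.sum_congr rfl fun s _ ↦ ?_
  congr 1
  have hv' := expand_H F hx hv
  have hw' := expand_H F hx hw
  have ht := hcov.torsion_add_bracket x _ _ ((hs v).diffAt hU hx) ((hs w).diffAt hU hx)
    (eventually_of_mem (hU.mem_nhds hx) (hH v)) (eventually_of_mem (hU.mem_nhds hx) (hH w))
  have hc := F.compat x hx s _ _ ((hs v).diffAt hU hx) ((hs w).diffAt hU hx) (hH v x hx) (hH w x hx)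
  have ht' := (mem_H_iff_inner F hx _).1 ht s
  rw [inner_add_left] at ht'
  -- η_s vanishes on both extensions near x, so `compat` reduces to 2g(I_s v, w) = −η_s([v, w]),
  -- while the axiom on T(v, w) + [v, w] identifies −η_s([v, w]) with the ξ_s-component of the
  -- torsion.
  have h0 (v : TangentSpace (𝓡 7) x) :
      df (fun y ↦ F.η s y (∑ a, A.g.inner x v (F.e a x) • F.e a y)) x = df (fun _ ↦ 0) x :=
    df_congr_on hU hx fun y hy ↦ (F.mem_H_iff y hy _).1 (hH v y hy) s
  rw [extDer, h0, h0, df_const, df_const, η_eq F hx] at hc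
  rw [← hv', ← hw'] at ht' hc
  linarith

lemma torsion_swap (v w : TangentSpace (𝓡 7) x) : cov.torsion x v w = -cov.torsion x w v :=
  cov.torsion_antisymm v w

lemma torsion_ξ_mem (s : Fin 3) {w : TangentSpace (𝓡 7) x} (hw : w ∈ A.H x) :
    cov.torsion x (F.ξ s x) w ∈ A.H x :=
  hcov.torsion_vertical_mem x _ (ξ_mem_V F hx s) w hw

lemma inner_torsion_ξ {v w : TangentSpace (𝓡 7) x} (hv : v ∈ A.H x) (hw : w ∈ A.H x)
    (t : Fin 3) : A.g.inner x (cov.torsion x v w) (F.ξ t x) = 2 * A.g.inner x (F.I t x v) w := by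
  rw [torsion_H hcov F hx hv hw]
  simp [F.g_ξ_ξ x hx]

/-- The trace of the torsion in a horizontal direction vanishes. -/
lemma torsion_trace {v : TangentSpace (𝓡 7) x} (hv : v ∈ A.H x) :
    ∑ i, A.g.inner x (cov.torsion x v (F.fr i x)) (F.fr i x) = 0 := by
  -- Each term vanishes separately: T(v, e_a) is vertical and T(v, ξ_s) is horizontal. This is why
  -- no torsion correction appears in the divergence theorem for horizontal fields.
  refine Finset.sum_eq_zero fun i _ ↦ ?_
  rcases i with a | s
  · exact hcov.torsion_mem_V x v hv _ (F.e_mem x hx a) _ (F.e_mem x hx a)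
  · simp only [QCData.LocalFrame.fr, Sum.elim_inr]
    rw [torsion_swap hcov F hx, inner_neg_left,
      inner_H_V F hx (torsion_ξ_mem hcov F hx s hv) (ξ_mem_V F hx s), neg_zero]

end FirstOrder

end QCStructure

end QuaternionicContact

/-! ### Symmetry of the vertical torsion; curvature, metric and almost complex structures. -/

namespace QuaternionicContact

namespace QCStructure

variable {M : Type*} [TopologicalSpace M] [ChartedSpace (EuclideanSpace ℝ (Fin 7)) M]
  [IsManifold (𝓡 7) ∞ M] {A : QCStructure M}

section Symmetry

variable (F : A.toQCData.LocalFrame) {x : M} (hx : x ∈ F.dom)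

include hx

lemma I_table {v : TangentSpace (𝓡 7) x} (hv : v ∈ A.H x) :
    (F.I 0 x (F.I 0 x v) = -v ∧ F.I 1 x (F.I 1 x v) = -v ∧ F.I 2 x (F.I 2 x v) = -v) ∧
    (F.I 0 x (F.I 1 x v) = F.I 2 x v ∧ F.I 1 x (F.I 2 x v) = F.I 0 x v ∧
      F.I 2 x (F.I 0 x v) = F.I 1 x v) ∧
    (F.I 1 x (F.I 0 x v) = -F.I 2 x v ∧ F.I 2 x (F.I 1 x v) = -F.I 0 x v ∧
      F.I 0 x (F.I 2 x v) = -F.I 1 x v) :=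
  ⟨⟨F.I_sq x hx 0 v hv, F.I_sq x hx 1 v hv, F.I_sq x hx 2 v hv⟩,
    ⟨(I_mul F hx 0 hv).1, (I_mul F hx 1 hv).1, (I_mul F hx 2 hv).1⟩,
    ⟨(I_mul F hx 0 hv).2, (I_mul F hx 1 hv).2, (I_mul F hx 2 hv).2⟩⟩

omit hx in
/-- The endomorphism of `H` which agrees with `I_s` on `v, I_s v` and with `-I_s` on the orthogonal
complement of `v, I_s v`, multiplied by `g(v, v)`. -/
def antiI (s : Fin 3) (x : M) (v : TangentSpace (𝓡 7) x) :
    TangentSpace (𝓡 7) x →L[ℝ] TangentSpace (𝓡 7) x :=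
  (A.g.inner x v).smulRight (F.I s x v) - (A.g.inner x (F.I s x v)).smulRight v
    - (A.g.inner x (F.I (s + 1) x v)).smulRight (F.I (s + 2) x v)
    + (A.g.inner x (F.I (s + 2) x v)).smulRight (F.I (s + 1) x v)

omit hx in
lemma antiI_apply (s : Fin 3) (x : M) (v w : TangentSpace (𝓡 7) x) :
    antiI F s x v w = A.g.inner x v w • F.I s x v - A.g.inner x (F.I s x v) w • v
    - A.g.inner x (F.I (s + 1) x v) w • F.I (s + 2) x v
    + A.g.inner x (F.I (s + 2) x v) w • F.I (s + 1) x v := rfl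

lemma antiI_comm_I (s r : Fin 3) {v w : TangentSpace (𝓡 7) x} (hv : v ∈ A.H x) (hw : w ∈ A.H x) :
    antiI F s x v (F.I r x w) = F.I r x (antiI F s x v w) := by
  have hI (t) : F.I t x v ∈ A.H x := F.I_mem x hx t v hv
  have h1 (b) (hb : b ∈ A.H x) : A.g.inner x b (F.I r x w) = -A.g.inner x (F.I r x b) w := by
    rw [I_skew F hx r hb hw, neg_neg]
  simp only [antiI_apply, h1 v hv, h1 _ (hI _), map_add, map_sub, map_smul]
  obtain ⟨⟨a1, a2, a3⟩, ⟨b1, b2, b3⟩, c1, c2, c3⟩ := I_table F hx hv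
  have z1 : (2 : Fin 3) + 1 = 0 := rfl
  have z2 : (2 : Fin 3) + 2 = 1 := rfl
  have z3 : (1 : Fin 3) + 2 = 0 := rfl
  have z4 : (1 : Fin 3) + 1 = 2 := rfl
  fin_cases s <;> fin_cases r <;>
    simp only [Fin.zero_eta, Fin.mk_one, Fin.reduceFinMk, zero_add, z1, z2, z3, z4, a1, a2, a3, b1,
      b2, b3, c1, c2, c3, map_neg, neg_apply] <;> module

/-- For v ≠ 0 the three endomorphisms `antiI` span the factor of so(4) = sp(1) ⊕ sp(1) that commutes
with Q; they are explicit test elements for the orthogonality axiom of the torsion. -/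
lemma memSpN_antiI (s : Fin 3) {v : TangentSpace (𝓡 7) x} (hv : v ∈ A.H x) :
    A.MemSpN x (antiI F s x v) := by
  have hI (t) : F.I t x v ∈ A.H x := F.I_mem x hx t v hv
  refine ⟨fun w _ ↦ ?_, fun w _ z _ ↦ ?_, fun C hC w hw ↦ ?_⟩
  · rw [antiI_apply]
    exact Submodule.add_mem _ (Submodule.sub_mem _ (Submodule.sub_mem _
      (Submodule.smul_mem _ _ (hI _)) (Submodule.smul_mem _ _ hv))
      (Submodule.smul_mem _ _ (hI _))) (Submodule.smul_mem _ _ (hI _))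
  · rw [antiI_apply, antiI_apply, A.g.symm x w]
    simp only [inner_add_left, inner_sub_left, inner_smul_left]
    ring
  · rw [F.Q_eq x hx] at hC
    induction hC using Submodule.span_induction with
    | mem C h => obtain ⟨r, rfl⟩ := h; exact antiI_comm_I F hx s r hv hw
    | zero => simp
    | add C D _ _ h1 h2 => rw [add_apply, add_apply, map_add, h1, h2]
    | smul c C _ h => rw [smul_apply, smul_apply, map_smul, h]

end Symmetry

variable [T2Space M]
  {cov : CovariantDerivative (𝓡 7) (EuclideanSpace ℝ (Fin 7)) (fun x : M ↦ TangentSpace (𝓡 7) x)}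
  (hcov : A.IsBiquard cov)

include hcov

/-- The torsion endomorphism of a vertical vector is symmetric on `H`. -/
lemma torsion_symm {x : M} {ζ : TangentSpace (𝓡 7) x} (hζ : ζ ∈ A.V x)
    {v w : TangentSpace (𝓡 7) x} (hv : v ∈ A.H x) (hw : w ∈ A.H x) :
    A.g.inner x (cov.torsion x ζ v) w = A.g.inner x (cov.torsion x ζ w) v := by
  set F := A.frameAt x
  have hx : x ∈ F.dom := A.mem_frameAt_dom x
  set τ := cov.torsion x ζ with hτ
  -- Modulo the factor g(v, v), I_s and `antiI` agree on the plane of v, I_s v and are opposite on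
  -- its complement. Adding the two orthogonality relations for τ therefore leaves only this plane,
  -- and there they say that τ is symmetric on the pair v, I_s v.
  have key (s : Fin 3) {v : TangentSpace (𝓡 7) x} (hv : v ∈ A.H x) :
      A.g.inner x (τ v) (F.I s x v) = A.g.inner x (τ (F.I s x v)) v := by
    have hI (t) : F.I t x v ∈ A.H x := F.I_mem x hx t v hv
    have h1 : ∑ a, A.g.inner x (τ (F.e a x)) (antiI F s x v (F.e a x)) = 0 :=
      hcov.torsion_orthogonal x ζ hζ _ (Or.inl (memSpN_antiI F hx s hv))
    have h2 : ∑ a, A.g.inner x (τ (F.e a x)) (F.I s x (F.e a x)) = 0 :=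
      hcov.torsion_orthogonal x ζ hζ _ (Or.inr ⟨F.I s x, by
        rw [F.Q_eq x hx]; exact Submodule.subset_span ⟨s, rfl⟩, fun _ _ ↦ rfl⟩)
    have h3 (b c : TangentSpace (𝓡 7) x) (hb : b ∈ A.H x) :
        ∑ a, A.g.inner x b (F.e a x) * A.g.inner x (τ (F.e a x)) c = A.g.inner x (τ b) c := by
      conv_rhs => rw [expand_H F hx hb]
      simp only [map_sum, map_smul, sum_apply, smul_apply, smul_eq_mul]
    simp only [antiI_apply, map_add, map_sub, map_smul, smul_eq_mul, Finset.sum_add_distrib,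
      Finset.sum_sub_distrib] at h1
    rw [h3 _ _ hv, h3 _ _ (hI _), h3 _ _ (hI _), h3 _ _ (hI _)] at h1
    have h4 := trace_quad F hx hv (LinearMap.mk₂ ℝ (fun u w ↦ A.g.inner x (τ u) (F.I s x w))
      (by simp) (by simp) (by simp) (by simp))
    simp only [LinearMap.mk₂_apply] at h4
    rw [h2, mul_zero, Fin.sum_univ_succ] at h4
    simp only [quad, Fin.cons_zero, Fin.cons_succ, Fin.sum_univ_three] at h4
    obtain ⟨⟨a1, a2, a3⟩, ⟨b1, b2, b3⟩, c1, c2, c3⟩ := I_table F hx hv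
    have z1 : (2 : Fin 3) + 1 = 0 := rfl
    have z2 : (2 : Fin 3) + 2 = 1 := rfl
    have z3 : (1 : Fin 3) + 2 = 0 := rfl
    have z4 : (1 : Fin 3) + 1 = 2 := rfl
    fin_cases s <;>
      simp only [Fin.zero_eta, Fin.mk_one, Fin.reduceFinMk, zero_add, z1, z2, z3, z4, a1, a2, a3,
        b1, b2, b3, c1, c2, c3, map_neg] at h4 h1 ⊢ <;> linarith
  by_cases hv0 : v = 0
  · simp [hv0]
  have hN := (A.g.pos x v hv0).ne'
  have hk (i : Fin 4) : A.g.inner x (τ v) (quad F x v i) = A.g.inner x (τ (quad F x v i)) v := by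
    refine Fin.cases rfl (fun s ↦ key s hv) i
  have hq := quad_expand F hx hv hw
  have h1 := congrArg (fun w ↦ A.g.inner x (τ v) w) hq
  have h2 := congrArg (fun w ↦ A.g.inner x (τ w) v) hq
  simp only [map_sum, map_smul, sum_apply, smul_apply, smul_eq_mul, hk] at h1 h2
  exact mul_left_cancel₀ hN (h1.trans h2.symm)

section Curvature

variable (F : A.toQCData.LocalFrame) {x : M} (hx : x ∈ F.dom) {X Y Z W : VField M}
  (hX : SmoothOn X F.dom) (hY : SmoothOn Y F.dom) (hZ : SmoothOn Z F.dom) (hW : SmoothOn W F.dom)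

include hx hX hY hZ

lemma curvature_mem_H (hH : ∀ y ∈ F.dom, Z y ∈ A.H y) : curvature cov X Y Z x ∈ A.H x := by
  have hc := hcov.smooth
  have hU := F.isOpen_dom
  have h (V W : VField M) (hV : SmoothOn V F.dom) (hW : SmoothOn W F.dom) :
      nabla cov V (nabla cov W Z) x ∈ A.H x :=
    cov_mem_H hcov F hx (SmoothOn.nabla hc hU hW hZ) (fun y hy ↦ cov_mem_H hcov F hy hZ hH _) _
  exact Submodule.sub_mem _ (Submodule.sub_mem _ (h X Y hX hY) (h Y X hY hX))
    (cov_mem_H hcov F hx hZ hH _)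

include hW

/-- Apply the commutator of X and Y minus [X, Y] to the function g(Z, W). The result is zero, and
since the connection is metric on the whole tangent bundle the products of first derivatives cancel.
-/
lemma curvature_skew :
    A.g.inner x (curvature cov X Y Z x) (W x) = -A.g.inner x (curvature cov X Y W x) (Z x) := by
  have hc := hcov.smooth
  have hU := F.isOpen_dom
  have hb := df_bracket hU hX hY (FunOn.inner A.g hZ hW) hx (F.smooth_e 0) (e_ne_zero F hx 0)
  have h (V Y : VField M) (hV : SmoothOn V F.dom) (hY : SmoothOn Y F.dom) :
      df (fun y ↦ df (fun y ↦ A.g.inner y (Z y) (W y)) y (Y y)) x (V x)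
      = (A.g.inner x (nabla cov V (nabla cov Y Z) x) (W x)
          + A.g.inner x (nabla cov Y Z x) (nabla cov V W x))
        + (A.g.inner x (nabla cov V Z x) (nabla cov Y W x)
          + A.g.inner x (Z x) (nabla cov V (nabla cov Y W) x)) := by
    have a1 := SmoothOn.nabla hc hU hY hZ
    have a2 := SmoothOn.nabla hc hU hY hW
    rw [df_congr_on hU hx (v := fun y ↦ A.g.inner y (nabla cov Y Z y) (W y)
      + A.g.inner y (Z y) (nabla cov Y W y)) (fun y hy ↦ metric hcov F hy hZ hW (Y y))]
    rw [df_add ((FunOn.inner A.g a1 hW).mdiffAt hU hx) ((FunOn.inner A.g hZ a2).mdiffAt hU hx)]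
    exact congrArg₂ _ (metric hcov F hx a1 hW (V x)) (metric hcov F hx hZ a2 (V x))
  rw [h X Y hX hY, h Y X hY hX, metric hcov F hx hZ hW] at hb
  simp only [curvature, Pi.sub_apply, inner_sub_left]
  rw [A.g.symm x (Z x), A.g.symm x (Z x), A.g.symm x (Z x), A.g.symm x (nabla cov X Z x),
    A.g.symm x (nabla cov Y Z x)] at hb
  simp only [nabla] at hb ⊢
  linarith

omit hW

/-- The commutator of the curvature with the almost complex structures. -/
lemma curvature_I (s : Fin 3) :
    curvature cov X Y (fun y ↦ F.I s y (Z y)) x = F.I s x (curvature cov X Y Z x)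
      + ∑ t, A.g.inner x (curvature cov X Y (F.ξ s) x) (F.ξ t x) • F.I t x (Z x) := by
  have hc := hcov.smooth
  have hU := F.isOpen_dom
  have hcf (s t : Fin 3) {V : VField M} (hV : SmoothOn V F.dom) :
      FunOn (fun y ↦ conn cov F s t y (V y)) F.dom :=
    FunOn.inner A.g (SmoothOn.nabla hc hU hV (F.smooth_ξ s)) (F.smooth_ξ t)
  have hI (s : Fin 3) {Z : VField M} (hZ : SmoothOn Z F.dom) :
      SmoothOn (fun y ↦ F.I s y (Z y)) F.dom := smooth_I F s hZ
  -- Two differentiations of the rule for ∇(I_s Z). The terms with one derivative on Z and one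
  -- connection form are symmetric in the two directions.
  have h2 (V Y : VField M) (hV : SmoothOn V F.dom) (hY : SmoothOn Y F.dom) :
      nabla cov V (nabla cov Y (fun y ↦ F.I s y (Z y))) x
      = (F.I s x (nabla cov V (nabla cov Y Z) x)
          + ∑ t, conn cov F s t x (V x) • F.I t x (nabla cov Y Z x))
        + ∑ t, (conn cov F s t x (Y x) • (F.I t x (nabla cov V Z x)
            + ∑ r, conn cov F t r x (V x) • F.I r x (Z x))
          + df (fun y ↦ conn cov F s t y (Y y)) x (V x) • F.I t x (Z x)) := by
    have a1 := hI s (SmoothOn.nabla hc hU hY hZ)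
    have a2 (t) := SmoothOn.smul (hcf s t hY) (hI t hZ)
    have a3 := SmoothOn.sum (s := Finset.univ) fun t _ ↦ a2 t
    rw [nabla, cov_congr hU hx
      ((SmoothOn.nabla hc hU hY (hI s hZ)).diffAt hU hx) ((a1.add a3).diffAt hU hx)
      (fun y hy ↦ cov_I hcov F hy s hZ (Y y)), cov_add (a1.diffAt hU hx) (a3.diffAt hU hx),
      cov_sum fun t _ ↦ (a2 t).diffAt hU hx]
    refine congrArg₂ _ (cov_I hcov F hx s (SmoothOn.nabla hc hU hY hZ) (V x))
      (Finset.sum_congr rfl fun t _ ↦ ?_)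
    rw [cov_smul ((hcf s t hY).mdiffAt hU hx) ((hI t hZ).diffAt hU hx),
      cov_I hcov F hx t hZ]
    rfl
  -- The same connection forms describe ∇ξ_s, so the terms without derivatives of Z assemble into
  -- the curvature of V.
  have h3 (V Y : VField M) (hV : SmoothOn V F.dom) (hY : SmoothOn Y F.dom) (t : Fin 3) :
      A.g.inner x (nabla cov V (nabla cov Y (F.ξ s)) x) (F.ξ t x)
      = ∑ r, conn cov F s r x (Y x) * conn cov F r t x (V x)
          + df (fun y ↦ conn cov F s t y (Y y)) x (V x) := by
    have a2 (t) := SmoothOn.smul (hcf s t hY) (F.smooth_ξ t)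
    have a3 := SmoothOn.sum (s := Finset.univ) fun t _ ↦ a2 t
    rw [nabla, cov_congr hU hx
      ((SmoothOn.nabla hc hU hY (F.smooth_ξ s)).diffAt hU hx) (a3.diffAt hU hx)
      (fun y hy ↦ cov_ξ hcov F hy s (Y y)), cov_sum fun t _ ↦ (a2 t).diffAt hU hx, inner_sum_left]
    have (r : Fin 3) : A.g.inner x (cov (fun y ↦ conn cov F s r y (Y y) • F.ξ r y) x (V x)) (F.ξ t x)
        = conn cov F s r x (Y x) * conn cov F r t x (V x)
          + df (fun y ↦ conn cov F s r y (Y y)) x (V x) * (if r = t then 1 else 0) := by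
      rw [cov_smul ((hcf s r hY).mdiffAt hU hx) ((F.smooth_ξ r).diffAt hU hx),
        inner_add_left, inner_smul_left, inner_smul_left, F.g_ξ_ξ x hx]
      rfl
    simp only [this, Finset.sum_add_distrib, mul_ite, mul_one, mul_zero, Finset.sum_ite_eq',
      Finset.mem_univ, if_true]
  have h4 (t : Fin 3) : A.g.inner x (curvature cov X Y (F.ξ s) x) (F.ξ t x)
      = (∑ r, conn cov F s r x (Y x) * conn cov F r t x (X x)
          + df (fun y ↦ conn cov F s t y (Y y)) x (X x))
        - (∑ r, conn cov F s r x (X x) * conn cov F r t x (Y x)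
          + df (fun y ↦ conn cov F s t y (X y)) x (Y x))
        - conn cov F s t x (VectorField.mlieBracket (𝓡 7) X Y x) := by
    simp only [curvature, Pi.sub_apply, inner_sub_left]
    rw [h3 X Y hX hY, h3 Y X hY hX]
    rfl
  have h5 : nabla cov (VectorField.mlieBracket (𝓡 7) X Y) (fun y ↦ F.I s y (Z y)) x
      = F.I s x (nabla cov (VectorField.mlieBracket (𝓡 7) X Y) Z x)
        + ∑ t, conn cov F s t x (VectorField.mlieBracket (𝓡 7) X Y x) • F.I t x (Z x) :=
    cov_I hcov F hx s hZ _
  have h6 : curvature cov X Y Z x = nabla cov X (nabla cov Y Z) x - nabla cov Y (nabla cov X Z) x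
      - nabla cov (VectorField.mlieBracket (𝓡 7) X Y) Z x := rfl
  simp only [h4]
  rw [curvature, Pi.sub_apply, Pi.sub_apply, h2 X Y hX hY, h2 Y X hY hX, h5, h6]
  simp only [map_sub, Fin.sum_univ_three]
  module

end Curvature

end QCStructure

end QuaternionicContact

/-! ### Bianchi identities with horizontal and vertical fields; the pointwise curvature tensor. -/

namespace QuaternionicContact

namespace QCStructure

variable {M : Type*} [TopologicalSpace M] [ChartedSpace (EuclideanSpace ℝ (Fin 7)) M]
  [IsManifold (𝓡 7) ∞ M] [T2Space M] {A : QCStructure M}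
  {cov : CovariantDerivative (𝓡 7) (EuclideanSpace ℝ (Fin 7)) (fun x : M ↦ TangentSpace (𝓡 7) x)}
  (hcov : A.IsBiquard cov) (F : A.toQCData.LocalFrame) {x : M} (hx : x ∈ F.dom)

section Fields

variable {X Y Z : VField M}
  (hX : SmoothOn X F.dom) (hY : SmoothOn Y F.dom) (hZ : SmoothOn Z F.dom)
  (hXH : ∀ y ∈ F.dom, X y ∈ A.H y) (hYH : ∀ y ∈ F.dom, Y y ∈ A.H y)

include hcov hx hX hY

lemma torsion_bracket (V : TangentSpace (𝓡 7) x) :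
    cov.torsion x V (VectorField.mlieBracket (𝓡 7) X Y x)
      = cov.torsion x V (nabla cov X Y x) - cov.torsion x V (nabla cov Y X x)
        - cov.torsion x V (cov.torsion x (X x) (Y x)) := by
  rw [torsion_eq (hX.diffAt F.isOpen_dom hx) (hY.diffAt F.isOpen_dom hx), map_sub, map_sub]
  abel

include hXH hYH hZ

/-- The first Bianchi identity on the horizontal space. -/
lemma bianchi_H (hZH : ∀ y ∈ F.dom, Z y ∈ A.H y) {w : TangentSpace (𝓡 7) x} (hw : w ∈ A.H x) :
    A.g.inner x (curvature cov X Y Z x) w + A.g.inner x (curvature cov Y Z X x) w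
        + A.g.inner x (curvature cov Z X Y x) w
      = 2 * ∑ s, (A.g.inner x (F.I s x (Y x)) (Z x) * A.g.inner x (cov.torsion x (F.ξ s x) (X x)) w
        + A.g.inner x (F.I s x (Z x)) (X x) * A.g.inner x (cov.torsion x (F.ξ s x) (Y x)) w
        + A.g.inner x (F.I s x (X x)) (Y x) * A.g.inner x (cov.torsion x (F.ξ s x) (Z x)) w) := by
  have hc := hcov.smooth
  have hU := F.isOpen_dom
  have h1 (X Y Z : VField M) (hX : SmoothOn X F.dom) (hY : SmoothOn Y F.dom)
      (hZ : SmoothOn Z F.dom) (hXH : ∀ y ∈ F.dom, X y ∈ A.H y)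
      (hYH : ∀ y ∈ F.dom, Y y ∈ A.H y) (hZH : ∀ y ∈ F.dom, Z y ∈ A.H y) :
      A.g.inner x (cov.torsion x (X x) (VectorField.mlieBracket (𝓡 7) Y Z x)
          + nabla cov X (torsionField cov Y Z) x) w
        = 2 * ∑ s, A.g.inner x (F.I s x (Y x)) (Z x)
          * A.g.inner x (cov.torsion x (F.ξ s x) (X x)) w := by
    -- For horizontal arguments T(Y, Z), its covariant derivative, and T(X, ∇_Y Z) are all vertical,
    -- so the only horizontal contribution of the cyclic sum is T(X, T(Y, Z)).
    have a1 : A.g.inner x (nabla cov X (torsionField cov Y Z) x) w = 0 :=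
      cov_mem_V hcov F hx (SmoothOn.torsionField hc hU hY hZ)
        (fun y hy ↦ hcov.torsion_mem_V y _ (hYH y hy) _ (hZH y hy)) _ _ hw
    have a2 (Y Z : VField M) (hZ : SmoothOn Z F.dom) (hZH : ∀ y ∈ F.dom, Z y ∈ A.H y) :
        A.g.inner x (cov.torsion x (X x) (nabla cov Y Z x)) w = 0 :=
      hcov.torsion_mem_V x _ (hXH x hx) _ (cov_mem_H hcov F hx hZ hZH _) _ hw
    rw [inner_add_left, a1, torsion_bracket hcov F hx hY hZ, inner_sub_left, inner_sub_left,
      a2 Y Z hZ hZH, a2 Z Y hY hYH, torsion_H hcov F hx (hYH x hx) (hZH x hx), map_sum,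
      inner_sum_left, Finset.mul_sum]
    simp only [torsion_swap hcov F hx (X x), map_smul, map_neg, smul_apply, neg_apply, smul_eq_mul]
    rw [sub_zero, zero_sub, add_zero, ← Finset.sum_neg_distrib]
    exact Finset.sum_congr rfl fun s _ ↦ by ring
  have key := congrArg (fun u ↦ A.g.inner x u w) (bianchi hc hU hX hY hZ hx)
  simp only [inner_add_left _ (_ + _)] at key
  rw [inner_add_left (_ + _), h1 X Y Z hX hY hZ hXH hYH hZH, h1 Y Z X hY hZ hX hYH hZH hXH,
    h1 Z X Y hZ hX hY hZH hXH hYH] at key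
  rw [inner_add_left] at key
  rw [key, Finset.sum_add_distrib, Finset.sum_add_distrib]
  ring

omit hZ

/-- The curvature of the vertical bundle in horizontal directions. -/
lemma curvature_ξ (s t : Fin 3) :
    A.g.inner x (curvature cov X Y (F.ξ s) x) (F.ξ t x)
      = 2 * A.g.inner x (F.I t x (X x)) (cov.torsion x (F.ξ s x) (Y x))
        - 2 * A.g.inner x (F.I t x (Y x)) (cov.torsion x (F.ξ s x) (X x))
        - 2 * ∑ p, A.g.inner x (F.I p x (X x)) (Y x)
          * A.g.inner x (cov.torsion x (F.ξ s x) (F.ξ p x)) (F.ξ t x) := by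
  have hc := hcov.smooth
  have hU := F.isOpen_dom
  have hξ := F.smooth_ξ
  have hV := fun s y hy ↦ ξ_mem_V F (x := y) hy s
  have vv {v : TangentSpace (𝓡 7) x} (hv : v ∈ A.H x) : A.g.inner x v (F.ξ t x) = 0 :=
    inner_H_V F hx hv (hV t x hx)
  have hTV {v w : TangentSpace (𝓡 7) x} (hv : v ∈ A.H x) (hw : w ∈ A.V x) :
      cov.torsion x v w ∈ A.H x := by
    rw [torsion_swap hcov F hx]
    exact Submodule.neg_mem _ (hcov.torsion_vertical_mem x _ hw _ hv)
  have key := congrArg (fun u ↦ A.g.inner x u (F.ξ t x)) (bianchi hc hU hX hY (hξ s) hx)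
  simp only [inner_add_left _ (_ + _), inner_add_left (_ + _)] at key
  rw [inner_add_left, inner_add_left, inner_add_left, inner_add_left] at key
  -- R(Y, ξ_s)X and R(ξ_s, X)Y are horizontal, hence the ξ_t-component of the Bianchi identity
  -- isolates R(X, Y)ξ_s.
  rw [vv (curvature_mem_H hcov F hx hY (hξ s) hX hXH),
    vv (curvature_mem_H hcov F hx (hξ s) hX hY hYH)] at key
  have h1 (X Y : VField M) (hY : SmoothOn Y F.dom) (hYH : ∀ y ∈ F.dom, Y y ∈ A.H y) :
      A.g.inner x (nabla cov X (torsionField cov Y (F.ξ s)) x) (F.ξ t x) = 0 := by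
    refine vv (cov_mem_H hcov F hx (SmoothOn.torsionField hc hU hY (hξ s)) (fun y hy ↦ ?_) _)
    rw [torsionField, torsion_swap hcov F hy]
    exact Submodule.neg_mem _ (torsion_ξ_mem hcov F hy s (hYH y hy))
  have h1' : A.g.inner x (nabla cov Y (torsionField cov (F.ξ s) X) x) (F.ξ t x) = 0 :=
    vv (cov_mem_H hcov F hx (SmoothOn.torsionField hc hU (hξ s) hX)
      (fun y hy ↦ torsion_ξ_mem hcov F hy s (hXH y hy)) _)
  have cH (Y Z : VField M) (hZ : SmoothOn Z F.dom) (hZH : ∀ y ∈ F.dom, Z y ∈ A.H y) :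
      nabla cov Y Z x ∈ A.H x := cov_mem_H hcov F hx hZ hZH _
  have cV (Y : VField M) : nabla cov Y (F.ξ s) x ∈ A.V x := cov_mem_V hcov F hx (hξ s) (hV s) _
  have h2 : A.g.inner x (cov.torsion x (X x) (VectorField.mlieBracket (𝓡 7) Y (F.ξ s) x)) (F.ξ t x)
      = -(2 * A.g.inner x (F.I t x (X x)) (nabla cov (F.ξ s) Y x))
        + 2 * A.g.inner x (F.I t x (X x)) (cov.torsion x (F.ξ s x) (Y x)) := by
    rw [torsion_bracket hcov F hx hY (hξ s), inner_sub_left, inner_sub_left,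
      vv (hTV (hXH x hx) (cV Y)), inner_torsion_ξ hcov F hx (hXH x hx) (cH _ Y hY hYH),
      torsion_swap hcov F hx (Y x), map_neg, inner_neg_left,
      inner_torsion_ξ hcov F hx (hXH x hx) (torsion_ξ_mem hcov F hx s (hYH x hx))]
    ring
  have h3 : A.g.inner x (cov.torsion x (Y x) (VectorField.mlieBracket (𝓡 7) (F.ξ s) X x)) (F.ξ t x)
      = 2 * A.g.inner x (F.I t x (Y x)) (nabla cov (F.ξ s) X x)
        - 2 * A.g.inner x (F.I t x (Y x)) (cov.torsion x (F.ξ s x) (X x)) := by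
    rw [torsion_bracket hcov F hx (hξ s) hX, inner_sub_left, inner_sub_left,
      vv (hTV (hYH x hx) (cV X)), inner_torsion_ξ hcov F hx (hYH x hx) (cH _ X hX hXH),
      inner_torsion_ξ hcov F hx (hYH x hx) (torsion_ξ_mem hcov F hx s (hXH x hx))]
    ring
  have h4 : A.g.inner x (cov.torsion x (F.ξ s x) (VectorField.mlieBracket (𝓡 7) X Y x)) (F.ξ t x)
      = - (2 * ∑ p, A.g.inner x (F.I p x (X x)) (Y x)
          * A.g.inner x (cov.torsion x (F.ξ s x) (F.ξ p x)) (F.ξ t x)) := by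
    rw [torsion_bracket hcov F hx hX hY, inner_sub_left, inner_sub_left,
      vv (torsion_ξ_mem hcov F hx s (cH X Y hY hYH)), vv (torsion_ξ_mem hcov F hx s (cH Y X hX hXH)),
      torsion_H hcov F hx (hXH x hx) (hYH x hx), map_sum, inner_sum_left, Finset.mul_sum]
    simp only [map_smul, smul_apply, smul_eq_mul, sub_zero, zero_sub, mul_assoc]
  have hI (p : Fin 3) : FunOn (fun y ↦ 2 * A.g.inner y (F.I p y (X y)) (Y y)) F.dom :=
    FunOn.mul (FunOn.const 2) (FunOn.inner A.g (smooth_I F p hX) hY)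
  have hIX (p : Fin 3) : ∀ y ∈ F.dom, F.I p y (X y) ∈ A.H y :=
    fun y hy ↦ F.I_mem y hy p _ (hXH y hy)
  -- Differentiating T(X, Y) = 2 Σ g(I_p X, Y) ξ_p along ξ_s: the connection forms coming from ξ_p
  -- and from I_t cancel by skewness. What is left cancels against the ∇_{ξ_s}X and ∇_{ξ_s}Y terms
  -- of `h2` and `h3`, so the final formula is tensorial.
  have h5 : A.g.inner x (nabla cov (F.ξ s) (torsionField cov X Y) x) (F.ξ t x)
      = 2 * A.g.inner x (F.I t x (nabla cov (F.ξ s) X x)) (Y x)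
        + 2 * A.g.inner x (F.I t x (X x)) (nabla cov (F.ξ s) Y x) := by
    have a1 (p) := SmoothOn.smul (hI p) (hξ p)
    rw [nabla, cov_congr hU hx ((SmoothOn.torsionField hc hU hX hY).diffAt hU hx)
      ((SmoothOn.sum fun p (_ : p ∈ Finset.univ) ↦ a1 p).diffAt hU hx)
      (fun y hy ↦ torsion_H hcov F hy (hXH y hy) (hYH y hy)),
      cov_sum fun p _ ↦ (a1 p).diffAt hU hx, inner_sum_left]
    have a2 (p : Fin 3) : A.g.inner x (cov (fun y ↦ (2 * A.g.inner y (F.I p y (X y)) (Y y)) • F.ξ p y)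
        x (F.ξ s x)) (F.ξ t x)
        = 2 * A.g.inner x (F.I p x (X x)) (Y x) * conn cov F p t x (F.ξ s x)
          + df (fun y ↦ 2 * A.g.inner y (F.I p y (X y)) (Y y)) x (F.ξ s x)
            * (if p = t then 1 else 0) := by
      rw [cov_smul ((hI p).mdiffAt hU hx) ((hξ p).diffAt hU hx), inner_add_left, inner_smul_left,
        inner_smul_left, F.g_ξ_ξ x hx]
      rfl
    simp only [a2, Finset.sum_add_distrib, mul_ite, mul_one, mul_zero, Finset.sum_ite_eq',
      Finset.mem_univ, if_true]
    rw [df_const_mul 2 ((FunOn.inner A.g (smooth_I F t hX) hY).mdiffAt hU hx),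
      metric hcov F hx (smooth_I F t hX) hY, cov_I hcov F hx t hX, inner_add_left, inner_sum_left]
    simp only [inner_smul_left]
    have a3 : ∑ p, conn cov F t p x (F.ξ s x) * A.g.inner x (F.I p x (X x)) (Y x)
        = -∑ p, A.g.inner x (F.I p x (X x)) (Y x) * conn cov F p t x (F.ξ s x) := by
      rw [← Finset.sum_neg_distrib]
      exact Finset.sum_congr rfl fun p _ ↦ by rw [conn_skew hcov F hx t p]; ring
    rw [a3]
    simp only [mul_assoc, ← Finset.mul_sum, nabla]
    ring
  rw [h1 X Y hY hYH, h1', h2, h3, h4, h5] at key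
  have h6 := I_skew F hx t (cH (F.ξ s) X hX hXH) (hYH x hx)
  rw [A.g.symm x (nabla cov (F.ξ s) X x)] at h6
  rw [h6] at key
  linarith

end Fields

variable (cov) in
/-- The curvature of horizontal vectors at a point. -/
def riem (x : M) (u v w : TangentSpace (𝓡 7) x) : TangentSpace (𝓡 7) x :=
  ∑ a, ∑ b, ∑ c, (A.g.inner x u (F.e a x) * A.g.inner x v (F.e b x) * A.g.inner x w (F.e c x))
    • curvature cov (F.e a) (F.e b) (F.e c) x

section Fields

variable {X Y Z : VField M}
  (hX : SmoothOn X F.dom) (hY : SmoothOn Y F.dom) (hZ : SmoothOn Z F.dom)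
  (hXH : ∀ y ∈ F.dom, X y ∈ A.H y) (hYH : ∀ y ∈ F.dom, Y y ∈ A.H y)
  (hZH : ∀ y ∈ F.dom, Z y ∈ A.H y)

include hcov hx hX hY hZ hXH hYH hZH in
-- Tensoriality of the curvature. It allows the identities for fields to be used for single vectors,
-- where `riem` is linear in each slot by its definition.
lemma curvature_eq_riem : curvature cov X Y Z x = riem cov F x (X x) (Y x) (Z x) := by
  have hU := F.isOpen_dom
  rw [curvature_congr hcov.smooth hU hX hY hZ (fun y hy ↦ expand_H F hy (hXH y hy))
    (fun y hy ↦ expand_H F hy (hYH y hy)) (fun y hy ↦ expand_H F hy (hZH y hy)) hx]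
  exact curvature_sum hcov.smooth hU F.smooth_e (fun a ↦ FunOn.inner A.g hX (F.smooth_e a))
    (fun a ↦ FunOn.inner A.g hY (F.smooth_e a)) (fun a ↦ FunOn.inner A.g hZ (F.smooth_e a)) hx

end Fields

section Pointwise

variable {u v w z : TangentSpace (𝓡 7) x}

/-- The extension of a horizontal vector with constant coefficients. -/
def constExt (x : M) (u : TangentSpace (𝓡 7) x) : VField M :=
  fun y ↦ ∑ a, A.g.inner x u (F.e a x) • F.e a y

lemma smooth_constExt (u : TangentSpace (𝓡 7) x) : SmoothOn (constExt F x u) F.dom :=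
  SmoothOn.sum fun a _ ↦ SmoothOn.const_smul _ (F.smooth_e a)

lemma constExt_mem (u : TangentSpace (𝓡 7) x) : ∀ y ∈ F.dom, constExt F x u y ∈ A.H y :=
  fun y hy ↦ Submodule.sum_mem _ fun a _ ↦ Submodule.smul_mem _ _ (F.e_mem y hy a)

include hx

lemma constExt_self (hu : u ∈ A.H x) : constExt F x u x = u := (expand_H F hx hu).symm

include hcov

lemma riem_eq_curvature (hu : u ∈ A.H x) (hv : v ∈ A.H x) (hw : w ∈ A.H x) :
    riem cov F x u v w = curvature cov (constExt F x u) (constExt F x v) (constExt F x w) x := by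
  rw [curvature_eq_riem hcov F hx (smooth_constExt F u) (smooth_constExt F v) (smooth_constExt F w)
    (constExt_mem F u) (constExt_mem F v) (constExt_mem F w), constExt_self F hx hu,
    constExt_self F hx hv, constExt_self F hx hw]

lemma riem_swap (hu : u ∈ A.H x) (hv : v ∈ A.H x) (hw : w ∈ A.H x) :
    A.g.inner x (riem cov F x u v w) z = -A.g.inner x (riem cov F x v u w) z := by
  rw [riem_eq_curvature hcov F hx hu hv hw, riem_eq_curvature hcov F hx hv hu hw, curvature_swap,
    inner_neg_left]

lemma riem_skew (hu : u ∈ A.H x) (hv : v ∈ A.H x) (hw : w ∈ A.H x) (hz : z ∈ A.H x) :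
    A.g.inner x (riem cov F x u v w) z = -A.g.inner x (riem cov F x u v z) w := by
  have := curvature_skew hcov F hx (smooth_constExt F u) (smooth_constExt F v) (smooth_constExt F w)
    (smooth_constExt F z)
  rw [constExt_self F hx hw, constExt_self F hx hz] at this
  rw [riem_eq_curvature hcov F hx hu hv hw, riem_eq_curvature hcov F hx hu hv hz, this]

lemma riem_bianchi (hu : u ∈ A.H x) (hv : v ∈ A.H x) (hw : w ∈ A.H x) (hz : z ∈ A.H x) :
    A.g.inner x (riem cov F x u v w) z + A.g.inner x (riem cov F x v w u) z
        + A.g.inner x (riem cov F x w u v) z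
      = 2 * ∑ s, (A.g.inner x (F.I s x v) w * A.g.inner x (cov.torsion x (F.ξ s x) u) z
        + A.g.inner x (F.I s x w) u * A.g.inner x (cov.torsion x (F.ξ s x) v) z
        + A.g.inner x (F.I s x u) v * A.g.inner x (cov.torsion x (F.ξ s x) w) z) := by
  have := bianchi_H hcov F hx (smooth_constExt F u) (smooth_constExt F v) (smooth_constExt F w)
    (constExt_mem F u) (constExt_mem F v) (constExt_mem F w) hz
  simp only [constExt_self F hx hu, constExt_self F hx hv, constExt_self F hx hw] at this
  rw [riem_eq_curvature hcov F hx hu hv hw, riem_eq_curvature hcov F hx hv hw hu,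
    riem_eq_curvature hcov F hx hw hu hv, this]

/-- The failure of R(u, v) to commute with I_s is the curvature of V in the directions u, v, and the
Bianchi identity has expressed that curvature through the torsion. -/
lemma riem_I (s : Fin 3) (hu : u ∈ A.H x) (hv : v ∈ A.H x) (hw : w ∈ A.H x) (hz : z ∈ A.H x) :
    A.g.inner x (riem cov F x u v (F.I s x w)) z + A.g.inner x (riem cov F x u v w) (F.I s x z)
      = ∑ t, (2 * A.g.inner x (F.I t x u) (cov.torsion x (F.ξ s x) v)
        - 2 * A.g.inner x (F.I t x v) (cov.torsion x (F.ξ s x) u)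
        - 2 * ∑ p, A.g.inner x (F.I p x u) v
          * A.g.inner x (cov.torsion x (F.ξ s x) (F.ξ p x)) (F.ξ t x)) * A.g.inner x (F.I t x w) z := by
  have su := smooth_constExt F u
  have sv := smooth_constExt F v
  have sw := smooth_constExt F w
  have h := curvature_I hcov F hx su sv sw s
  have h2 := curvature_ξ hcov F hx su sv (constExt_mem F u) (constExt_mem F v) s
  rw [curvature_eq_riem hcov F hx su sv (smooth_I F s sw) (constExt_mem F u) (constExt_mem F v)
    (fun y hy ↦ F.I_mem y hy s _ (constExt_mem F w y hy))] at h
  simp only [constExt_self F hx hu, constExt_self F hx hv, constExt_self F hx hw,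
    ← riem_eq_curvature hcov F hx hu hv hw] at h h2
  have hR : riem cov F x u v w ∈ A.H x := by
    rw [riem_eq_curvature hcov F hx hu hv hw]
    exact curvature_mem_H hcov F hx su sv sw (constExt_mem F w)
  rw [h, inner_add_left, I_skew F hx s hR hz, inner_sum_left]
  simp only [inner_smul_left, h2]
  ring

end Pointwise

end QCStructure

end QuaternionicContact

/-! ### The horizontal Ricci tensor. -/

namespace QuaternionicContact

namespace QCStructure

/-- The matrices of the almost complex structures in a quadruple `v, I₁ v, I₂ v, I₃ v`. -/
def quatMatrix : Fin 3 → Fin 4 → Fin 4 → ℝ :=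
  ![![![0, 1, 0, 0], ![-1, 0, 0, 0], ![0, 0, 0, 1], ![0, 0, -1, 0]],
    ![![0, 0, 1, 0], ![0, 0, 0, -1], ![-1, 0, 0, 0], ![0, 1, 0, 0]],
    ![![0, 0, 0, 1], ![0, 0, 1, 0], ![0, -1, 0, 0], ![-1, 0, 0, 0]]]

/-- The algebraic identity behind the formula for the horizontal Ricci tensor. -/
lemma ricci_algebra (N : ℝ) (ρ : Fin 4 → Fin 4 → Fin 4 → Fin 4 → ℝ) (τ : Fin 3 → Fin 4 → Fin 4 → ℝ)
    (κ : Fin 3 → Fin 3 → Fin 3 → ℝ) (hρ₁ : ∀ i j k l, ρ i j k l = -ρ j i k l)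
    (hρ₂ : ∀ i j k l, ρ i j k l = -ρ i j l k) (hτ : ∀ s i j, τ s i j = τ s j i)
    (hκ : ∀ s p t, κ s p t = -κ p s t)
    (hB : ∀ i j k l, ρ i j k l + ρ j k i l + ρ k i j l = 2 * ∑ s,
      (N * quatMatrix s j k * τ s i l + N * quatMatrix s k i * τ s j l
        + N * quatMatrix s i j * τ s k l))
    (hI : ∀ s i j k l, ∑ m, quatMatrix s k m * ρ i j m l + ∑ m, quatMatrix s l m * ρ i j k m
      = ∑ t, (2 * ∑ m, quatMatrix t i m * τ s j m - 2 * ∑ m, quatMatrix t j m * τ s i m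
        - 2 * ∑ p, N * quatMatrix p i j * κ s p t) * (N * quatMatrix t k l)) :
    ∑ i, ρ i 0 0 i = 4 * N * ∑ s : Fin 3, τ s s.succ 0 + 1 / 4 * ∑ i, ∑ j, ρ j i i j := by
  have r (i k l) : ρ i i k l = 0 := by have := hρ₁ i i k l; linarith
  have r' (i j k) : ρ i j k k = 0 := by have := hρ₂ i j k k; linarith
  have κ0 (s t) : κ s s t = 0 := by have := hκ s s t; linarith
  -- Six instances of the commutator relation and four of the Bianchi identity suffice to solve for
  -- the Ricci entry in the direction of the first vector.
  have c1 := hI 0 1 2 2 0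
  have c2 := hI 2 0 1 3 1
  have c3 := hI 2 1 3 3 2
  have c4 := hI 1 0 3 2 3
  have c5 := hI 1 2 3 1 2
  have c6 := hI 0 0 2 0 3
  have b1 := hB 1 2 3 0
  have b2 := hB 0 1 3 2
  have b3 := hB 0 1 2 3
  have b4 := hB 0 2 3 1
  have s1 : (0 : Fin 3).succ = (1 : Fin 4) := rfl
  have s2 : (1 : Fin 3).succ = (2 : Fin 4) := rfl
  have s3 : (2 : Fin 3).succ = (3 : Fin 4) := rfl
  simp only [quatMatrix, Fin.sum_univ_four, Fin.sum_univ_three, Matrix.cons_val, mul_zero, zero_mul,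
    add_zero, zero_add, mul_one, one_mul, mul_neg, neg_mul, r, r', κ0,
    hρ₁ 1 0, hρ₁ 2 0, hρ₁ 3 0, hρ₁ 2 1, hρ₁ 3 1, hρ₁ 3 2, hρ₂ _ _ 1 0, hρ₂ _ _ 2 0, hρ₂ _ _ 3 0,
    hρ₂ _ _ 2 1, hρ₂ _ _ 3 1, hρ₂ _ _ 3 2, hτ _ 1 0, hτ _ 2 0, hτ _ 3 0, hτ _ 2 1, hτ _ 3 1,
    hτ _ 3 2, hκ 1 0, hκ 2 0, hκ 2 1, neg_neg, neg_zero, s1, s2, s3] at c1 c2 c3 c4 c5 c6 b1 b2 b3 b4 ⊢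
  -- The coefficients solve the linear system that eliminates the remaining curvature components.
  -- The terms in κ, the vertical part of the vertical torsion, cancel using only its antisymmetry
  -- in the first two indices.
  linear_combination -1 / 2 * c1 + 1 / 2 * c2 + 1 / 2 * c3 + 1 / 2 * c4 + 1 / 2 * c5 + 1 / 2 * c6
    + 3 / 4 * b1 - 1 / 4 * b2 + 1 / 4 * b3 + 1 / 4 * b4

variable {M : Type*} [TopologicalSpace M] [ChartedSpace (EuclideanSpace ℝ (Fin 7)) M]
  [IsManifold (𝓡 7) ∞ M] {A : QCStructure M}
  {cov : CovariantDerivative (𝓡 7) (EuclideanSpace ℝ (Fin 7)) (fun x : M ↦ TangentSpace (𝓡 7) x)}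
  (F : A.toQCData.LocalFrame) {x : M} (hx : x ∈ F.dom)

include hx in
lemma I_quad (s : Fin 3) {v : TangentSpace (𝓡 7) x} (hv : v ∈ A.H x) (i : Fin 4) :
    F.I s x (quad F x v i) = ∑ m, quatMatrix s i m • quad F x v m := by
  obtain ⟨⟨a1, a2, a3⟩, ⟨b1, b2, b3⟩, c1, c2, c3⟩ := I_table F hx hv
  have q0 : quad F x v 0 = v := rfl
  have q1 : quad F x v 1 = F.I 0 x v := rfl
  have q2 : quad F x v 2 = F.I 1 x v := rfl
  have q3 : quad F x v 3 = F.I 2 x v := rfl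
  fin_cases s <;> fin_cases i <;> simp [quatMatrix, Fin.sum_univ_four, q0, q1, q2, q3, a1, a2, a3,
    b1, b2, b3, c1, c2, c3]

lemma riem_sum_third {ι : Type*} [Fintype ι] (u v : TangentSpace (𝓡 7) x) (c : ι → ℝ)
    (w : ι → TangentSpace (𝓡 7) x) :
    riem cov F x u v (∑ i, c i • w i) = ∑ i, c i • riem cov F x u v (w i) := by
  let L : TangentSpace (𝓡 7) x →ₗ[ℝ] TangentSpace (𝓡 7) x :=
    { toFun := riem cov F x u v
      map_add' := fun w w' ↦ by
        simp only [riem, inner_add_left, mul_add, add_smul, Finset.sum_add_distrib]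
      map_smul' := fun c w ↦ by
        simp only [riem, inner_smul_left, mul_left_comm _ c, mul_smul c, ← Finset.smul_sum,
          RingHom.id_apply] }
  exact (map_sum L _ _).trans (Finset.sum_congr rfl fun i _ ↦ map_smul L _ _)

variable [T2Space M] (hcov : A.IsBiquard cov)

include hcov

/-- Since T_ξ is already symmetric on H, taking its symmetric part changes nothing. -/
lemma T0_eq {u v : TangentSpace (𝓡 7) x} (hu : u ∈ A.H x) (hv : v ∈ A.H x) :
    A.T0 cov x u v = ∑ s, A.g.inner x (cov.torsion x ((A.frameAt x).ξ s x)
      ((A.frameAt x).I s x u)) v := by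
  have hx := A.mem_frameAt_dom x
  refine Finset.sum_congr rfl fun s _ ↦ ?_
  have hI := (A.frameAt x).I_mem x hx s u hu
  rw [symmTorsion, A.g.symm x ((A.frameAt x).I s x u),
    torsion_symm hcov (ξ_mem_V _ hx s) hv hI]
  ring

/-- The horizontal Ricci tensor. -/
lemma ricci_eq {v : TangentSpace (𝓡 7) x} (hv : v ∈ A.H x) :
    ∑ a, A.g.inner x (riem cov (A.frameAt x) x ((A.frameAt x).e a x) v v) ((A.frameAt x).e a x)
      = 4 * A.T0 cov x v v + 6 * A.S cov x * A.g.inner x v v := by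
  set F := A.frameAt x with hF
  have hx : x ∈ F.dom := A.mem_frameAt_dom x
  by_cases hv0 : v = 0
  · simp [hv0, riem, T0, symmTorsion]
  have hN := (A.g.pos x v hv0).ne'
  set N := A.g.inner x v v with hNdef
  have hq := quad_mem F hx hv
  have hω (s : Fin 3) (i j : Fin 4) :
      A.g.inner x (F.I s x (quad F x v i)) (quad F x v j) = N * quatMatrix s i j := by
    rw [I_quad F hx s hv]
    simp only [inner_sum_left, inner_smul_left, quad_inner F hx hv, ← hNdef]
    simp [mul_comm]
  have key := ricci_algebra N
    (fun i j k l ↦ A.g.inner x (riem cov F x (quad F x v i) (quad F x v j) (quad F x v k))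
      (quad F x v l))
    (fun s i j ↦ A.g.inner x (cov.torsion x (F.ξ s x) (quad F x v i)) (quad F x v j))
    (fun s p t ↦ A.g.inner x (cov.torsion x (F.ξ s x) (F.ξ p x)) (F.ξ t x))
    (fun i j k l ↦ riem_swap hcov F hx (hq i) (hq j) (hq k))
    (fun i j k l ↦ riem_skew hcov F hx (hq i) (hq j) (hq k) (hq l))
    (fun s i j ↦ torsion_symm hcov (ξ_mem_V F hx s) (hq i) (hq j))
    (fun s p t ↦ by rw [torsion_swap hcov F hx, inner_neg_left])
    (fun i j k l ↦ by
      rw [riem_bianchi hcov F hx (hq i) (hq j) (hq k) (hq l)]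
      simp only [hω])
    (fun s i j k l ↦ by
      have := riem_I hcov F hx s (hq i) (hq j) (hq k) (hq l)
      rw [I_quad F hx s hv k, riem_sum_third, inner_sum_left, I_quad F hx s hv l, map_sum] at this
      simp only [hω] at this
      simp only [I_quad F hx _ hv i, I_quad F hx _ hv j, inner_sum_left, map_smul, smul_apply,
        smul_eq_mul, A.g.symm x (quad F x v _) (cov.torsion x _ _)] at this
      exact this)
  have t1 (w z : TangentSpace (𝓡 7) x) :
      ∑ i, A.g.inner x (riem cov F x (quad F x v i) w z) (quad F x v i)
        = N * ∑ a, A.g.inner x (riem cov F x (F.e a x) w z) (F.e a x) := by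
    have := trace_quad F hx hv (LinearMap.mk₂ ℝ (fun u y ↦ A.g.inner x (riem cov F x u w z) y)
      (fun u u' y ↦ by
        simp only [riem, inner_add_left, add_mul, add_smul, Finset.sum_add_distrib])
      (fun c u y ↦ by
        simp only [riem, inner_smul_left, mul_assoc, mul_smul, ← Finset.smul_sum, smul_eq_mul])
      (fun u y y' ↦ map_add _ _ _) (fun c u y ↦ map_smul _ _ _))
    exact this
  -- Each trace over the quadruple costs one factor N = g(v, v). The double trace is thus N²·24S,
  -- and its quarter gives the term 6S g(v, v) once a common N is cancelled.
  have t2 : ∑ i, ∑ a, A.g.inner x (riem cov F x (F.e a x) (quad F x v i) (quad F x v i)) (F.e a x)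
      = N * ∑ b, ∑ a, A.g.inner x (riem cov F x (F.e a x) (F.e b x) (F.e b x)) (F.e a x) := by
    have := trace_quad F hx hv (LinearMap.mk₂ ℝ (fun u y ↦
        ∑ a, A.g.inner x (riem cov F x (F.e a x) u y) (F.e a x))
      (fun u u' y ↦ by
        simp only [riem, inner_add_left, add_mul, mul_add, add_smul, Finset.sum_add_distrib])
      (fun c u y ↦ by
        simp only [riem, inner_smul_left, mul_left_comm _ c, mul_assoc c, mul_smul c, ← Finset.smul_sum,
          smul_eq_mul, ← Finset.mul_sum])
      (fun u y y' ↦ by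
        simp only [riem, inner_add_left, mul_add, add_smul, Finset.sum_add_distrib])
      (fun c u y ↦ by
        simp only [riem, inner_smul_left, mul_left_comm _ c, mul_smul c, ← Finset.smul_sum,
          smul_eq_mul, ← Finset.mul_sum]))
    exact this
  have q0 : quad F x v 0 = v := rfl
  have qs (s : Fin 3) : quad F x v s.succ = F.I s x v := rfl
  simp only [t1, q0, qs, ← Finset.mul_sum] at key
  rw [t2] at key
  have hS : A.S cov x = 1 / 24 * ∑ b, ∑ a,
      A.g.inner x (riem cov F x (F.e a x) (F.e b x) (F.e b x)) (F.e a x) := by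
    rw [S, ← hF]
    congr 1
    refine Finset.sum_congr rfl fun b _ ↦ Finset.sum_congr rfl fun a _ ↦ ?_
    rw [curvature_eq_riem hcov F hx (F.smooth_e a) (F.smooth_e b) (F.smooth_e b)
      (fun y hy ↦ F.e_mem y hy a) (fun y hy ↦ F.e_mem y hy b) (fun y hy ↦ F.e_mem y hy b)]
  rw [hS, T0_eq hcov hv hv, ← hF]
  refine mul_left_cancel₀ hN (key.trans ?_)
  ring

end QCStructure

end QuaternionicContact

/-! ### Horizontal gradient and Hessian, and the Bochner formula. -/

namespace QuaternionicContact

namespace QCStructure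

variable {M : Type*} [TopologicalSpace M] [ChartedSpace (EuclideanSpace ℝ (Fin 7)) M]
  [IsManifold (𝓡 7) ∞ M] {A : QCStructure M}

section Sharp

variable (F : A.toQCData.LocalFrame) {x : M} (hx : x ∈ F.dom)

variable (A) in
/-- The horizontal vector field dual to a one-form. -/
def sharp (α : OneForm M) : VField M := fun x ↦
  ∑ a, α x ((A.frameAt x).e a x) • (A.frameAt x).e a x

lemma sharp_mem_H (α : OneForm M) (x : M) : A.sharp α x ∈ A.H x :=
  Submodule.sum_mem _ fun a _ ↦ Submodule.smul_mem _ _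
    ((A.frameAt x).e_mem x (A.mem_frameAt_dom x) a)

lemma inner_sharp (α : OneForm M) {w : TangentSpace (𝓡 7) x} (hw : w ∈ A.H x) :
    A.g.inner x (A.sharp α x) w = α x w := by
  conv_rhs => rw [expand_H (A.frameAt x) (A.mem_frameAt_dom x) hw]
  rw [sharp, inner_sum_left, map_sum]
  exact Finset.sum_congr rfl fun a _ ↦ by
    rw [inner_smul_left, map_smul, smul_eq_mul, A.g.symm x w, mul_comm]

include hx in
-- The frames `frameAt x` are chosen separately for every x, with no continuity. Independence of the
-- frame lets a fixed one be used on its whole domain, which is what smoothness requires.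
lemma sharp_eq (α : OneForm M) : A.sharp α x = ∑ a, α x (F.e a x) • F.e a x := by
  rw [expand_H F hx (sharp_mem_H α x)]
  exact Finset.sum_congr rfl fun a _ ↦ by rw [inner_sharp α (F.e_mem x hx a)]

lemma hgrad_mem_H (f : M → ℝ) (x : M) : A.hgrad f x ∈ A.H x := sharp_mem_H (df f) x

lemma inner_hgrad (f : M → ℝ) {w : TangentSpace (𝓡 7) x} (hw : w ∈ A.H x) :
    A.g.inner x (A.hgrad f x) w = df f x w := inner_sharp (df f) hw

lemma smooth_hgrad {f : M → ℝ} (hf : FunOn f F.dom) : SmoothOn (A.hgrad f) F.dom :=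
  SmoothOn.congr (SmoothOn.sum fun a (_ : a ∈ Finset.univ) ↦
    SmoothOn.smul (hf.df F.isOpen_dom (F.smooth_e a)) (F.smooth_e a))
    (fun _ hy ↦ sharp_eq F hy (df f))

include hx in
/-- A bilinear form is traceless against a skew-symmetric family. -/
lemma sum_skew (β : TangentSpace (𝓡 7) x →ₗ[ℝ] TangentSpace (𝓡 7) x →ₗ[ℝ] ℝ)
    {w : Fin 4 → TangentSpace (𝓡 7) x} (hw : ∀ a, w a ∈ A.H x)
    (h : ∀ a b, A.g.inner x (w a) (F.e b x) = -A.g.inner x (w b) (F.e a x)) :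
    ∑ a, β (w a) (F.e a x) + ∑ a, β (F.e a x) (w a) = 0 := by
  have h1 (a : Fin 4) : β (w a) (F.e a x)
      = ∑ b, A.g.inner x (w a) (F.e b x) * β (F.e b x) (F.e a x) := by
    conv_lhs => rw [expand_H F hx (hw a)]
    simp only [map_sum, map_smul, LinearMap.sum_apply, LinearMap.smul_apply, smul_eq_mul]
  have h2 (a : Fin 4) : β (F.e a x) (w a)
      = ∑ b, A.g.inner x (w a) (F.e b x) * β (F.e a x) (F.e b x) := by
    conv_lhs => rw [expand_H F hx (hw a)]
    simp only [map_sum, map_smul, smul_eq_mul]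
  simp only [h1, h2]
  rw [Finset.sum_comm, ← Finset.sum_add_distrib]
  refine Finset.sum_eq_zero fun a _ ↦ ?_
  rw [← Finset.sum_add_distrib]
  refine Finset.sum_eq_zero fun b _ ↦ ?_
  rw [h b a]
  ring

end Sharp

variable [T2Space M]
  {cov : CovariantDerivative (𝓡 7) (EuclideanSpace ℝ (Fin 7)) (fun x : M ↦ TangentSpace (𝓡 7) x)}
  (hcov : A.IsBiquard cov) (F : A.toQCData.LocalFrame) {x : M} (hx : x ∈ F.dom)

section Divergence

variable (cov) in
/-- The divergence of a vector field. -/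
def divg (σ : VField M) (x : M) : ℝ :=
  LinearMap.trace ℝ (TangentSpace (𝓡 7) x) (cov σ x : TangentSpace (𝓡 7) x →ₗ[ℝ] TangentSpace (𝓡 7) x)

include hx in
lemma divg_eq_fr (σ : VField M) :
    divg cov σ x = ∑ i, A.g.inner x (cov σ x (F.fr i x)) (F.fr i x) := by
  rw [divg, LinearMap.trace_eq_matrix_trace ℝ (frBasis F hx), Matrix.trace]
  refine Finset.sum_congr rfl fun i _ ↦ ?_
  rw [Matrix.diag_apply, LinearMap.toMatrix_apply, frBasis_repr, frBasis_apply]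
  rfl

include hx hcov in
lemma divg_eq {σ : VField M} (hσ : SmoothOn σ F.dom) (hH : ∀ y ∈ F.dom, σ y ∈ A.H y) :
    divg cov σ x = ∑ a, A.g.inner x (cov σ x (F.e a x)) (F.e a x) := by
  rw [divg_eq_fr F hx, Fintype.sum_sum_type]
  have : ∀ s, A.g.inner x (cov σ x (F.fr (Sum.inr s) x)) (F.fr (Sum.inr s) x) = 0 := fun s ↦
    inner_H_V F hx (cov_mem_H hcov F hx hσ hH _) (ξ_mem_V F hx s)
  simp only [this, Finset.sum_const_zero, add_zero]
  rfl

end Divergence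

section Function

variable {f : M → ℝ} (hf : FunOn f F.dom)

include hcov hx hf

lemma cov_hgrad_mem (u : TangentSpace (𝓡 7) x) : cov (A.hgrad f) x u ∈ A.H x :=
  cov_mem_H hcov F hx (smooth_hgrad F hf) (fun y _ ↦ hgrad_mem_H f y) u

/-- Differentiate g(∇f, Z) = df(Z) with the metric connection. From here on the Hessian is handled
through the tensor ∇(∇f). -/
lemma hess_eq (Y : VField M) {Z : VField M} (hZ : SmoothOn Z F.dom)
    (hH : ∀ y ∈ F.dom, Z y ∈ A.H y) :
    hess cov f Y Z x = A.g.inner x (cov (A.hgrad f) x (Y x)) (Z x) := by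
  have h1 := metric hcov F hx (smooth_hgrad F hf) hZ (Y x)
  rw [df_congr_on F.isOpen_dom hx (fun y hy ↦ inner_hgrad f (hH y hy)),
    inner_hgrad f (cov_mem_H hcov F hx hZ hH _)] at h1
  rw [hess, h1]
  exact add_sub_cancel_right _ _

/-- The skew part of the horizontal Hessian is the torsion term T(u, w) = 2 Σ g(I_s u, w) ξ_s
applied to f. -/
lemma cov_hgrad_antisymm {u w : TangentSpace (𝓡 7) x} (hu : u ∈ A.H x) (hw : w ∈ A.H x) :
    A.g.inner x (cov (A.hgrad f) x u) w - A.g.inner x (cov (A.hgrad f) x w) u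
      = -2 * ∑ s, A.g.inner x (F.I s x u) w * df f x (F.ξ s x) := by
  have h := hess_sub_hess (cov := cov) F.isOpen_dom (F.smooth_e 0) (fun y hy ↦ e_ne_zero F hy 0) hf
    (smooth_constExt F u) (smooth_constExt F w) hx
  rw [hess_eq hcov F hx hf _ (smooth_constExt F w) (constExt_mem F w),
    hess_eq hcov F hx hf _ (smooth_constExt F u) (constExt_mem F u), constExt_self F hx hu,
    constExt_self F hx hw, torsion_H hcov F hx hu hw, map_sum] at h
  rw [h, Finset.mul_sum, ← Finset.sum_neg_distrib]
  refine Finset.sum_congr rfl fun s _ ↦ ?_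
  rw [map_smul, smul_eq_mul]
  ring

/-- The mixed second derivatives of a function, in a vertical and a horizontal direction. -/
lemma df_df_ξ (s : Fin 3) {v : TangentSpace (𝓡 7) x} (hv : v ∈ A.H x) :
    df (fun y ↦ df f y (F.ξ s y)) x v - ∑ t, conn cov F s t x v * df f x (F.ξ t x)
      = A.g.inner x (cov (A.hgrad f) x (F.ξ s x)) v
        + A.g.inner x (cov.torsion x (F.ξ s x) v) (A.hgrad f x) := by
  have h := hess_sub_hess (cov := cov) F.isOpen_dom (F.smooth_e 0) (fun y hy ↦ e_ne_zero F hy 0) hf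
    (smooth_constExt F v) (F.smooth_ξ s) hx
  rw [hess_eq hcov F hx hf _ (smooth_constExt F v) (constExt_mem F v), constExt_self F hx hv,
    torsion_swap hcov F hx, map_neg, neg_neg,
    ← inner_hgrad f (torsion_ξ_mem hcov F hx s hv), A.g.symm x (A.hgrad f x)] at h
  rw [← h, hess, nabla, constExt_self F hx hv, cov_ξ hcov F hx, map_sum]
  simp only [map_smul, smul_eq_mul]
  ring

/-- Pairing with I_s sees only the skew part of the Hessian. The four frame vectors contribute −2
df(ξ_s) each to the difference of two traces that are opposite to one another, whence −4. -/
lemma sum_cov_hgrad_I (s : Fin 3) :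
    ∑ a, A.g.inner x (cov (A.hgrad f) x (F.e a x)) (F.I s x (F.e a x))
      = -4 * df f x (F.ξ s x) := by
  have he := F.e_mem x hx
  have h := sum_skew F hx (LinearMap.mk₂ ℝ (fun u w ↦ A.g.inner x (cov (A.hgrad f) x u) w)
    (by simp) (by simp) (by simp) (by simp)) (w := fun a ↦ F.I s x (F.e a x))
    (fun a ↦ F.I_mem x hx s _ (he a)) (fun a b ↦ by
      rw [I_skew F hx s (he a) (he b), A.g.symm])
  simp only [LinearMap.mk₂_apply] at h
  rw [← Finset.sum_add_distrib] at h
  have h2 (a : Fin 4) := cov_hgrad_antisymm hcov F hx hf (he a) (F.I_mem x hx s _ (he a))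
  simp only [I_inner_I F hx _ _ (he _), F.e_orthonormal x hx, if_true, ite_mul, one_mul, zero_mul,
    Finset.sum_ite_eq', Finset.mem_univ] at h2
  have h3 : ∑ a, (A.g.inner x (cov (A.hgrad f) x (F.e a x)) (F.I s x (F.e a x))
      - A.g.inner x (cov (A.hgrad f) x (F.I s x (F.e a x))) (F.e a x))
      = ∑ a : Fin 4, -2 * df f x (F.ξ s x) := Finset.sum_congr rfl fun a _ ↦ h2 a
  rw [Finset.sum_sub_distrib] at h3
  rw [Finset.sum_add_distrib] at h
  simp only [Finset.sum_const, Finset.card_univ, Fintype.card_fin, nsmul_eq_mul] at h3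
  push_cast at h3
  linarith

/-- The norm of the horizontal Hessian is bounded below by its trace and its skew part. -/
lemma bessel : 1 / 4 * divg cov (A.hgrad f) x ^ 2 + 4 * ∑ s, df f x (F.ξ s x) ^ 2
    ≤ ∑ a, A.g.inner x (cov (A.hgrad f) x (F.e a x)) (cov (A.hgrad f) x (F.e a x)) := by
  set D := cov (A.hgrad f) x with hD
  set L := divg cov (A.hgrad f) x with hL
  have hL' := divg_eq hcov F hx (smooth_hgrad F hf) (fun y _ ↦ hgrad_mem_H f y)
  have he := F.e_mem x hx
  -- The residual of the orthogonal projection of D to the span of the identity and I_1, I_2, I_3.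
  -- These have norm squared 4, and the pairings of D with them are L and −4 df(ξ_s), so the
  -- coefficients are L/4 and −df(ξ_s).
  have h0 : 0 ≤ ∑ a, A.g.inner x
      (D (F.e a x) - (L / 4) • F.e a x + ∑ s, df f x (F.ξ s x) • F.I s x (F.e a x))
      (D (F.e a x) - (L / 4) • F.e a x + ∑ s, df f x (F.ξ s x) • F.I s x (F.e a x)) :=
    Finset.sum_nonneg fun a _ ↦ inner_self_nonneg _
  have h1 (a : Fin 4) : A.g.inner x
      (D (F.e a x) - (L / 4) • F.e a x + ∑ s, df f x (F.ξ s x) • F.I s x (F.e a x))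
      (D (F.e a x) - (L / 4) • F.e a x + ∑ s, df f x (F.ξ s x) • F.I s x (F.e a x))
      = A.g.inner x (D (F.e a x)) (D (F.e a x)) + L ^ 2 / 16 + ∑ s, df f x (F.ξ s x) ^ 2
        - L / 2 * A.g.inner x (D (F.e a x)) (F.e a x)
        + 2 * ∑ s, df f x (F.ξ s x) * A.g.inner x (D (F.e a x)) (F.I s x (F.e a x)) := by
    have i1 (s t) := I_inner_I F hx s t (he a)
    have i2 (s) := inner_I_self F hx s (he a)
    have i3 (s) : A.g.inner x (F.I s x (F.e a x)) (F.e a x) = 0 := by rw [A.g.symm]; exact i2 s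
    simp only [Fin.sum_univ_three, map_add, map_sub, map_smul, add_apply, sub_apply,
      smul_apply, smul_eq_mul, i1, i2, i3, F.e_orthonormal x hx,
      A.g.symm x (F.e a x) (D (F.e a x)), A.g.symm x (F.I _ x (F.e a x)) (D (F.e a x))]
    simp
    ring
  simp only [h1, Finset.sum_add_distrib, Finset.sum_sub_distrib, ← Finset.mul_sum] at h0
  rw [← hL'] at h0
  have h2 : ∑ a, ∑ s, df f x (F.ξ s x) * A.g.inner x (D (F.e a x)) (F.I s x (F.e a x))
      = -4 * ∑ s, df f x (F.ξ s x) ^ 2 := by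
    rw [Finset.sum_comm, Finset.mul_sum]
    refine Finset.sum_congr rfl fun s _ ↦ ?_
    rw [← Finset.mul_sum, sum_cov_hgrad_I hcov F hx hf]
    ring
  rw [h2] at h0
  simp only [Finset.sum_const, Finset.card_univ, Fintype.card_fin, nsmul_eq_mul] at h0
  push_cast at h0
  nlinarith [h0]

/-- The skew-symmetry of the connection matrix of the horizontal frame. -/
lemma sum_cov_e (β : TangentSpace (𝓡 7) x →ₗ[ℝ] TangentSpace (𝓡 7) x →ₗ[ℝ] ℝ)
    (u : TangentSpace (𝓡 7) x) :
    ∑ a, β (cov (F.e a) x u) (F.e a x) + ∑ a, β (F.e a x) (cov (F.e a) x u) = 0 :=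
  sum_skew F hx β (fun a ↦ cov_mem_H hcov F hx (F.smooth_e a) (fun y hy ↦ F.e_mem y hy a) u)
    (fun a b ↦ fr_skew hcov F hx (Sum.inl a) (Sum.inl b) u)

/-- The Bochner formula: exchanging ∇_{e_a} and ∇_G in the trace of ∇(∇_G G) produces the Ricci
form, the derivative of div G along G, the trace of D², and the term D(T(e_a, G)), which brings in
the derivatives of G along ξ_s. -/
lemma divg_nabla_hgrad :
    divg cov (nabla cov (A.hgrad f) (A.hgrad f)) x
      = ∑ a, A.g.inner x (cov (A.hgrad f) x (F.e a x)) (cov (A.hgrad f) x (F.e a x))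
        - 8 * ∑ s, df f x (F.ξ s x) ^ 2
        + ∑ a, A.g.inner x (riem cov F x (F.e a x) (A.hgrad f x) (A.hgrad f x)) (F.e a x)
        + df (divg cov (A.hgrad f)) x (A.hgrad f x)
        + 2 * ∑ s, A.g.inner x (cov (A.hgrad f) x (F.ξ s x)) (F.I s x (A.hgrad f x)) := by
  have hc := hcov.smooth
  have hU := F.isOpen_dom
  have hG := smooth_hgrad F hf
  have hGH : ∀ y ∈ F.dom, A.hgrad f y ∈ A.H y := fun y _ ↦ hgrad_mem_H f y
  have hs := F.smooth_e
  have heH (a : Fin 4) : ∀ y ∈ F.dom, F.e a y ∈ A.H y := fun y hy ↦ F.e_mem y hy a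
  set G := A.hgrad f with hGdef
  have hn (a : Fin 4) : SmoothOn (nabla cov (F.e a) G) F.dom := SmoothOn.nabla hc hU (hs a) hG
  have h1 (a : Fin 4) : A.g.inner x (cov (nabla cov G G) x (F.e a x)) (F.e a x)
      = A.g.inner x (riem cov F x (F.e a x) (G x) (G x)) (F.e a x)
        + (df (fun y ↦ A.g.inner y (cov G y (F.e a y)) (F.e a y)) x (G x)
          - A.g.inner x (cov G x (F.e a x)) (cov (F.e a) x (G x)))
        + (A.g.inner x (cov G x (cov G x (F.e a x))) (F.e a x)
          - A.g.inner x (cov G x (cov (F.e a) x (G x))) (F.e a x)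
          - A.g.inner x (cov G x (cov.torsion x (F.e a x) (G x))) (F.e a x)) := by
    have e1 := curvature_eq_riem hcov F hx (hs a) hG hG (heH a) hGH hGH
    have e2 : df (fun y ↦ A.g.inner y (cov G y (F.e a y)) (F.e a y)) x (G x)
        = A.g.inner x (cov (nabla cov (F.e a) G) x (G x)) (F.e a x)
          + A.g.inner x (cov G x (F.e a x)) (cov (F.e a) x (G x)) :=
      metric hcov F hx (hn a) (hs a) (G x)
    have e3 := torsion_eq (cov := cov) ((hs a).diffAt hU hx) (hG.diffAt hU hx)
    rw [← e1, e2, e3]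
    simp only [curvature, Pi.sub_apply, nabla, map_sub, sub_apply]
    ring
  have h2 := sum_cov_e hcov F hx hf (LinearMap.mk₂ ℝ (fun u w ↦ A.g.inner x (cov G x u) w)
    (by simp) (by simp) (by simp) (by simp)) (G x)
  simp only [LinearMap.mk₂_apply] at h2
  -- The trace of D² differs from |D|² by twice the pairing of D with Σ df(ξ_s) I_s. With `h4` this
  -- is −8 Σ df(ξ_s)².
  have h3 (a : Fin 4) : A.g.inner x (cov G x (cov G x (F.e a x))) (F.e a x)
      = A.g.inner x (cov G x (F.e a x)) (cov G x (F.e a x))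
        + 2 * ∑ s, df f x (F.ξ s x) * A.g.inner x (cov G x (F.e a x)) (F.I s x (F.e a x)) := by
    have hm := cov_hgrad_mem hcov F hx hf (F.e a x)
    have := cov_hgrad_antisymm hcov F hx hf hm (F.e_mem x hx a)
    rw [← hGdef] at this hm
    simp only [I_skew F hx _ hm (F.e_mem x hx a)] at this
    rw [eq_add_of_sub_eq this, add_comm, Finset.mul_sum, Finset.mul_sum]
    congr 1
    exact Finset.sum_congr rfl fun s _ ↦ by ring
  have h4 : ∑ a, ∑ s, df f x (F.ξ s x) * A.g.inner x (cov G x (F.e a x)) (F.I s x (F.e a x))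
      = -4 * ∑ s, df f x (F.ξ s x) ^ 2 := by
    rw [Finset.sum_comm, Finset.mul_sum]
    refine Finset.sum_congr rfl fun s _ ↦ ?_
    rw [← Finset.mul_sum, sum_cov_hgrad_I hcov F hx hf]
    ring
  have h5 (a : Fin 4) : A.g.inner x (cov G x (cov.torsion x (F.e a x) (G x))) (F.e a x)
      = -2 * ∑ s, A.g.inner x (F.I s x (G x)) (F.e a x) * A.g.inner x (cov G x (F.ξ s x)) (F.e a x) := by
    rw [torsion_H hcov F hx (F.e_mem x hx a) (hGH x hx), map_sum, inner_sum_left, Finset.mul_sum]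
    refine Finset.sum_congr rfl fun s _ ↦ ?_
    rw [map_smul, inner_smul_left, I_skew F hx s (F.e_mem x hx a) (hGH x hx), A.g.symm x (F.e a x)]
    ring
  have h6 : ∑ a, ∑ s, A.g.inner x (F.I s x (G x)) (F.e a x) * A.g.inner x (cov G x (F.ξ s x)) (F.e a x)
      = ∑ s, A.g.inner x (cov G x (F.ξ s x)) (F.I s x (G x)) := by
    rw [Finset.sum_comm]
    refine Finset.sum_congr rfl fun s _ ↦ ?_
    rw [A.g.symm x (cov G x (F.ξ s x)), inner_H F hx (F.I_mem x hx s _ (hGH x hx))]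
  have h7 : df (divg cov G) x (G x)
      = ∑ a, df (fun y ↦ A.g.inner y (cov G y (F.e a y)) (F.e a y)) x (G x) := by
    rw [df_congr_on hU hx (fun y hy ↦ divg_eq hcov F hy hG hGH), df_sum]
    exact fun a _ ↦ (FunOn.inner A.g (hn a) (hs a)).mdiffAt hU hx
  rw [divg_eq hcov F hx (SmoothOn.nabla hc hU hG hG) (fun y hy ↦ cov_mem_H hcov F hy hG hGH _), h7]
  simp only [h1, h3, h5, Finset.sum_add_distrib, Finset.sum_sub_distrib, ← Finset.mul_sum, h4, h6]
  linarith

end Function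

end QCStructure

end QuaternionicContact

/-! ### The P-function, the flux field, and the pointwise inequality. -/

namespace QuaternionicContact

namespace QCStructure

variable {M : Type*} [TopologicalSpace M] [ChartedSpace (EuclideanSpace ℝ (Fin 7)) M]
  [IsManifold (𝓡 7) ∞ M] {A : QCStructure M} [T2Space M]
  {cov : CovariantDerivative (𝓡 7) (EuclideanSpace ℝ (Fin 7)) (fun x : M ↦ TangentSpace (𝓡 7) x)}
  (hcov : A.IsBiquard cov) (F : A.toQCData.LocalFrame) {x : M} (hx : x ∈ F.dom)

section Divergence

lemma divg_add {σ τ : VField M} (hσ : DiffAt σ x) (hτ : DiffAt τ x) :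
    divg cov (fun y ↦ σ y + τ y) x = divg cov σ x + divg cov τ x := by
  have : (cov (fun y ↦ σ y + τ y) x : TangentSpace (𝓡 7) x →ₗ[ℝ] TangentSpace (𝓡 7) x)
      = cov σ x + cov τ x := LinearMap.ext fun w ↦ cov_add hσ hτ w
  rw [divg, this]
  exact map_add _ _ _

include hx in
lemma divg_smul {u : M → ℝ} {σ : VField M} (hu : MDifferentiableAt (𝓡 7) 𝓘(ℝ) u x)
    (hσ : DiffAt σ x) :
    divg cov (fun y ↦ u y • σ y) x = u x * divg cov σ x + df u x (σ x) := by
  simp only [divg_eq_fr F hx, cov_smul hu hσ, inner_add_left, inner_smul_left,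
    Finset.sum_add_distrib, Finset.mul_sum]
  congr 1
  conv_rhs => rw [fr_expand F hx (σ x), map_sum]
  exact Finset.sum_congr rfl fun i _ ↦ by rw [map_smul, smul_eq_mul, mul_comm]

end Divergence

variable (A cov) in
/-- The horizontal vector field `∑ₛ df(ξₛ) Iₛ ∇f`. -/
def reebGrad (f : M → ℝ) : VField M :=
  A.sharp fun y ↦ (1 / 2 : ℝ) • (df f y).comp (cov.torsion y (A.hgrad f y))

lemma reebGrad_mem_H (f : M → ℝ) (x : M) : reebGrad A cov f x ∈ A.H x := sharp_mem_H _ x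

section Function

variable {f : M → ℝ}

include hx hcov in
-- For horizontal w one has T(∇f, w) = 2 Σ g(I_s ∇f, w) ξ_s, which explains the factor 1/2 in
-- `reebGrad`. Defining the field through the torsion avoids the choice of Reeb fields and makes it
-- global.
lemma reebGrad_eq : reebGrad A cov f x = ∑ s, df f x (F.ξ s x) • F.I s x (A.hgrad f x) := by
  have hG := hgrad_mem_H (A := A) f x
  refine ext_H F hx (sharp_mem_H _ x)
    (Submodule.sum_mem _ fun s _ ↦ Submodule.smul_mem _ _ (F.I_mem x hx s _ hG)) fun a ↦ ?_
  have he := F.e_mem x hx a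
  rw [reebGrad, inner_sharp _ he, smul_apply, ContinuousLinearMap.comp_apply,
    torsion_H hcov F hx hG he, map_sum, inner_sum_left, Finset.smul_sum]
  refine Finset.sum_congr rfl fun s _ ↦ ?_
  rw [map_smul, smul_eq_mul, smul_eq_mul, inner_smul_left]
  ring

variable (hf : FunOn f F.dom)

include hcov hf

lemma smooth_reebGrad : SmoothOn (reebGrad A cov f) F.dom :=
  SmoothOn.congr (SmoothOn.sum fun s (_ : s ∈ Finset.univ) ↦
    SmoothOn.smul (hf.df F.isOpen_dom (F.smooth_ξ s)) (smooth_I F s (smooth_hgrad F hf)))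
    (fun _ hy ↦ reebGrad_eq hcov F hy)

include hx

/-- In the divergence of df(ξ_s) I_s ∇f, the derivative of I_s gives connection forms, the
derivative of ∇f pairs with I_s and gives 4 df(ξ_s)², and the derivative of df(ξ_s) along I_s ∇f is
rewritten by `df_df_ξ`. -/
lemma divg_reebGrad :
    divg cov (reebGrad A cov f) x
      = ∑ s, A.g.inner x (cov (A.hgrad f) x (F.ξ s x)) (F.I s x (A.hgrad f x))
        + ∑ s, A.g.inner x (cov.torsion x (F.ξ s x) (F.I s x (A.hgrad f x))) (A.hgrad f x)
        + 4 * ∑ s, df f x (F.ξ s x) ^ 2 := by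
  have hU := F.isOpen_dom
  have hG := smooth_hgrad F hf
  have hGH := hgrad_mem_H (A := A) f
  have hIG (s) := F.I_mem x hx s _ (hGH x)
  have hφ (s) := hf.df hU (F.smooth_ξ s)
  have hI (s) := smooth_I F s hG
  have h1 (u : TangentSpace (𝓡 7) x) : cov (reebGrad A cov f) x u
      = ∑ s, (df f x (F.ξ s x) • (F.I s x (cov (A.hgrad f) x u)
          + ∑ t, conn cov F s t x u • F.I t x (A.hgrad f x))
        + df (fun y ↦ df f y (F.ξ s y)) x u • F.I s x (A.hgrad f x)) := by
    have hs (s) := SmoothOn.smul (hφ s) (hI s)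
    rw [cov_congr hU hx ((smooth_reebGrad hcov F hf).diffAt hU hx)
      ((SmoothOn.sum fun s (_ : s ∈ Finset.univ) ↦ hs s).diffAt hU hx)
      (fun y hy ↦ reebGrad_eq hcov F hy), cov_sum fun s _ ↦ (hs s).diffAt hU hx]
    refine Finset.sum_congr rfl fun s _ ↦ ?_
    rw [cov_smul ((hφ s).mdiffAt hU hx) ((hI s).diffAt hU hx), cov_I hcov F hx s hG]
  have h2 (L : TangentSpace (𝓡 7) x →L[ℝ] ℝ) {v : TangentSpace (𝓡 7) x} (hv : v ∈ A.H x) :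
      ∑ a, L (F.e a x) * A.g.inner x v (F.e a x) = L v := by
    conv_rhs => rw [expand_H F hx hv, map_sum]
    exact Finset.sum_congr rfl fun a _ ↦ by rw [map_smul, smul_eq_mul, mul_comm]
  have h2' (s t : Fin 3) {v : TangentSpace (𝓡 7) x} (hv : v ∈ A.H x) :
      ∑ a, conn cov F s t x (F.e a x) * A.g.inner x v (F.e a x) = conn cov F s t x v := by
    simp only [conn, A.g.symm x (cov (F.ξ s) x _)]
    exact h2 ((A.g.inner x (F.ξ t x)).comp (cov (F.ξ s) x)) hv
  have h3 (a : Fin 4) : A.g.inner x (cov (reebGrad A cov f) x (F.e a x)) (F.e a x)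
      = ∑ s, (-(df f x (F.ξ s x) * A.g.inner x (cov (A.hgrad f) x (F.e a x)) (F.I s x (F.e a x)))
        + (∑ t, df f x (F.ξ s x) * (conn cov F s t x (F.e a x)
            * A.g.inner x (F.I t x (A.hgrad f x)) (F.e a x))
          + df (fun y ↦ df f y (F.ξ s y)) x (F.e a x)
            * A.g.inner x (F.I s x (A.hgrad f x)) (F.e a x))) := by
    rw [h1, inner_sum_left]
    refine Finset.sum_congr rfl fun s _ ↦ ?_
    rw [inner_add_left, inner_smul_left, inner_smul_left, inner_add_left, inner_sum_left,
      I_skew F hx s (cov_hgrad_mem hcov F hx hf _) (F.e_mem x hx a), mul_add, Finset.mul_sum]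
    simp only [inner_smul_left]
    ring
  rw [divg_eq hcov F hx (smooth_reebGrad hcov F hf) (fun y _ ↦ reebGrad_mem_H f y)]
  simp only [h3]
  rw [Finset.sum_comm]
  have h4 (s : Fin 3) := df_df_ξ hcov F hx hf s (hIG s)
  have h5 (s : Fin 3) : ∑ a, (-(df f x (F.ξ s x)
        * A.g.inner x (cov (A.hgrad f) x (F.e a x)) (F.I s x (F.e a x)))
        + (∑ t, df f x (F.ξ s x) * (conn cov F s t x (F.e a x)
            * A.g.inner x (F.I t x (A.hgrad f x)) (F.e a x))
          + df (fun y ↦ df f y (F.ξ s y)) x (F.e a x)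
            * A.g.inner x (F.I s x (A.hgrad f x)) (F.e a x)))
      = 4 * df f x (F.ξ s x) ^ 2
        + (∑ t, df f x (F.ξ s x) * conn cov F s t x (F.I t x (A.hgrad f x))
          + df (fun y ↦ df f y (F.ξ s y)) x (F.I s x (A.hgrad f x))) := by
    rw [Finset.sum_add_distrib, Finset.sum_add_distrib, Finset.sum_neg_distrib, ← Finset.mul_sum,
      sum_cov_hgrad_I hcov F hx hf, h2 _ (hIG s), Finset.sum_comm]
    simp only [← Finset.mul_sum, h2' s _ (hIG _)]
    ring
  simp only [h5, Finset.sum_add_distrib]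
  -- The connection forms from ∇I_s cancel, by skewness, those that `df_df_ξ` brings in.
  have h6 : ∑ s, ∑ t, df f x (F.ξ s x) * conn cov F s t x (F.I t x (A.hgrad f x))
      = - ∑ s, ∑ t, conn cov F s t x (F.I s x (A.hgrad f x)) * df f x (F.ξ t x) := by
    rw [Finset.sum_comm, ← Finset.sum_neg_distrib]
    refine Finset.sum_congr rfl fun s _ ↦ ?_
    rw [← Finset.sum_neg_distrib]
    refine Finset.sum_congr rfl fun t _ ↦ ?_
    rw [conn_skew hcov F hx t s]
    ring
  have h7 : ∑ s, df (fun y ↦ df f y (F.ξ s y)) x (F.I s x (A.hgrad f x))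
      = ∑ s, A.g.inner x (cov (A.hgrad f) x (F.ξ s x)) (F.I s x (A.hgrad f x))
        + ∑ s, A.g.inner x (cov.torsion x (F.ξ s x) (F.I s x (A.hgrad f x))) (A.hgrad f x)
        + ∑ s, ∑ t, conn cov F s t x (F.I s x (A.hgrad f x)) * df f x (F.ξ t x) := by
    rw [← Finset.sum_add_distrib, ← Finset.sum_add_distrib]
    exact Finset.sum_congr rfl fun s _ ↦ by rw [← h4 s]; ring
  rw [h6, h7, ← Finset.mul_sum]
  ring

/-- The trace part of the third derivatives. -/
lemma sum_third_trace {X : VField M} (hX : SmoothOn X F.dom) :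
    ∑ b, third cov f X (F.e b) (F.e b) x = df (divg cov (A.hgrad f)) x (X x) := by
  have hc := hcov.smooth
  have hU := F.isOpen_dom
  have hG := smooth_hgrad F hf
  have hs := F.smooth_e
  have heH (a : Fin 4) : ∀ y ∈ F.dom, F.e a y ∈ A.H y := fun y hy ↦ F.e_mem y hy a
  have h1 : df (divg cov (A.hgrad f)) x (X x) = ∑ b, df (hess cov f (F.e b) (F.e b)) x (X x) := by
    rw [df_congr_on hU hx (v := fun y ↦ ∑ b, hess cov f (F.e b) (F.e b) y) (fun y hy ↦ by
      rw [divg_eq hcov F hy hG (fun y _ ↦ hgrad_mem_H f y)]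
      exact Finset.sum_congr rfl fun b _ ↦ (hess_eq hcov F hy hf _ (hs b) (heH b)).symm), df_sum]
    exact fun b _ ↦ (FunOn.hess hc hU hf (hs b) (hs b)).mdiffAt hU hx
  have h2 := sum_cov_e hcov F hx hf (LinearMap.mk₂ ℝ
    (fun u w ↦ A.g.inner x (cov (A.hgrad f) x u) w)
    (by simp) (by simp) (by simp) (by simp)) (X x)
  simp only [LinearMap.mk₂_apply] at h2
  have h3 (b : Fin 4) : third cov f X (F.e b) (F.e b) x = df (hess cov f (F.e b) (F.e b)) x (X x)
      - A.g.inner x (cov (A.hgrad f) x (cov (F.e b) x (X x))) (F.e b x)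
      - A.g.inner x (cov (A.hgrad f) x (F.e b x)) (cov (F.e b) x (X x)) := by
    rw [third, hess_eq hcov F hx hf _ (hs b) (heH b),
      hess_eq hcov F hx hf _ (SmoothOn.nabla hc hU hX (hs b))
        (fun y hy ↦ cov_mem_H hcov F hy (hs b) (heH b) _)]
    rfl
  simp only [h3, Finset.sum_sub_distrib]
  rw [h1]
  linarith

/-- The part of the third derivatives which comes from an almost complex structure. -/
lemma sum_third_I (t : Fin 3) {X : VField M} (hX : SmoothOn X F.dom)
    (hXH : ∀ y ∈ F.dom, X y ∈ A.H y) :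
    ∑ b, third cov f X (F.e b) (fun y ↦ F.I t y (F.e b y)) x
      = -4 * (A.g.inner x (cov (A.hgrad f) x (F.ξ t x)) (X x)
        + A.g.inner x (cov.torsion x (F.ξ t x) (X x)) (A.hgrad f x)) := by
  have hc := hcov.smooth
  have hU := F.isOpen_dom
  have hs := F.smooth_e
  have heH (a : Fin 4) : ∀ y ∈ F.dom, F.e a y ∈ A.H y := fun y hy ↦ F.e_mem y hy a
  have hI (b : Fin 4) := smooth_I F t (hs b)
  have hIH (b : Fin 4) : ∀ y ∈ F.dom, F.I t y (F.e b y) ∈ A.H y :=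
    fun y hy ↦ F.I_mem y hy t _ (heH b y hy)
  -- The trace of the Hessian against I_t is −4 df(ξ_t) at every point of the frame domain, so it
  -- can be differentiated along X. Frame derivatives drop out by skewness, and the derivative of
  -- I_t supplies the connection forms that turn X(df(ξ_t)) into a Hessian.
  have h1 : ∑ b, df (hess cov f (F.e b) (fun y ↦ F.I t y (F.e b y))) x (X x)
      = -4 * df (fun y ↦ df f y (F.ξ t y)) x (X x) := by
    rw [← df_sum fun b _ ↦ (FunOn.hess hc hU hf (hs b) (hI b)).mdiffAt hU hx,
      df_congr_on hU hx (v := fun y ↦ -4 * df f y (F.ξ t y)) (fun y hy ↦ by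
        rw [← sum_cov_hgrad_I hcov F hy hf]
        exact Finset.sum_congr rfl fun b _ ↦ hess_eq hcov F hy hf _ (hI b) (hIH b)),
      df_const_mul _ ((hf.df hU (F.smooth_ξ t)).mdiffAt hU hx)]
  have h2 := sum_cov_e hcov F hx hf (LinearMap.mk₂ ℝ
    (fun u w ↦ A.g.inner x (cov (A.hgrad f) x u) (F.I t x w))
    (by simp) (by simp) (by simp) (by simp)) (X x)
  simp only [LinearMap.mk₂_apply] at h2
  have h3 (b : Fin 4) : third cov f X (F.e b) (fun y ↦ F.I t y (F.e b y)) x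
      = df (hess cov f (F.e b) (fun y ↦ F.I t y (F.e b y))) x (X x)
      - A.g.inner x (cov (A.hgrad f) x (cov (F.e b) x (X x))) (F.I t x (F.e b x))
      - (A.g.inner x (cov (A.hgrad f) x (F.e b x)) (F.I t x (cov (F.e b) x (X x)))
        + ∑ s, conn cov F t s x (X x)
          * A.g.inner x (cov (A.hgrad f) x (F.e b x)) (F.I s x (F.e b x))) := by
    rw [third, hess_eq hcov F hx hf _ (hI b) (hIH b),
      hess_eq hcov F hx hf _ (SmoothOn.nabla hc hU hX (hI b))
        (fun y hy ↦ cov_mem_H hcov F hy (hI b) (hIH b) _)]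
    congr 1
    rw [nabla, cov_I hcov F hx t (hs b), map_add, map_sum]
    simp only [map_smul, smul_eq_mul]
  have h4 : ∑ b, ∑ s, conn cov F t s x (X x)
        * A.g.inner x (cov (A.hgrad f) x (F.e b x)) (F.I s x (F.e b x))
      = -4 * ∑ s, conn cov F t s x (X x) * df f x (F.ξ s x) := by
    rw [Finset.sum_comm, Finset.mul_sum]
    refine Finset.sum_congr rfl fun s _ ↦ ?_
    rw [← Finset.mul_sum, sum_cov_hgrad_I hcov F hx hf]
    ring
  simp only [h3, Finset.sum_sub_distrib, Finset.sum_add_distrib]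
  rw [h1, h4, ← df_df_ξ hcov F hx hf t (hXH x hx)]
  linarith

end Function

section Eigenfunction

variable {f : M → ℝ} (hf : ContMDiff (𝓡 7) 𝓘(ℝ) ∞ f)

include hcov hf

lemma subLaplacian_eq (x : M) : A.subLaplacian cov f x = -divg cov (A.hgrad f) x := by
  have hx := A.mem_frameAt_dom x
  set F := A.frameAt x with hF
  have hf' : FunOn f F.dom := hf.contMDiffOn
  rw [subLaplacian, divg_eq hcov F hx (smooth_hgrad F hf') (fun y _ ↦ hgrad_mem_H f y), ← hF]
  congr 1
  exact Finset.sum_congr rfl fun a _ ↦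
    hess_eq hcov F hx hf' _ (F.smooth_e a) (fun y hy ↦ F.e_mem y hy a)

/-- Taking X = I_t ∇f in `sum_third_I` and summing over t yields −4T⁰(∇f, ∇f) besides the mixed
derivatives; the summand +4T⁰ in the P-form removes it exactly. -/
lemma pFunction_eq (x : M) : A.PFunction cov f x = df (divg cov (A.hgrad f)) x (A.hgrad f x)
    - 4 * ∑ s, A.g.inner x (cov (A.hgrad f) x ((A.frameAt x).ξ s x))
      ((A.frameAt x).I s x (A.hgrad f x))
    - 4 * A.S cov x * A.g.inner x (A.hgrad f x) (A.hgrad f x) := by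
  have hx := A.mem_frameAt_dom x
  have hGH := hgrad_mem_H (A := A) f
  rw [PFunction, PForm, T0_eq hcov (hGH x) (hGH x)]
  set F := A.frameAt x with hF
  have hf' : FunOn f F.dom := hf.contMDiffOn
  have hG := smooth_hgrad F hf'
  rw [sum_third_trace hcov F hx hf' hG]
  have h (t : Fin 3) := sum_third_I hcov F hx hf' t (smooth_I F t hG)
    (fun y hy ↦ F.I_mem y hy t _ (hGH y))
  simp only [h, ← Finset.mul_sum, Finset.sum_add_distrib, ← inner_hgrad (A := A) f (hGH x)]
  ring

variable (A cov) in
omit hcov hf in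
/-- The vector field whose divergence enters the integral formula. -/
def flux (lam : ℝ) (f : M → ℝ) : VField M := fun y ↦
  nabla cov (A.hgrad f) (A.hgrad f) y + reebGrad A cov f y + (lam / 4 * f y) • A.hgrad f y

lemma flux_smoothOn (lam : ℝ) {F : A.toQCData.LocalFrame} : SmoothOn (flux A cov lam f) F.dom := by
  have hf' : FunOn f F.dom := hf.contMDiffOn
  have hG := smooth_hgrad F hf'
  exact ((SmoothOn.nabla hcov.smooth F.isOpen_dom hG hG).add (smooth_reebGrad hcov F hf')).add
    (SmoothOn.smul ((FunOn.const _).mul hf') hG)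

lemma flux_mem_H (lam : ℝ) (x : M) : flux A cov lam f x ∈ A.H x :=
  Submodule.add_mem _ (Submodule.add_mem _
    (cov_hgrad_mem hcov (A.frameAt x) (A.mem_frameAt_dom x) hf.contMDiffOn _)
    (reebGrad_mem_H f x)) (Submodule.smul_mem _ _ (hgrad_mem_H f x))

/-- The pointwise inequality behind the eigenvalue estimate. -/
lemma pointwise_inequality {lam k₀ : ℝ} (heig : ∀ y, A.subLaplacian cov f y = lam * f y)
    (hLich : ∀ X ∈ A.H x, k₀ * A.g.inner x X X
      ≤ 6 * A.S cov x * A.g.inner x X X + 10 * A.T0 cov x X X) :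
    1 / 2 * (k₀ - 3 * lam) * A.g.inner x (A.hgrad f x) (A.hgrad f x)
      ≤ 3 / 4 * A.PFunction cov f x + divg cov (flux A cov lam f) x := by
  have hx := A.mem_frameAt_dom x
  have hGH := hgrad_mem_H (A := A) f
  have hL := hLich _ (hGH x)
  rw [pFunction_eq hcov hf]
  have hR := ricci_eq hcov (hGH x)
  have hT := T0_eq hcov (hGH x) (hGH x)
  set F := A.frameAt x with hF
  have hU := F.isOpen_dom
  have hf' : FunOn f F.dom := hf.contMDiffOn
  have hG := smooth_hgrad F hf'
  have hdiv (y : M) : divg cov (A.hgrad f) y = -lam * f y := by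
    have := heig y
    rw [subLaplacian_eq hcov hf] at this
    linarith
  have hb := bessel hcov F hx hf'
  have h1 := divg_nabla_hgrad hcov F hx hf'
  have h2 := divg_reebGrad hcov F hx hf'
  have hfl : FunOn (fun y ↦ lam / 4 * f y) F.dom := (FunOn.const _).mul hf'
  have s1 := SmoothOn.nabla hcov.smooth hU hG hG
  have s2 := smooth_reebGrad hcov F hf'
  have h3 : divg cov (flux A cov lam f) x = divg cov (nabla cov (A.hgrad f) (A.hgrad f)) x
      + divg cov (reebGrad A cov f) x + (lam / 4 * f x * divg cov (A.hgrad f) x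
        + lam / 4 * A.g.inner x (A.hgrad f x) (A.hgrad f x)) := by
    unfold flux
    rw [divg_add ((s1.add s2).diffAt hU hx) ((SmoothOn.smul hfl hG).diffAt hU hx),
      divg_add (s1.diffAt hU hx) (s2.diffAt hU hx),
      divg_smul F hx (hfl.mdiffAt hU hx) (hG.diffAt hU hx),
      df_const_mul _ (hf'.mdiffAt hU hx), inner_hgrad f (hGH x)]
  have h4 : df (divg cov (A.hgrad f)) x (A.hgrad f x)
      = -lam * A.g.inner x (A.hgrad f x) (A.hgrad f x) := by
    rw [df_congr_on hU hx (fun y _ ↦ hdiv y), df_const_mul _ (hf'.mdiffAt hU hx),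
      inner_hgrad f (hGH x)]
  -- Coefficients in the sum with (3/4)P: mixed derivatives 2 + 1 − 3 = 0, T⁰ 4 + 1 = 5, S 6 − 3 =
  -- 3, Σ df(ξ_s)² −8 + 4 = −4, and λ|∇f|² −1 − 3/4 + 1/4 = −3/2. The term (λ/4) f div(∇f) =
  -- −(λf)²/4 is what `bessel` needs.
  rw [h3, h1, h2, h4, hR, hT, hdiv]
  rw [hT] at hL
  rw [hdiv] at hb
  nlinarith [hb, hL]

end Eigenfunction

end QCStructure

end QuaternionicContact

/-! ### The volume form as a constant multiple of the Riemannian density. -/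

namespace QuaternionicContact

namespace QCStructure

section VolumeConstant

/-- The matrix of the first fundamental two-form in an adapted frame. -/
def omegaMatrix (i k : Fin 7) : ℝ :=
  if (i = 3 ∧ k = 4) ∨ (i = 5 ∧ k = 6) then 1
  else if (i = 4 ∧ k = 3) ∨ (i = 6 ∧ k = 5) then -1 else 0

lemma omegaMatrix_cases (i k : Fin 7) : omegaMatrix i k = 0 ∨ (i = 3 ∧ k = 4) ∨ (i = 5 ∧ k = 6) ∨
    (i = 4 ∧ k = 3) ∨ (i = 6 ∧ k = 5) := by
  unfold omegaMatrix
  split_ifs with h1 h2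
  · tauto
  · tauto
  · simp

/-- The value of the volume form on an adapted frame. -/
def volConst : ℝ := (1 / 4 : ℝ) * ∑ p : Equiv.Perm (Fin 7), ((Equiv.Perm.sign p : ℤ) : ℝ) *
    ((if p 0 = 0 then 1 else 0) * (if p 1 = 1 then 1 else 0) * (if p 2 = 2 then 1 else 0)
      * omegaMatrix (p 3) (p 4) * omegaMatrix (p 5) (p 6))

/-- A permutation contributes only if it fixes 0, 1, 2 and permutes the pairs {3, 4} and {5, 6} or
the entries within them. Its sign then equals the product of the two matrix entries of ω₁, as each
reversed pair changes both signs and exchanging the pairs changes neither. Of the constant itself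
only positivity is needed. -/
lemma volConst_term_nonneg (p : Equiv.Perm (Fin 7)) : 0 ≤ ((Equiv.Perm.sign p : ℤ) : ℝ) *
    ((if p 0 = 0 then 1 else 0) * (if p 1 = 1 then 1 else 0) * (if p 2 = 2 then 1 else 0)
      * omegaMatrix (p 3) (p 4) * omegaMatrix (p 5) (p 6)) := by
  by_cases h0 : p 0 = 0
  swap; · simp [h0]
  by_cases h1 : p 1 = 1
  swap; · simp [h1]
  by_cases h2 : p 2 = 2
  swap; · simp [h2]
  have e (q : Equiv.Perm (Fin 7)) (h : ∀ i, p i = q i) : p = q := Equiv.ext h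
  rcases omegaMatrix_cases (p 3) (p 4) with h | ⟨h3, h4⟩ | ⟨h3, h4⟩ | ⟨h3, h4⟩ | ⟨h3, h4⟩
  · simp [h]
  all_goals
    rcases omegaMatrix_cases (p 5) (p 6) with h | ⟨h5, h6⟩ | ⟨h5, h6⟩ | ⟨h5, h6⟩ | ⟨h5, h6⟩
    · simp [h]
    all_goals
      first
      | exact absurd (p.injective (h5.trans h3.symm)) (by decide)
      | exact absurd (p.injective (h5.trans h4.symm)) (by decide)
      | skip
  · rw [e 1 (by intro i; fin_cases i <;> assumption)]; simp [omegaMatrix]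
  · rw [e (Equiv.swap 5 6) (by intro i; fin_cases i <;> assumption)]
    rw [Equiv.Perm.sign_swap (by decide)]; simp [omegaMatrix, Equiv.swap_apply_def]
  · rw [e (Equiv.swap 3 5 * Equiv.swap 4 6) (by intro i; fin_cases i <;> assumption)]
    rw [Equiv.Perm.sign_mul, Equiv.Perm.sign_swap (by decide), Equiv.Perm.sign_swap (by decide)]
    simp [omegaMatrix, Equiv.swap_apply_def]
  · rw [e (Equiv.swap 3 5 * Equiv.swap 4 6 * Equiv.swap 5 6)
      (by intro i; fin_cases i <;> assumption)]
    rw [Equiv.Perm.sign_mul, Equiv.Perm.sign_mul, Equiv.Perm.sign_swap (by decide),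
      Equiv.Perm.sign_swap (by decide), Equiv.Perm.sign_swap (by decide)]
    simp [omegaMatrix, Equiv.swap_apply_def]
  · rw [e (Equiv.swap 3 4 * Equiv.swap 5 6 * Equiv.swap 5 6)
      (by intro i; fin_cases i <;> assumption)]
    rw [Equiv.Perm.sign_mul, Equiv.Perm.sign_mul, Equiv.Perm.sign_swap (by decide),
      Equiv.Perm.sign_swap (by decide)]
    simp [omegaMatrix, Equiv.swap_apply_def]
  · rw [e (Equiv.swap 3 4 * Equiv.swap 5 6) (by intro i; fin_cases i <;> assumption)]
    rw [Equiv.Perm.sign_mul, Equiv.Perm.sign_swap (by decide), Equiv.Perm.sign_swap (by decide)]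
    simp [omegaMatrix, Equiv.swap_apply_def]
  · rw [e (Equiv.swap 3 5 * Equiv.swap 4 6 * Equiv.swap 3 4)
      (by intro i; fin_cases i <;> assumption)]
    rw [Equiv.Perm.sign_mul, Equiv.Perm.sign_mul, Equiv.Perm.sign_swap (by decide),
      Equiv.Perm.sign_swap (by decide), Equiv.Perm.sign_swap (by decide)]
    simp [omegaMatrix, Equiv.swap_apply_def]
  · rw [e (Equiv.swap 3 5 * Equiv.swap 4 6 * Equiv.swap 3 4 * Equiv.swap 5 6)
      (by intro i; fin_cases i <;> assumption)]
    rw [Equiv.Perm.sign_mul, Equiv.Perm.sign_mul, Equiv.Perm.sign_mul,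
      Equiv.Perm.sign_swap (by decide), Equiv.Perm.sign_swap (by decide),
      Equiv.Perm.sign_swap (by decide), Equiv.Perm.sign_swap (by decide)]
    simp [omegaMatrix, Equiv.swap_apply_def]

lemma volConst_pos : 0 < volConst := by
  refine mul_pos (by norm_num) (Finset.sum_pos' (fun p _ ↦ volConst_term_nonneg p)
    ⟨1, Finset.mem_univ _, ?_⟩)
  simp [omegaMatrix]

end VolumeConstant

variable {M : Type*} [TopologicalSpace M] [ChartedSpace (EuclideanSpace ℝ (Fin 7)) M]
  [IsManifold (𝓡 7) ∞ M] {A : QCStructure M}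

/-- The volume form is the alternatization of this multilinear form. -/
def volMultilinear (F : A.toQCData.LocalFrame) (x : M) :
    MultilinearMap ℝ (fun _ : Fin 7 ↦ TangentSpace (𝓡 7) x) ℝ :=
  MultilinearMap.mk' (fun v ↦ F.η 0 x (v 0) * F.η 1 x (v 1) * F.η 2 x (v 2)
      * omega F 0 x (v 3) (v 4) * omega F 0 x (v 5) (v 6))
    (by
      intro v i a b
      fin_cases i <;> simp [Function.update, omega] <;> ring)
    (by
      intro v i c a
      fin_cases i <;> simp [Function.update, omega] <;> ring)

lemma volForm_eq (x : M) (v : Fin 7 → TangentSpace (𝓡 7) x) :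
    A.volForm x v = ((1 / 4 : ℝ) • MultilinearMap.alternatization
      (volMultilinear (A.frameAt x) x)) v := by
  rw [AlternatingMap.smul_apply, MultilinearMap.alternatization_apply, volForm, smul_eq_mul]
  congr 1
  refine Finset.sum_congr rfl fun p _ ↦ ?_
  rw [MultilinearMap.domDomCongr_apply, Units.smul_def, zsmul_eq_mul]
  rfl

section Adapted

variable (F : A.toQCData.LocalFrame) {x : M} (hx : x ∈ F.dom)

/-- An orthonormal frame of the tangent space adapted to the almost complex structures. -/
def adapted (x : M) : Fin 7 → TangentSpace (𝓡 7) x :=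
  ![F.ξ 0 x, F.ξ 1 x, F.ξ 2 x, F.e 0 x, F.I 0 x (F.e 0 x), F.I 1 x (F.e 0 x), F.I 2 x (F.e 0 x)]

include hx

lemma adapted_orthonormal (i j : Fin 7) :
    A.g.inner x (adapted F x i) (adapted F x j) = if i = j then 1 else 0 := by
  have he := F.e_mem x hx 0
  have h1 (s) : A.g.inner x (F.e 0 x) (F.I s x (F.e 0 x)) = 0 := inner_I_self F hx s he
  have h2 (s) : A.g.inner x (F.I s x (F.e 0 x)) (F.e 0 x) = 0 := by rw [A.g.symm, h1]
  have h3 (s t) := I_inner_I F hx s t he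
  have h4 (s) (w) (hw : w ∈ A.H x) := F.g_ξ_H x hx s w hw
  have h5 (s) (w) (hw : w ∈ A.H x) : A.g.inner x w (F.ξ s x) = 0 := by rw [A.g.symm, h4 s w hw]
  have h6 (s) := F.I_mem x hx s _ he
  fin_cases i <;> fin_cases j <;>
    simp [adapted, h1, h2, h3, h4 _ _ he, h5 _ _ he, h4 _ _ (h6 _), h5 _ _ (h6 _), F.g_ξ_ξ x hx,
      F.e_orthonormal x hx]

lemma η_adapted (s : Fin 3) (j : Fin 7) :
    F.η s x (adapted F x j) = if j = Fin.castLE (by norm_num) s then 1 else 0 := by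
  have : F.ξ s x = adapted F x (Fin.castLE (by norm_num) s) := by fin_cases s <;> rfl
  rw [η_eq F hx, this, adapted_orthonormal F hx]

lemma omega_adapted (i k : Fin 7) :
    omega F 0 x (adapted F x i) (adapted F x k) = omegaMatrix i k := by
  have he := F.e_mem x hx 0
  obtain ⟨⟨a1, a2, a3⟩, ⟨b1, b2, b3⟩, c1, c2, c3⟩ := I_table F hx he
  have hI : F.I 0 x (adapted F x i) = (![0, 0, 0, 1, -1, 1, -1] : Fin 7 → ℝ) i •
      adapted F x ((![0, 0, 0, 4, 3, 6, 5] : Fin 7 → Fin 7) i) := by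
    fin_cases i <;> simp [adapted, F.I_ξ x hx, a1, b1, c3]
  rw [omega, hI, inner_smul_left, adapted_orthonormal F hx]
  fin_cases i <;> fin_cases k <;> simp [omegaMatrix]

lemma adapted_linearIndependent : LinearIndependent ℝ (adapted F x) := by
  rw [Fintype.linearIndependent_iff]
  intro c hc j
  have := congrArg (fun v ↦ A.g.inner x v (adapted F x j)) hc
  simp only [inner_sum_left, inner_smul_left, adapted_orthonormal F hx] at this
  simpa using this

/-- The adapted frame as a basis. -/
def adaptedBasis : Module.Basis (Fin 7) ℝ (TangentSpace (𝓡 7) x) :=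
  haveI : FiniteDimensional ℝ (TangentSpace (𝓡 7) x) :=
    inferInstanceAs (FiniteDimensional ℝ (EuclideanSpace ℝ (Fin 7)))
  basisOfLinearIndependentOfCardEqFinrank (adapted_linearIndependent F hx) (by
    have : Module.finrank ℝ (TangentSpace (𝓡 7) x) = 7 :=
      finrank_euclideanSpace_fin (𝕜 := ℝ) (n := 7)
    rw [this]; rfl)

lemma adaptedBasis_apply (i : Fin 7) : adaptedBasis F hx i = adapted F x i := by
  simp [adaptedBasis]

lemma adaptedBasis_repr (v : TangentSpace (𝓡 7) x) (i : Fin 7) :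
    (adaptedBasis F hx).repr v i = A.g.inner x v (adapted F x i) := by
  conv_rhs => rw [← (adaptedBasis F hx).sum_repr v]
  simp only [inner_sum_left, inner_smul_left, adaptedBasis_apply, adapted_orthonormal F hx]
  simp

end Adapted

variable (A) in
/-- The Gram matrix of seven tangent vectors. -/
def gram (x : M) (v : Fin 7 → TangentSpace (𝓡 7) x) : Matrix (Fin 7) (Fin 7) ℝ :=
  Matrix.of fun i j ↦ A.g.inner x (v i) (v j)

/-- With B the matrix of v in an orthonormal adapted basis, the Gram matrix is BᵀB, so √det is |det
B|. The volume form refers to a frame chosen point by point, whereas the Gram matrix involves only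
the smooth metric; this is how smoothness of the density is obtained. -/
lemma gram_eq (x : M) (v : Fin 7 → TangentSpace (𝓡 7) x) :
    A.gram x v = ((adaptedBasis (A.frameAt x) (A.mem_frameAt_dom x)).toMatrix v).transpose
      * (adaptedBasis (A.frameAt x) (A.mem_frameAt_dom x)).toMatrix v := by
  ext i j
  simp only [gram, Matrix.of_apply, Matrix.mul_apply, Matrix.transpose_apply,
    Module.Basis.toMatrix_apply, adaptedBasis_repr]
  conv_lhs => rw [← (adaptedBasis (A.frameAt x) (A.mem_frameAt_dom x)).sum_repr (v i)]
  simp only [inner_sum_left, inner_smul_left, adaptedBasis_repr, adaptedBasis_apply]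
  exact Finset.sum_congr rfl fun k _ ↦ by rw [A.g.symm x (v j)]

/-- The volume form in terms of the metric. -/
lemma abs_volForm (x : M) (v : Fin 7 → TangentSpace (𝓡 7) x) :
    |A.volForm x v| = volConst * √(A.gram x v).det := by
  have hx := A.mem_frameAt_dom x
  have hb : A.volForm x (adaptedBasis (A.frameAt x) hx) = volConst := by
    rw [volForm, volConst]
    congr 1
    refine Finset.sum_congr rfl fun p _ ↦ ?_
    simp only [adaptedBasis_apply]
    rw [η_adapted _ hx, η_adapted _ hx, η_adapted _ hx, omega_adapted _ hx, omega_adapted _ hx]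
    rfl
  -- Alternating forms of top degree are determined by their value on one basis.
  have h : A.volForm x v = A.volForm x (adaptedBasis (A.frameAt x) hx)
      * (adaptedBasis (A.frameAt x) hx).det v := by
    have h1 (f : TangentSpace (𝓡 7) x [⋀^Fin 7]→ₗ[ℝ] ℝ)
        (b : Module.Basis (Fin 7) ℝ (TangentSpace (𝓡 7) x)) : f v = f b * b.det v := by
      conv_lhs => rw [f.eq_smul_basis_det b]
      rfl
    rw [volForm_eq x v, volForm_eq x (adaptedBasis _ hx)]
    exact h1 _ _
  rw [h, hb, Module.Basis.det_apply, gram_eq, Matrix.det_mul, Matrix.det_transpose, abs_mul,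
    Real.sqrt_mul_self_eq_abs, abs_of_pos volConst_pos]

lemma gram_det_nonneg (x : M) (v : Fin 7 → TangentSpace (𝓡 7) x) : 0 ≤ (A.gram x v).det := by
  rw [gram_eq, Matrix.det_mul, Matrix.det_transpose]
  exact mul_self_nonneg _

lemma gram_det_pos {x : M} {v : Fin 7 → TangentSpace (𝓡 7) x} (hv : LinearIndependent ℝ v) :
    0 < (A.gram x v).det := by
  have : FiniteDimensional ℝ (TangentSpace (𝓡 7) x) :=
    inferInstanceAs (FiniteDimensional ℝ (EuclideanSpace ℝ (Fin 7)))
  have hu := ((adaptedBasis (A.frameAt x) (A.mem_frameAt_dom x)).is_basis_iff_det (v := v)).1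
    ⟨hv, hv.span_eq_top_of_card_eq_finrank' (by
      have : Module.finrank ℝ (TangentSpace (𝓡 7) x) = 7 :=
        finrank_euclideanSpace_fin (𝕜 := ℝ) (n := 7)
      rw [this]; rfl)⟩
  rw [gram_eq, Matrix.det_mul, Matrix.det_transpose]
  rw [Module.Basis.det_apply] at hu
  exact mul_self_pos.2 hu.ne_zero

lemma gram_sum {x : M} (J : Matrix (Fin 7) (Fin 7) ℝ) (v : Fin 7 → TangentSpace (𝓡 7) x) :
    A.gram x (fun i ↦ ∑ j, J i j • v j) = J * A.gram x v * J.transpose := by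
  ext i k
  simp only [gram, Matrix.of_apply, Matrix.mul_apply, Matrix.transpose_apply]
  rw [map_sum (A.g.inner x (∑ j, J i j • v j))]
  refine Finset.sum_congr rfl fun l _ ↦ ?_
  rw [map_smul, inner_sum_left, smul_eq_mul, mul_comm]
  simp only [inner_smul_left]

end QCStructure

end QuaternionicContact

/-! ### Coordinates: Jacobi's formula, the density, and the divergence in a chart. -/

namespace QuaternionicContact

section Determinant

/-- The determinant is multilinear in the rows, so its derivative is the sum over rows of
determinants with one row replaced. Cramer's rule turns these into entries of the adjugate. -/
lemma hasFDerivAt_det {n : ℕ} (U : Fin n → Fin n → ℝ) :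
    ∃ L : (Fin n → Fin n → ℝ) →L[ℝ] ℝ,
      HasFDerivAt (fun V : Fin n → Fin n → ℝ ↦ (Matrix.of V).det) L U ∧
      ∀ V, L V = ((Matrix.of U).adjugate * Matrix.of V).trace := by
  let f : ContinuousMultilinearMap ℝ (fun _ : Fin n ↦ Fin n → ℝ) ℝ :=
    ⟨(Matrix.detRowAlternating (R := ℝ) (n := Fin n)).toMultilinearMap,
      Continuous.matrix_det continuous_id⟩
  refine ⟨f.linearDeriv U, f.hasFDerivAt U, fun V ↦ ?_⟩
  rw [f.linearDeriv_apply, Matrix.trace]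
  have h (i : Fin n) : f (Function.update U i (V i))
      = ∑ j, V i j * (Matrix.of U).adjugate j i := by
    have h1 : f (Function.update U i (V i)) = ((Matrix.of U).updateRow i (V i)).det := rfl
    rw [h1, ← Matrix.cramer_transpose_apply, Matrix.cramer_eq_adjugate_mulVec,
      ← Matrix.adjugate_transpose]
    simp only [Matrix.mulVec, dotProduct, Matrix.transpose_apply]
    exact Finset.sum_congr rfl fun j _ ↦ mul_comm _ _
  simp only [h, Matrix.diag_apply, Matrix.mul_apply, Matrix.of_apply]
  rw [Finset.sum_comm]
  exact Finset.sum_congr rfl fun i _ ↦ Finset.sum_congr rfl fun j _ ↦ mul_comm _ _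

end Determinant

variable {M : Type*} [TopologicalSpace M] [ChartedSpace (EuclideanSpace ℝ (Fin 7)) M]
  [IsManifold (𝓡 7) ∞ M]

lemma mfderiv_apply_clm {E' : Type*} [NormedAddCommGroup E'] [NormedSpace ℝ E'] {Φ : M → E'}
    {x : M} (hΦ : MDifferentiableAt (𝓡 7) 𝓘(ℝ, E') Φ x) (L : E' →L[ℝ] ℝ)
    (w : TangentSpace (𝓡 7) x) : df (fun y ↦ L (Φ y)) x w = L (mfderiv (𝓡 7) 𝓘(ℝ, E') Φ x w) := by
  have h := mvfderiv_comp_apply (g := L) (f := Φ) x L.differentiableAt.mdifferentiableAt hΦ w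
  refine h.trans ?_
  simp only [mvfderiv, mfderiv_eq_fderiv]
  rw [L.fderiv]
  rfl

/-- Jacobi's formula. -/
lemma df_det {n : ℕ} {u : Fin n → Fin n → M → ℝ} {x : M}
    (hu : ∀ i j, MDifferentiableAt (𝓡 7) 𝓘(ℝ) (u i j) x) (w : TangentSpace (𝓡 7) x) :
    df (fun y ↦ (Matrix.of fun i j ↦ u i j y).det) x w
      = ((Matrix.of fun i j ↦ u i j x).adjugate * Matrix.of fun i j ↦ df (u i j) x w).trace := by
  obtain ⟨L, hL, hLV⟩ := hasFDerivAt_det (fun i j ↦ u i j x)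
  let Φ : M → Fin n → Fin n → ℝ := fun y i j ↦ u i j y
  have hΦ : MDifferentiableAt (𝓡 7) 𝓘(ℝ, Fin n → Fin n → ℝ) Φ x := by
    have h (i j) := (mdifferentiableAt_iff _ _).1 (hu i j)
    rw [mdifferentiableAt_iff]
    exact ⟨continuousAt_pi.2 fun i ↦ continuousAt_pi.2 fun j ↦ (h i j).1,
      differentiableWithinAt_pi.2 fun i ↦ differentiableWithinAt_pi.2 fun j ↦ (h i j).2⟩
  have h := mvfderiv_comp_apply (g := fun V : Fin n → Fin n → ℝ ↦ (Matrix.of V).det) (f := Φ) x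
    hL.differentiableAt.mdifferentiableAt hΦ w
  refine h.trans ?_
  have h2 : (mvfderiv 𝓘(ℝ, Fin n → Fin n → ℝ) (fun V : Fin n → Fin n → ℝ ↦ (Matrix.of V).det)
      (Φ x)) = L := by
    simp only [mvfderiv, mfderiv_eq_fderiv]
    rw [hL.fderiv]
    rfl
  rw [h2]
  refine (hLV _).trans ?_
  congr 3
  funext i j
  exact (mfderiv_apply_clm hΦ ((ContinuousLinearMap.proj j).comp
    (ContinuousLinearMap.proj (R := ℝ) (φ := fun _ : Fin n ↦ Fin n → ℝ) i)) w).symm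

lemma FunOn.prod {ι : Type*} {s : Finset ι} {w : ι → M → ℝ} {U : Set M}
    (h : ∀ i ∈ s, FunOn (w i) U) : FunOn (fun y ↦ ∏ i ∈ s, w i y) U :=
  contMDiffOn_finsetProd h

lemma FunOn.det {n : ℕ} {u : Fin n → Fin n → M → ℝ} {U : Set M} (hu : ∀ i j, FunOn (u i j) U) :
    FunOn (fun y ↦ (Matrix.of fun i j ↦ u i j y).det) U := by
  simp only [Matrix.det_apply']
  exact FunOn.sum fun σ _ ↦ (FunOn.const _).mul (FunOn.prod fun i _ ↦ hu _ _)

section Coordinates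

variable (c : M) {x : M}

/-- The coordinate vector fields of the chart at `c`. -/
def coordField (i : Fin 7) : VField M :=
  (trivializationAt (EuclideanSpace ℝ (Fin 7)) (TangentSpace (𝓡 7)) c).localFrame
    (EuclideanSpace.basisFun (Fin 7) ℝ).toBasis i

/-- The coordinate functions of the chart at `c`. -/
def coord (i : Fin 7) (x : M) : ℝ := extChartAt (𝓡 7) c x i

lemma smooth_coordField (i : Fin 7) :
    SmoothOn (coordField c i) (chartAt (EuclideanSpace ℝ (Fin 7)) c).source :=
  Bundle.Trivialization.contMDiffOn_localFrame_baseSet ∞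
    (trivializationAt (EuclideanSpace ℝ (Fin 7)) (TangentSpace (𝓡 7)) c)
    (EuclideanSpace.basisFun (Fin 7) ℝ).toBasis i

lemma smooth_coord (i : Fin 7) :
    FunOn (coord c i) (chartAt (EuclideanSpace ℝ (Fin 7)) c).source :=
  ((EuclideanSpace.proj (𝕜 := ℝ) i).contMDiff).comp_contMDiffOn contMDiffOn_extChartAt

variable {c}

lemma coordField_eq (hx : x ∈ (chartAt (EuclideanSpace ℝ (Fin 7)) c).source) (i : Fin 7) :
    coordField c i x
      = (trivializationAt (EuclideanSpace ℝ (Fin 7)) (TangentSpace (𝓡 7)) c).symmL ℝ x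
        (EuclideanSpace.single i 1) := by
  have hb : x ∈ (trivializationAt (EuclideanSpace ℝ (Fin 7)) (TangentSpace (𝓡 7)) c).baseSet := hx
  rw [coordField, Bundle.Trivialization.localFrame_apply_of_mem_baseSet _ _ hb,
    Bundle.Trivialization.basisAt, Module.Basis.map_apply]
  rw [OrthonormalBasis.coe_toBasis, EuclideanSpace.basisFun_apply,
    Bundle.Trivialization.symmL_apply _ hb]
  rfl

lemma coordVector_eq {z : EuclideanSpace ℝ (Fin 7)} (hz : z ∈ (extChartAt (𝓡 7) c).target)
    (i : Fin 7) :
    QCStructure.coordVector c z i = coordField c i ((extChartAt (𝓡 7) c).symm z) := by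
  have hx : (extChartAt (𝓡 7) c).symm z ∈ (chartAt (EuclideanSpace ℝ (Fin 7)) c).source := by
    rw [← extChartAt_source (𝓡 7)]
    exact (extChartAt (𝓡 7) c).map_target hz
  rw [coordField_eq hx, TangentBundle.symmL_trivializationAt hx, (extChartAt (𝓡 7) c).right_inv hz]
  simp only [ModelWithCorners.range_eq_univ, mfderivWithin_univ]
  rfl

lemma df_coord (hx : x ∈ (chartAt (EuclideanSpace ℝ (Fin 7)) c).source) (i j : Fin 7) :
    df (coord c j) x (coordField c i x) = if i = j then 1 else 0 := by
  have hb : x ∈ (trivializationAt (EuclideanSpace ℝ (Fin 7)) (TangentSpace (𝓡 7)) c).baseSet := hx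
  have h := mfderiv_apply_clm (mdifferentiableAt_extChartAt (I := 𝓡 7) hx)
    (EuclideanSpace.proj (𝕜 := ℝ) j) (coordField c i x)
  refine h.trans ?_
  rw [← TangentBundle.continuousLinearMapAt_trivializationAt hx, coordField_eq hx]
  have h2 := Bundle.Trivialization.continuousLinearMapAt_symmL (R := ℝ)
    (trivializationAt (EuclideanSpace ℝ (Fin 7)) (TangentSpace (𝓡 7)) c) hb
    (EuclideanSpace.single i 1)
  refine (congrArg (EuclideanSpace.proj (𝕜 := ℝ) j) h2).trans ?_
  simp [eq_comm]

lemma coordField_linearIndependent (hx : x ∈ (chartAt (EuclideanSpace ℝ (Fin 7)) c).source) :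
    LinearIndependent ℝ (fun i ↦ coordField c i x) := by
  rw [Fintype.linearIndependent_iff]
  intro a ha j
  have := congrArg (df (coord c j) x) ha
  simpa [df_coord hx] using this

/-- The coordinate vector fields as a basis of the tangent space. -/
def coordBasis (hx : x ∈ (chartAt (EuclideanSpace ℝ (Fin 7)) c).source) :
    Module.Basis (Fin 7) ℝ (TangentSpace (𝓡 7) x) :=
  haveI : FiniteDimensional ℝ (TangentSpace (𝓡 7) x) :=
    inferInstanceAs (FiniteDimensional ℝ (EuclideanSpace ℝ (Fin 7)))
  basisOfLinearIndependentOfCardEqFinrank (coordField_linearIndependent hx) (by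
    have : Module.finrank ℝ (TangentSpace (𝓡 7) x) = 7 :=
      finrank_euclideanSpace_fin (𝕜 := ℝ) (n := 7)
    rw [this]; rfl)

lemma coordBasis_apply (hx : x ∈ (chartAt (EuclideanSpace ℝ (Fin 7)) c).source) (i : Fin 7) :
    coordBasis hx i = coordField c i x := by
  simp [coordBasis]

lemma coordBasis_repr (hx : x ∈ (chartAt (EuclideanSpace ℝ (Fin 7)) c).source)
    (v : TangentSpace (𝓡 7) x) (i : Fin 7) : (coordBasis hx).repr v i = df (coord c i) x v := by
  conv_rhs => rw [← (coordBasis hx).sum_repr v]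
  simp [coordBasis_apply, df_coord hx]

lemma coord_expand (hx : x ∈ (chartAt (EuclideanSpace ℝ (Fin 7)) c).source)
    (v : TangentSpace (𝓡 7) x) : v = ∑ i, df (coord c i) x v • coordField c i x := by
  conv_lhs => rw [← (coordBasis hx).sum_repr v]
  simp only [coordBasis_apply, coordBasis_repr]

/-- Partial derivatives in the chart are derivatives along the coordinate fields. -/
lemma fderiv_comp_symm {u : M → ℝ} {z : EuclideanSpace ℝ (Fin 7)}
    (hz : z ∈ (extChartAt (𝓡 7) c).target)
    (hu : MDifferentiableAt (𝓡 7) 𝓘(ℝ) u ((extChartAt (𝓡 7) c).symm z)) (i : Fin 7) :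
    DifferentiableAt ℝ (u ∘ (extChartAt (𝓡 7) c).symm) z ∧
    fderiv ℝ (u ∘ (extChartAt (𝓡 7) c).symm) z (EuclideanSpace.single i 1)
      = df u ((extChartAt (𝓡 7) c).symm z) (coordField c i ((extChartAt (𝓡 7) c).symm z)) := by
  have hs : MDifferentiableAt 𝓘(ℝ, EuclideanSpace ℝ (Fin 7)) (𝓡 7) (extChartAt (𝓡 7) c).symm z :=
    ((contMDiffOn_extChartAt_symm (I := 𝓡 7) (n := ∞) c).contMDiffAt
      ((isOpen_extChartAt_target c).mem_nhds hz)).mdifferentiableAt (by simp)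
  refine ⟨(hu.comp z hs).differentiableAt, ?_⟩
  rw [← coordVector_eq hz]
  have h := mvfderiv_comp_apply (g := u) (f := (extChartAt (𝓡 7) c).symm) z hu hs
    (EuclideanSpace.single i (1 : ℝ) : EuclideanSpace ℝ (Fin 7))
  refine Eq.trans ?_ h
  simp only [mvfderiv, mfderiv_eq_fderiv]
  rfl

end Coordinates

/-- The restriction of a local frame to an open set. -/
def QCData.LocalFrame.restrict {D : QCData M} (F : D.LocalFrame) (U : Set M) (hU : IsOpen U) :
    D.LocalFrame where
  dom := F.dom ∩ U
  isOpen_dom := F.isOpen_dom.inter hU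
  η := F.η
  I := F.I
  ξ := F.ξ
  e := F.e
  smooth_η s := (F.smooth_η s).mono inter_subset_left
  smooth_I s := (F.smooth_I s).mono inter_subset_left
  smooth_ξ s := (F.smooth_ξ s).mono inter_subset_left
  smooth_e a := (F.smooth_e a).mono inter_subset_left
  mem_H_iff x hx := F.mem_H_iff x hx.1
  e_mem x hx := F.e_mem x hx.1
  e_orthonormal x hx := F.e_orthonormal x hx.1
  Q_eq x hx := F.Q_eq x hx.1
  I_mem x hx := F.I_mem x hx.1
  I_ξ x hx := F.I_ξ x hx.1
  I_sq x hx := F.I_sq x hx.1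
  I_zero_one x hx := F.I_zero_one x hx.1
  I_one_zero x hx := F.I_one_zero x hx.1
  g_I_I x hx := F.g_I_I x hx.1
  compat x hx := F.compat x hx.1
  η_ξ x hx := F.η_ξ x hx.1
  reeb_self x hx := F.reeb_self x hx.1
  reeb_skew x hx := F.reeb_skew x hx.1
  g_ξ_ξ x hx := F.g_ξ_ξ x hx.1
  g_ξ_H x hx := F.g_ξ_H x hx.1

namespace QCStructure

variable {A : QCStructure M}

variable (A) in
/-- The density of the volume form in the chart at `c`. -/
def dens (c x : M) : ℝ := volConst * √(A.gram x fun i ↦ coordField c i x).det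

lemma dens_pos {c x : M} (hx : x ∈ (chartAt (EuclideanSpace ℝ (Fin 7)) c).source) :
    0 < A.dens c x :=
  mul_pos volConst_pos (Real.sqrt_pos.2 (gram_det_pos (coordField_linearIndependent hx)))

lemma smooth_gram (c : M) : FunOn (fun x ↦ (A.gram x fun i ↦ coordField c i x).det)
    (chartAt (EuclideanSpace ℝ (Fin 7)) c).source :=
  FunOn.det fun i j ↦ FunOn.inner A.g (smooth_coordField c i) (smooth_coordField c j)

lemma smooth_dens (c : M) : FunOn (A.dens c) (chartAt (EuclideanSpace ℝ (Fin 7)) c).source := by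
  refine (FunOn.const _).mul fun x hx ↦ ?_
  have h := Real.contDiffAt_sqrt (n := ∞)
    (gram_det_pos (A := A) (coordField_linearIndependent hx)).ne'
  exact h.contMDiffAt.comp_contMDiffWithinAt x (smooth_gram c x hx)

lemma abs_volForm_coordVector {c : M} {z : EuclideanSpace ℝ (Fin 7)}
    (hz : z ∈ (extChartAt (𝓡 7) c).target) :
    |A.volForm ((extChartAt (𝓡 7) c).symm z) (coordVector c z)|
      = A.dens c ((extChartAt (𝓡 7) c).symm z) := by
  rw [abs_volForm, dens]
  congr 4
  exact funext fun i ↦ coordVector_eq hz i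

section Divergence

variable [T2Space M]
  {cov : CovariantDerivative (𝓡 7) (EuclideanSpace ℝ (Fin 7)) (fun x : M ↦ TangentSpace (𝓡 7) x)}
  (hcov : A.IsBiquard cov) (F : A.toQCData.LocalFrame) {x c : M} (hx : x ∈ F.dom)
  (hF : F.dom ⊆ (chartAt (EuclideanSpace ℝ (Fin 7)) c).source)

include hcov hx hF

/-- With a the connection matrix of the coordinate fields, metric compatibility reads dG = aG + Gaᵀ.
Jacobi's formula and adj(G)G = det(G)·1 then give 2 det(G) tr(a). -/
lemma df_gram_det (v : TangentSpace (𝓡 7) x) :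
    df (fun y ↦ (A.gram y fun i ↦ coordField c i y).det) x v
      = 2 * (A.gram x fun i ↦ coordField c i x).det
        * ∑ i, df (coord c i) x (cov (coordField c i) x v) := by
  have hP (i) : SmoothOn (coordField c i) F.dom := (smooth_coordField c i).mono hF
  set a : Matrix (Fin 7) (Fin 7) ℝ :=
    Matrix.of fun i k ↦ df (coord c k) x (cov (coordField c i) x v) with ha
  set G := A.gram x fun i ↦ coordField c i x with hG
  have h1 : df (fun y ↦ (A.gram y fun i ↦ coordField c i y).det) x v
      = (G.adjugate * Matrix.of fun i j ↦
        df (fun y ↦ A.g.inner y (coordField c i y) (coordField c j y)) x v).trace :=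
    df_det (fun i j ↦ (FunOn.inner A.g (hP i) (hP j)).mdiffAt F.isOpen_dom hx) v
  have hexp (i) := coord_expand (hF hx) (cov (coordField c i) x v)
  have h2 : (Matrix.of fun i j ↦
      df (fun y ↦ A.g.inner y (coordField c i y) (coordField c j y)) x v)
      = a * G + G * a.transpose := by
    ext i j
    rw [Matrix.of_apply, metric hcov F hx (hP i) (hP j), Matrix.add_apply, Matrix.mul_apply,
      Matrix.mul_apply]
    congr 1
    · conv_lhs => rw [hexp i]
      rw [inner_sum_left]
      simp only [inner_smul_left]
      rfl
    · conv_lhs => rw [hexp j]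
      rw [map_sum]
      simp only [map_smul, smul_eq_mul, mul_comm (df _ x _)]
      rfl
  have h3 : ∑ i, df (coord c i) x (cov (coordField c i) x v) = a.trace := rfl
  rw [h1, h2, h3, Matrix.mul_add, Matrix.trace_add, ← Matrix.mul_assoc, ← Matrix.mul_assoc,
    Matrix.trace_mul_comm, ← Matrix.mul_assoc, Matrix.mul_adjugate, Matrix.adjugate_mul,
    Matrix.smul_mul, Matrix.smul_mul, Matrix.one_mul, Matrix.one_mul, Matrix.trace_smul,
    Matrix.trace_smul, Matrix.trace_transpose, smul_eq_mul]
  ring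

lemma df_dens (v : TangentSpace (𝓡 7) x) :
    df (A.dens c) x v = A.dens c x * ∑ i, df (coord c i) x (cov (coordField c i) x v) := by
  have hU := F.isOpen_dom
  have hd := ((smooth_dens (A := A) c).mono hF).mdiffAt hU hx
  -- Comparing the square of the density with the Gram determinant avoids differentiating the square
  -- root.
  have hsq (y : M) : (A.gram y fun i ↦ coordField c i y).det
      = (volConst ^ 2)⁻¹ * (A.dens c y * A.dens c y) := by
    have h := Real.mul_self_sqrt (gram_det_nonneg (A := A) y fun i ↦ coordField c i y)
    have h2 := volConst_pos.ne'
    rw [dens, mul_mul_mul_comm, h, ← pow_two, inv_mul_cancel_left₀ (pow_ne_zero 2 h2)]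
  have h1 := df_gram_det hcov F hx hF v
  rw [df_congr_on hU hx (fun y _ ↦ hsq y), df_const_mul (u := fun y ↦ A.dens c y * A.dens c y) _ (hd.mul hd), df_mul hd hd, hsq x] at h1
  have h2 := (inv_pos.2 (pow_pos volConst_pos 2)).ne'
  have h3 := (dens_pos (A := A) (hF hx)).ne'
  have h4 : (volConst ^ 2)⁻¹ * A.dens c x * 2 * df (A.dens c) x v
      = (volConst ^ 2)⁻¹ * A.dens c x * 2
        * (A.dens c x * ∑ i, df (coord c i) x (cov (coordField c i) x v)) := by linarith
  exact mul_left_cancel₀ (by positivity) h4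

/-- The divergence in coordinates. -/
lemma dens_mul_divg {σ : VField M} (hσ : SmoothOn σ F.dom) (hH : σ x ∈ A.H x) :
    A.dens c x * divg cov σ x
      = ∑ i, df (fun y ↦ A.dens c y * df (coord c i) y (σ y)) x (coordField c i x) := by
  have hU := F.isOpen_dom
  have hP (i) : SmoothOn (coordField c i) F.dom := (smooth_coordField c i).mono hF
  have hz (i) : FunOn (coord c i) F.dom := (smooth_coord c i).mono hF
  have hd := ((smooth_dens (A := A) c).mono hF).mdiffAt hU hx
  have h1 : divg cov σ x = ∑ i, df (coord c i) x (cov σ x (coordField c i x)) := by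
    rw [divg, LinearMap.trace_eq_matrix_trace ℝ (coordBasis (hF hx)), Matrix.trace]
    refine Finset.sum_congr rfl fun i _ ↦ ?_
    rw [Matrix.diag_apply, LinearMap.toMatrix_apply, coordBasis_repr, coordBasis_apply]
    rfl
  -- The trace of T(σ, ·) does not depend on the basis, and in the adapted frame it vanishes since σ
  -- x is horizontal.
  have h2 : ∑ i, df (coord c i) x (cov.torsion x (σ x) (coordField c i x)) = 0 := by
    rw [← torsion_trace hcov F hx hH]
    have e1 : LinearMap.trace ℝ (TangentSpace (𝓡 7) x)
        (cov.torsion x (σ x) : TangentSpace (𝓡 7) x →ₗ[ℝ] TangentSpace (𝓡 7) x)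
        = ∑ i, df (coord c i) x (cov.torsion x (σ x) (coordField c i x)) := by
      rw [LinearMap.trace_eq_matrix_trace ℝ (coordBasis (hF hx)), Matrix.trace]
      refine Finset.sum_congr rfl fun i _ ↦ ?_
      rw [Matrix.diag_apply, LinearMap.toMatrix_apply, coordBasis_repr, coordBasis_apply]
      rfl
    rw [← e1, LinearMap.trace_eq_matrix_trace ℝ (frBasis F hx), Matrix.trace]
    refine Finset.sum_congr rfl fun i _ ↦ ?_
    rw [Matrix.diag_apply, LinearMap.toMatrix_apply, frBasis_repr, frBasis_apply]
    rfl
  -- ∇_{∂_i}σ = ∇_σ ∂_i − [σ, ∂_i] − T(σ, ∂_i), and the i-th coordinate of [σ, ∂_i] is −∂_i(σ^i)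
  -- because dz_i(∂_i) is constant. The terms ∇_σ ∂_i sum to the logarithmic derivative of the
  -- density along σ by `df_dens`.
  have h3 (i : Fin 7) : df (coord c i) x (cov σ x (coordField c i x))
      = df (coord c i) x (cov (coordField c i) x (σ x))
        + df (fun y ↦ df (coord c i) y (σ y)) x (coordField c i x)
        - df (coord c i) x (cov.torsion x (σ x) (coordField c i x)) := by
    have e1 := torsion_eq (cov := cov) (hσ.diffAt hU hx) ((hP i).diffAt hU hx)
    have e2 := df_bracket hU hσ (hP i) (hz i) hx (F.smooth_e 0) (e_ne_zero F hx 0)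
    rw [df_congr_on hU hx (u := fun y ↦ df (coord c i) y (coordField c i y)) (v := fun _ ↦ 1)
      (fun y hy ↦ by rw [df_coord (hF hy), if_pos rfl]), df_const] at e2
    rw [e1, map_sub, map_sub, e2]
    simp only [nabla]
    ring
  have h4 (i : Fin 7) : df (fun y ↦ A.dens c y * df (coord c i) y (σ y)) x (coordField c i x)
      = A.dens c x * df (fun y ↦ df (coord c i) y (σ y)) x (coordField c i x)
        + df (coord c i) x (σ x) * df (A.dens c) x (coordField c i x) :=
    df_mul hd (((hz i).df hU hσ).mdiffAt hU hx) _
  have h5 : df (A.dens c) x (σ x)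
      = ∑ i, df (coord c i) x (σ x) * df (A.dens c) x (coordField c i x) := by
    conv_lhs => rw [coord_expand (hF hx) (σ x), map_sum]
    simp only [map_smul, smul_eq_mul]
  simp only [h4, Finset.sum_add_distrib, ← Finset.mul_sum]
  rw [← h5, df_dens hcov F hx hF, h1]
  simp only [h3, Finset.sum_add_distrib, Finset.sum_sub_distrib, h2]
  ring

end Divergence

end QCStructure

end QuaternionicContact

/-! ### The measure of the volume form: gluing of charts, local finiteness, positivity. -/

namespace QuaternionicContact

namespace QCStructure

variable {M : Type*} [TopologicalSpace M] [ChartedSpace (EuclideanSpace ℝ (Fin 7)) M]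
  [IsManifold (𝓡 7) ∞ M] {A : QCStructure M}

section ChangeOfCoordinates

variable {c c' x : M}

lemma dens_change
    (hx' : x ∈ (chartAt (EuclideanSpace ℝ (Fin 7)) c').source) :
    A.dens c x = |(Matrix.of fun i j ↦ df (coord c' j) x (coordField c i x)).det|
      * A.dens c' x := by
  set J : Matrix (Fin 7) (Fin 7) ℝ := Matrix.of fun i j ↦ df (coord c' j) x (coordField c i x)
    with hJ
  have h : (fun i ↦ coordField c i x) = fun i ↦ ∑ j, J i j • coordField c' j x :=
    funext fun i ↦ coord_expand hx' (coordField c i x)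
  rw [dens, dens, h, gram_sum, Matrix.det_mul, Matrix.det_mul, Matrix.det_transpose,
    mul_right_comm, ← pow_two, Real.sqrt_mul (sq_nonneg _), Real.sqrt_sq_eq_abs]
  ring

lemma hasFDerivAt_coordChange {z : EuclideanSpace ℝ (Fin 7)}
    (hz : z ∈ (extChartAt (𝓡 7) c).target)
    (hz' : (extChartAt (𝓡 7) c).symm z ∈ (chartAt (EuclideanSpace ℝ (Fin 7)) c').source) :
    HasFDerivAt (extChartAt (𝓡 7) c' ∘ (extChartAt (𝓡 7) c).symm)
      (fderiv ℝ (extChartAt (𝓡 7) c' ∘ (extChartAt (𝓡 7) c).symm) z) z ∧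
    (fderiv ℝ (extChartAt (𝓡 7) c' ∘ (extChartAt (𝓡 7) c).symm) z).det
      = (Matrix.of fun i j ↦ df (coord c' j) ((extChartAt (𝓡 7) c).symm z)
        (coordField c i ((extChartAt (𝓡 7) c).symm z))).det := by
  have h (j i) := fderiv_comp_symm hz ((smooth_coord c' j).mdiffAt
    (chartAt (EuclideanSpace ℝ (Fin 7)) c').open_source hz') i
  have hd : DifferentiableAt ℝ (extChartAt (𝓡 7) c' ∘ (extChartAt (𝓡 7) c).symm) z :=
    differentiableAt_euclidean.2 fun j ↦ (h j 0).1
  refine ⟨hd.hasFDerivAt, ?_⟩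
  rw [← Matrix.det_transpose, ContinuousLinearMap.det,
    ← LinearMap.det_toMatrix (EuclideanSpace.basisFun (Fin 7) ℝ).toBasis]
  congr 1
  ext j i
  rw [LinearMap.toMatrix_apply, OrthonormalBasis.coe_toBasis, EuclideanSpace.basisFun_apply,
    Matrix.transpose_apply, Matrix.of_apply, ← (h j i).2]
  have h2 : fderiv ℝ (coord c' j ∘ (extChartAt (𝓡 7) c).symm) z
      = (EuclideanSpace.proj (𝕜 := ℝ) j).comp
        (fderiv ℝ (extChartAt (𝓡 7) c' ∘ (extChartAt (𝓡 7) c).symm) z) :=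
    ((EuclideanSpace.proj (𝕜 := ℝ) j).hasFDerivAt.comp z hd.hasFDerivAt).fderiv
  rw [h2]
  rfl

end ChangeOfCoordinates

section ChartMeasure

variable [MeasurableSpace M] [BorelSpace M] (c : M)

lemma aemeasurable_chart_symm {ν : Measure (EuclideanSpace ℝ (Fin 7))}
    (hν : ν ≪ volume.restrict (extChartAt (𝓡 7) c).target) :
    AEMeasurable (extChartAt (𝓡 7) c).symm ν :=
  ((continuousOn_extChartAt_symm c).aemeasurable
    (isOpen_extChartAt_target c).measurableSet).mono_ac hν

lemma continuousOn_dens :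
    ContinuousOn (A.dens c ∘ (extChartAt (𝓡 7) c).symm) (extChartAt (𝓡 7) c).target :=
  (smooth_dens c).continuousOn.comp (continuousOn_extChartAt_symm c) fun z hz ↦ by
    rw [← extChartAt_source (𝓡 7)]
    exact (extChartAt (𝓡 7) c).map_target hz

lemma measurableSet_chart_preimage {s : Set M} (hs : MeasurableSet s) :
    MeasurableSet ((extChartAt (𝓡 7) c).target ∩ (extChartAt (𝓡 7) c).symm ⁻¹' s) := by
  have h := (isOpen_extChartAt_target (I := 𝓡 7) c).measurableSet.subtype_image
    ((continuousOn_extChartAt_symm (I := 𝓡 7) c).domRestrict.measurable hs)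
  convert h using 1
  ext z
  simp [and_comm]

variable (A) in
/-- The density of the chart measure with respect to Lebesgue measure. -/
lemma chartMeasure_eq : A.chartMeasure c
    = Measure.map (extChartAt (𝓡 7) c).symm
      ((volume.restrict (extChartAt (𝓡 7) c).target).withDensity
        fun z ↦ ENNReal.ofReal (A.dens c ((extChartAt (𝓡 7) c).symm z))) := by
  rw [chartMeasure]
  congr 1
  refine withDensity_congr_ae ?_
  filter_upwards [ae_restrict_mem (isOpen_extChartAt_target c).measurableSet] with z hz
  rw [abs_volForm_coordVector hz]

lemma chartMeasure_apply {s : Set M} (hs : MeasurableSet s) :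
    A.chartMeasure c s
      = ∫⁻ z in (extChartAt (𝓡 7) c).target ∩ (extChartAt (𝓡 7) c).symm ⁻¹' s,
        ENNReal.ofReal (A.dens c ((extChartAt (𝓡 7) c).symm z)) := by
  rw [chartMeasure_eq, Measure.map_apply_of_aemeasurable
    (aemeasurable_chart_symm c (withDensity_absolutelyContinuous _ _)) hs, withDensity_apply',
    Measure.restrict_restrict' (isOpen_extChartAt_target c).measurableSet, inter_comm]

lemma chartMeasure_restrict :
    (A.chartMeasure c).restrict (chartAt (EuclideanSpace ℝ (Fin 7)) c).source
      = A.chartMeasure c := by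
  ext s hs
  have ho := (chartAt (EuclideanSpace ℝ (Fin 7)) c).open_source.measurableSet
  rw [Measure.restrict_apply hs, chartMeasure_apply c (hs.inter ho), chartMeasure_apply c hs]
  congr 2
  ext z
  refine ⟨fun h ↦ ⟨h.1, h.2.1⟩, fun h ↦ ⟨h.1, h.2, ?_⟩⟩
  rw [← extChartAt_source (𝓡 7)]
  exact (extChartAt (𝓡 7) c).map_target h.1

/-- The chart measures agree on the overlaps. -/
lemma chartMeasure_overlap (c c' : M) {s : Set M} (hs : MeasurableSet s)
    (h : s ⊆ (chartAt (EuclideanSpace ℝ (Fin 7)) c).source)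
    (h' : s ⊆ (chartAt (EuclideanSpace ℝ (Fin 7)) c').source) :
    A.chartMeasure c s = A.chartMeasure c' s := by
  rw [← extChartAt_source (𝓡 7)] at h h'
  set W := (extChartAt (𝓡 7) c).target ∩ (extChartAt (𝓡 7) c).symm ⁻¹' s with hW
  set τ := extChartAt (𝓡 7) c' ∘ (extChartAt (𝓡 7) c).symm with hτ
  have hτs (z) (hz : z ∈ W) : (extChartAt (𝓡 7) c').symm (τ z) = (extChartAt (𝓡 7) c).symm z :=
    (extChartAt (𝓡 7) c').left_inv (h' hz.2)
  have himg : (extChartAt (𝓡 7) c').target ∩ (extChartAt (𝓡 7) c').symm ⁻¹' s = τ '' W := by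
    ext w
    constructor
    · intro hw
      have e := (extChartAt (𝓡 7) c).left_inv (h hw.2)
      refine ⟨extChartAt (𝓡 7) c ((extChartAt (𝓡 7) c').symm w),
        ⟨(extChartAt (𝓡 7) c).map_source (h hw.2), ?_⟩, ?_⟩
      · rw [mem_preimage, e]
        exact hw.2
      · rw [hτ, Function.comp_apply, e, (extChartAt (𝓡 7) c').right_inv hw.1]
    · rintro ⟨z, hz, rfl⟩
      refine ⟨(extChartAt (𝓡 7) c').map_source (h' hz.2), ?_⟩
      rw [mem_preimage, hτs z hz]
      exact hz.2
  have hinj : InjOn τ W := fun z hz w hw e ↦ by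
    have e2 : (extChartAt (𝓡 7) c).symm z = (extChartAt (𝓡 7) c).symm w := by
      rw [← hτs z hz, ← hτs w hw, e]
    rw [← (extChartAt (𝓡 7) c).right_inv hz.1, e2, (extChartAt (𝓡 7) c).right_inv hw.1]
  have hmem' (z) (hz : z ∈ W) :
      (extChartAt (𝓡 7) c).symm z ∈ (chartAt (EuclideanSpace ℝ (Fin 7)) c').source := by
    rw [← extChartAt_source (𝓡 7)]
    exact h' hz.2
  have hWm : MeasurableSet W := measurableSet_chart_preimage c hs
  -- Change of variables along the transition map; its Jacobian is exactly the factor by which the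
  -- two densities differ.
  rw [chartMeasure_apply c hs, chartMeasure_apply c' hs, himg,
    lintegral_image_eq_lintegral_abs_det_fderiv_mul volume hWm
      (fun z hz ↦ (hasFDerivAt_coordChange hz.1 (hmem' z hz)).1.hasFDerivWithinAt) hinj]
  refine setLIntegral_congr_fun hWm fun z hz ↦ ?_
  rw [hτs z hz, (hasFDerivAt_coordChange hz.1 (hmem' z hz)).2,
    ← ENNReal.ofReal_mul (abs_nonneg _), dens_change (hmem' z hz)]

/-- The volume restricts to the chart measure on the domain of a chart. -/
lemma qcVolume_restrict :
    A.qcVolume.restrict (chartAt (EuclideanSpace ℝ (Fin 7)) c).source = A.chartMeasure c := by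
  set U := (chartAt (EuclideanSpace ℝ (Fin 7)) c).source with hU
  have hUm : MeasurableSet U := (chartAt (EuclideanSpace ℝ (Fin 7)) c).open_source.measurableSet
  refine le_antisymm ?_ ?_
  · have hle : A.qcVolume ≤ A.chartMeasure c
        + Measure.sum fun c' ↦ (A.chartMeasure c').restrict Uᶜ := by
      refine iSup_le fun c' ↦ Measure.le_iff.2 fun s hs ↦ ?_
      set U' := (chartAt (EuclideanSpace ℝ (Fin 7)) c').source with hU'
      have hUm' : MeasurableSet U' :=
        (chartAt (EuclideanSpace ℝ (Fin 7)) c').open_source.measurableSet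
      rw [← measure_inter_add_sdiff s hUm, Measure.add_apply]
      refine add_le_add ?_ ?_
      · rw [← chartMeasure_restrict c', Measure.restrict_apply (hs.inter hUm),
          ← chartMeasure_overlap c c' ((hs.inter hUm).inter hUm')
            (inter_subset_left.trans inter_subset_right) inter_subset_right]
        exact measure_mono (inter_subset_left.trans inter_subset_left)
      · refine le_trans (le_of_eq ?_)
          (Measure.le_iff'.1 (Measure.le_sum (fun c' ↦ (A.chartMeasure c').restrict Uᶜ) c') s)
        rw [Measure.restrict_apply hs, sdiff_eq]
    refine (Measure.restrict_mono_measure hle U).trans (le_of_eq ?_)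
    rw [Measure.restrict_add, chartMeasure_restrict, Measure.restrict_sum _ hUm]
    simp [Measure.restrict_restrict hUm]
  · rw [← chartMeasure_restrict c]
    exact Measure.restrict_mono_measure (le_iSup A.chartMeasure c) U

lemma qcVolume_apply {s : Set M} (hs : MeasurableSet s)
    (h : s ⊆ (chartAt (EuclideanSpace ℝ (Fin 7)) c).source) :
    A.qcVolume s
      = ∫⁻ z in (extChartAt (𝓡 7) c).target ∩ (extChartAt (𝓡 7) c).symm ⁻¹' s,
        ENNReal.ofReal (A.dens c ((extChartAt (𝓡 7) c).symm z)) := by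
  rw [← chartMeasure_apply c hs, ← qcVolume_restrict, Measure.restrict_apply hs,
    inter_eq_self_of_subset_left h]

variable {c}

/-- Integrals of functions supported in a chart. -/
lemma integral_qcVolume {u : M → ℝ} (hu : Continuous u)
    (h : ∀ x ∉ (chartAt (EuclideanSpace ℝ (Fin 7)) c).source, u x = 0) :
    ∫ x, u x ∂A.qcVolume = ∫ z in (extChartAt (𝓡 7) c).target,
      A.dens c ((extChartAt (𝓡 7) c).symm z) * u ((extChartAt (𝓡 7) c).symm z) := by
  have hm := (isOpen_extChartAt_target (I := 𝓡 7) c).measurableSet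
  have hd : AEMeasurable (fun z ↦ ENNReal.ofReal (A.dens c ((extChartAt (𝓡 7) c).symm z)))
      (volume.restrict (extChartAt (𝓡 7) c).target) :=
    ((continuousOn_dens c).aemeasurable hm).ennreal_ofReal
  rw [← setIntegral_eq_integral_of_forall_compl_eq_zero h, qcVolume_restrict, chartMeasure_eq,
    integral_map (aemeasurable_chart_symm c (withDensity_absolutelyContinuous _ _))
      hu.aestronglyMeasurable, integral_withDensity_eq_integral_toReal_smul₀ hd (by simp)]
  refine setIntegral_congr_fun hm fun z hz ↦ ?_
  have hx : (extChartAt (𝓡 7) c).symm z ∈ (chartAt (EuclideanSpace ℝ (Fin 7)) c).source := by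
    rw [← extChartAt_source (𝓡 7)]
    exact (extChartAt (𝓡 7) c).map_target hz
  simp only [smul_eq_mul]
  rw [ENNReal.toReal_ofReal (dens_pos hx).le]

/-- Continuity and positivity of the density bound it on a small coordinate ball by twice and by
half its central value. The upper bound yields local finiteness of the volume, the lower one
positivity on open sets. -/
lemma exists_ball_dens (x : M) {O : Set M} (hO : IsOpen O) (hx : x ∈ O) :
    ∃ r : ℝ, 0 < r ∧ ∀ z ∈ Metric.ball (extChartAt (𝓡 7) x x) r,
      z ∈ (extChartAt (𝓡 7) x).target ∧ (extChartAt (𝓡 7) x).symm z ∈ O ∧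
      A.dens x x / 2 < A.dens x ((extChartAt (𝓡 7) x).symm z) ∧
      A.dens x ((extChartAt (𝓡 7) x).symm z) < 2 * A.dens x x := by
  have hp := dens_pos (A := A) (mem_chart_source (EuclideanSpace ℝ (Fin 7)) x)
  have ht := extChartAt_target_mem_nhds (I := 𝓡 7) x
  have hs := continuousAt_extChartAt_symm (I := 𝓡 7) x
  have hd := (continuousOn_dens (A := A) x).continuousAt ht
  have e := extChartAt_to_inv (I := 𝓡 7) x
  have h1 : ∀ᶠ z in 𝓝 (extChartAt (𝓡 7) x x), (extChartAt (𝓡 7) x).symm z ∈ O :=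
    hs.eventually_mem (hO.mem_nhds (by rwa [e]))
  have h2 := hd.eventually (Ioo_mem_nhds (a := A.dens x x / 2) (b := 2 * A.dens x x)
    (by rw [Function.comp_apply, e]; linarith) (by rw [Function.comp_apply, e]; linarith))
  obtain ⟨r, hr, hb⟩ := Metric.eventually_nhds_iff_ball.1 ((eventually_mem_set.2 ht).and (h1.and h2))
  exact ⟨r, hr, fun z hz ↦ ⟨(hb z hz).1, (hb z hz).2.1, (hb z hz).2.2.1, (hb z hz).2.2.2⟩⟩

/-- With compactness of M this makes continuous functions integrable. -/
instance : IsLocallyFiniteMeasure A.qcVolume where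
  finiteAtNhds x := by
    obtain ⟨r, hr, hb⟩ := exists_ball_dens (A := A) x isOpen_univ (mem_univ x)
    set N := (extChartAt (𝓡 7) x).source ∩ extChartAt (𝓡 7) x ⁻¹'
      Metric.ball (extChartAt (𝓡 7) x x) r with hN
    have hNo : IsOpen N := (continuousOn_extChartAt x).isOpen_inter_preimage
      (isOpen_extChartAt_source x) Metric.isOpen_ball
    refine ⟨N, hNo.mem_nhds ⟨mem_extChartAt_source x, Metric.mem_ball_self hr⟩, ?_⟩
    rw [qcVolume_apply x hNo.measurableSet (by
      rw [← extChartAt_source (𝓡 7)]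
      exact inter_subset_left)]
    have hsub : (extChartAt (𝓡 7) x).target ∩ (extChartAt (𝓡 7) x).symm ⁻¹' N
        ⊆ Metric.ball (extChartAt (𝓡 7) x x) r := fun z hz ↦ by
      have := hz.2.2
      rwa [mem_preimage, (extChartAt (𝓡 7) x).right_inv hz.1] at this
    calc _ ≤ ∫⁻ z in Metric.ball (extChartAt (𝓡 7) x x) r,
          ENNReal.ofReal (A.dens x ((extChartAt (𝓡 7) x).symm z)) := lintegral_mono_set hsub
      _ ≤ ∫⁻ _ in Metric.ball (extChartAt (𝓡 7) x x) r, ENNReal.ofReal (2 * A.dens x x) :=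
          setLIntegral_mono measurable_const fun z hz ↦
            ENNReal.ofReal_le_ofReal (hb z hz).2.2.2.le
      _ < ⊤ := by
          rw [setLIntegral_const]
          exact ENNReal.mul_lt_top ENNReal.ofReal_lt_top measure_ball_lt_top

/-- This allows a continuous function that vanishes almost everywhere to be recognized as zero. -/
instance : Measure.IsOpenPosMeasure A.qcVolume where
  open_pos O hO hne := by
    obtain ⟨x, hx⟩ := hne
    obtain ⟨r, hr, hb⟩ := exists_ball_dens (A := A) x hO hx
    have hp := dens_pos (A := A) (mem_chart_source (EuclideanSpace ℝ (Fin 7)) x)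
    set O' := O ∩ (chartAt (EuclideanSpace ℝ (Fin 7)) x).source with hO'
    have hsub : Metric.ball (extChartAt (𝓡 7) x x) r
        ⊆ (extChartAt (𝓡 7) x).target ∩ (extChartAt (𝓡 7) x).symm ⁻¹' O' := fun z hz ↦ by
      refine ⟨(hb z hz).1, (hb z hz).2.1, ?_⟩
      rw [← extChartAt_source (𝓡 7)]
      exact (extChartAt (𝓡 7) x).map_target (hb z hz).1
    refine ne_of_gt (lt_of_lt_of_le ?_ (measure_mono (inter_subset_left : O' ⊆ O)))
    rw [qcVolume_apply x (hO.inter (chartAt _ x).open_source).measurableSet inter_subset_right]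
    calc 0 < ∫⁻ _ in Metric.ball (extChartAt (𝓡 7) x x) r, ENNReal.ofReal (A.dens x x / 2) := by
          rw [setLIntegral_const]
          exact ENNReal.mul_pos (ENNReal.ofReal_pos.2 (by linarith)).ne'
            (Metric.measure_ball_pos volume _ hr).ne'
      _ ≤ ∫⁻ z in Metric.ball (extChartAt (𝓡 7) x x) r,
          ENNReal.ofReal (A.dens x ((extChartAt (𝓡 7) x).symm z)) :=
          setLIntegral_mono' measurableSet_ball fun z hz ↦
            ENNReal.ofReal_le_ofReal (hb z hz).2.2.1.le
      _ ≤ _ := lintegral_mono_set hsub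

end ChartMeasure

end QCStructure

end QuaternionicContact

/-! ### The divergence theorem and the eigenvalue estimate. -/

namespace QuaternionicContact

/-- Integration by parts against the constant function 1. -/
lemma integral_fderiv_apply_eq_zero {E : Type*} [NormedAddCommGroup E] [NormedSpace ℝ E]
    [FiniteDimensional ℝ E] [MeasurableSpace E] [BorelSpace E] {μ : Measure E}
    [μ.IsAddHaarMeasure] {s : E → ℝ} (hs : ContDiff ℝ 1 s) (hc : HasCompactSupport s) (v : E) :
    Integrable (fun z ↦ fderiv ℝ s z v) μ ∧ ∫ z, fderiv ℝ s z v ∂μ = 0 := by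
  have h1 : Integrable (fun z ↦ fderiv ℝ s z v) μ :=
    ((hs.continuous_fderiv one_ne_zero).clm_apply continuous_const).integrable_of_hasCompactSupport
      (hc.fderiv_apply ℝ v)
  have h2 : Integrable s μ := hs.continuous.integrable_of_hasCompactSupport hc
  refine ⟨h1, ?_⟩
  have h := integral_mul_fderiv_eq_neg_fderiv_mul_of_integrable (𝕜 := ℝ) (μ := μ)
    (f := fun _ : E ↦ (1 : ℝ)) (g := s) (v := v) (by simp) (by simpa using h1) (by simpa using h2)
    (fun _ _ ↦ differentiableAt_const _) (fun z _ ↦ hs.differentiable one_ne_zero z)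
  simpa using h

namespace QCStructure

variable {M : Type*} [TopologicalSpace M] [ChartedSpace (EuclideanSpace ℝ (Fin 7)) M]
  [IsManifold (𝓡 7) ∞ M] [T2Space M] {A : QCStructure M}
  {cov : CovariantDerivative (𝓡 7) (EuclideanSpace ℝ (Fin 7)) (fun x : M ↦ TangentSpace (𝓡 7) x)}
  {σ : VField M}

lemma continuous_divg (hcov : A.IsBiquard cov) (hσ : SmoothOn σ univ) :
    Continuous (divg cov σ) := by
  refine continuous_iff_continuousAt.2 fun x ↦ ?_
  set F := A.frameAt x
  have hU := F.isOpen_dom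
  have h : FunOn (fun y ↦ ∑ i, A.g.inner y (nabla cov (F.fr i) σ y) (F.fr i y)) F.dom :=
    FunOn.sum fun i _ ↦ FunOn.inner A.g
      (SmoothOn.nabla hcov.smooth hU (smooth_fr F i) (hσ.mono (subset_univ _))) (smooth_fr F i)
  exact ((h.congr fun y hy ↦ divg_eq_fr F hy σ).continuousOn.continuousAt
    (hU.mem_nhds (A.mem_frameAt_dom x)))

lemma divg_eq_zero (hσ : SmoothOn σ univ) {U : Set M} (hU : IsOpen U) {x : M} (hx : x ∈ U)
    (h : ∀ y ∈ U, σ y = 0) : divg cov σ x = 0 := by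
  have hd := hσ.diffAt isOpen_univ (mem_univ x)
  have e : cov σ x = 0 := by
    ext1 w
    -- Near x the field coincides with 0 • σ, whose covariant derivative vanishes by linearity.
    rw [cov_congr hU hx hd (hd.const_smul 0) (fun y hy ↦ by rw [h y hy, smul_zero]),
      cov_const_smul 0 hd, zero_smul]
    rfl
  rw [divg, e]
  exact map_zero _

variable [MeasurableSpace M] [BorelSpace M]

/-- The divergence theorem for horizontal fields supported in a chart. -/
lemma integral_divg_of_chart (hcov : A.IsBiquard cov) (hσ : SmoothOn σ univ)
    (hH : ∀ x, σ x ∈ A.H x) {c : M} {K : Set M} (hK : IsCompact K)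
    (hKc : K ⊆ (chartAt (EuclideanSpace ℝ (Fin 7)) c).source) (h0 : ∀ x ∉ K, σ x = 0) :
    ∫ x, divg cov σ x ∂A.qcVolume = 0 := by
  set φ := extChartAt (𝓡 7) c with hφ
  have hsrc : φ.source = (chartAt (EuclideanSpace ℝ (Fin 7)) c).source := extChartAt_source (𝓡 7) c
  have hto : IsOpen φ.target := isOpen_extChartAt_target c
  have hmem (z) (hz : z ∈ φ.target) :
      φ.symm z ∈ (chartAt (EuclideanSpace ℝ (Fin 7)) c).source := hsrc ▸ φ.map_target hz
  have hso := (chartAt (EuclideanSpace ℝ (Fin 7)) c).open_source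
  set u : Fin 7 → M → ℝ := fun i y ↦ A.dens c y * df (coord c i) y (σ y) with hu
  have hus (i) : FunOn (u i) (chartAt (EuclideanSpace ℝ (Fin 7)) c).source :=
    (smooth_dens c).mul ((smooth_coord c i).df hso (hσ.mono (subset_univ _)))
  have hu0 (i) (x) (hx : x ∉ K) : u i x = 0 := by simp [hu, h0 x hx]
  -- The components of the field times the density, read in the chart and extended by zero. The
  -- field vanishes outside the compact set K inside the chart domain, so these functions are C¹
  -- with compact support on all of Euclidean space.
  set s : Fin 7 → EuclideanSpace ℝ (Fin 7) → ℝ := fun i ↦ φ.target.indicator (u i ∘ φ.symm) with hs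
  have hKφ : IsCompact (φ '' K) :=
    hK.image_of_continuousOn ((continuousOn_extChartAt c).mono (by rwa [hsrc]))
  have hs0 (i) (z) (hz : z ∉ φ '' K) : s i z = 0 := by
    by_cases hzt : z ∈ φ.target
    · rw [hs]
      simp only [indicator_of_mem hzt, Function.comp_apply]
      exact hu0 i _ fun hzK ↦ hz ⟨_, hzK, φ.right_inv hzt⟩
    · exact indicator_of_notMem hzt _
  have hnear (i) (z) (hz : z ∉ φ.target) : s i =ᶠ[𝓝 z] fun _ ↦ 0 := by
    have hz' : z ∉ φ '' K := by
      rintro ⟨x, hx, rfl⟩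
      exact hz (φ.map_source (by rw [hsrc]; exact hKc hx))
    exact eventually_of_mem (hKφ.isClosed.isOpen_compl.mem_nhds hz') fun w hw ↦ hs0 i w hw
  have heq (i) (z) (hz : z ∈ φ.target) : s i =ᶠ[𝓝 z] u i ∘ φ.symm :=
    eventually_of_mem (hto.mem_nhds hz) fun w hw ↦ indicator_of_mem hw _
  have hsc (i) : HasCompactSupport (s i) := HasCompactSupport.intro hKφ (hs0 i)
  have hsd (i) : ContDiff ℝ 1 (s i) := by
    refine contDiff_iff_contDiffAt.2 fun z ↦ ?_
    by_cases hz : z ∈ φ.target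
    · have h1 : ContDiffOn ℝ ∞ (u i ∘ φ.symm) φ.target :=
        contMDiffOn_iff_contDiffOn.1 ((hus i).comp (contMDiffOn_extChartAt_symm c) hmem)
      exact ((h1.contDiffAt (hto.mem_nhds hz)).of_le (by simp)).congr_of_eventuallyEq (heq i z hz)
    · exact contDiffAt_const.congr_of_eventuallyEq (hnear i z hz)
  have hpt (z) (hz : z ∈ φ.target) : A.dens c (φ.symm z) * divg cov σ (φ.symm z)
      = ∑ i, fderiv ℝ (s i) z (EuclideanSpace.single i 1) := by
    -- The coordinate formula asks for a frame whose domain lies in the chart, hence the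
    -- restriction.
    rw [dens_mul_divg hcov ((A.frameAt (φ.symm z)).restrict _ hso)
      (show φ.symm z ∈ (A.frameAt (φ.symm z)).dom ∩ _ from ⟨A.mem_frameAt_dom _, hmem z hz⟩)
      (show (A.frameAt (φ.symm z)).dom ∩ _ ⊆ _ from inter_subset_right)
      (hσ.mono (subset_univ _)) (hH _)]
    refine Finset.sum_congr rfl fun i _ ↦ ?_
    rw [(heq i z hz).fderiv_eq]
    exact (fderiv_comp_symm hz ((hus i).mdiffAt hso (hmem z hz)) i).2.symm
  have hI (i) := integral_fderiv_apply_eq_zero (μ := volume) (hsd i) (hsc i)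
    (EuclideanSpace.single i 1)
  rw [integral_qcVolume (c := c) (continuous_divg hcov hσ) fun x hx ↦
    divg_eq_zero hσ hK.isClosed.isOpen_compl (fun h ↦ hx (hKc h)) h0,
    setIntegral_congr_fun hto.measurableSet hpt,
    integral_finsetSum _ fun i _ ↦ (hI i).1.integrableOn]
  refine Finset.sum_eq_zero fun i _ ↦ ?_
  rw [setIntegral_eq_integral_of_forall_compl_eq_zero fun z hz ↦ ?_, (hI i).2]
  rw [(hnear i z hz).fderiv_eq]
  simp

/-- The divergence theorem for horizontal fields on a compact manifold. -/
theorem integral_divg [CompactSpace M] (hcov : A.IsBiquard cov) (hσ : SmoothOn σ univ)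
    (hH : ∀ x, σ x ∈ A.H x) : ∫ x, divg cov σ x ∂A.qcVolume = 0 := by
  obtain ⟨t, ht⟩ := isCompact_univ.elim_finite_subcover
    (fun c : M ↦ (chartAt (EuclideanSpace ℝ (Fin 7)) c).source)
    (fun c ↦ (chartAt (EuclideanSpace ℝ (Fin 7)) c).open_source)
    (fun x _ ↦ mem_iUnion.2 ⟨x, mem_chart_source _ x⟩)
  obtain ⟨ρ, hρ⟩ := SmoothPartitionOfUnity.exists_isSubordinate (𝓡 7) (isClosed_univ (X := M))
    (fun c : t ↦ (chartAt (EuclideanSpace ℝ (Fin 7)) c.1).source)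
    (fun c ↦ (chartAt (EuclideanSpace ℝ (Fin 7)) c.1).open_source)
    (fun x hx ↦ by
      obtain ⟨c, hc, hxc⟩ := mem_iUnion₂.1 (ht hx)
      exact mem_iUnion.2 ⟨⟨c, hc⟩, hxc⟩)
  have hρs (c : t) : FunOn (ρ c) univ := (ρ c).contMDiff.contMDiffOn
  have hρσ (c : t) : SmoothOn (fun y ↦ ρ c y • σ y) univ := SmoothOn.smul (hρs c) hσ
  have hsum (x : M) : ∑ c, ρ c x = 1 := by
    rw [← finsum_eq_sum_of_fintype]
    exact ρ.sum_eq_one (mem_univ x)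
  have hint (c : t) : Integrable (divg cov fun y ↦ ρ c y • σ y) A.qcVolume :=
    (continuous_divg hcov (hρσ c)).integrable_of_hasCompactSupport
      (HasCompactSupport.of_compactSpace _)
  -- The derivative terms add up to the derivative of Σρ_c = 1 along σ, which is zero.
  have e (x : M) : divg cov σ x = ∑ c, divg cov (fun y ↦ ρ c y • σ y) x := by
    have hm (c : t) : MDifferentiableAt (𝓡 7) 𝓘(ℝ) (ρ c) x :=
      (hρs c).mdiffAt isOpen_univ (mem_univ x)
    have h1 (c : t) := divg_smul (cov := cov) (A.frameAt x) (A.mem_frameAt_dom x) (hm c)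
      (hσ.diffAt isOpen_univ (mem_univ x))
    simp only [h1]
    rw [Finset.sum_add_distrib, ← Finset.sum_mul, hsum, one_mul, ← df_sum fun c _ ↦ hm c]
    simp only [hsum]
    rw [df_const, add_zero]
  simp only [e]
  rw [integral_finsetSum _ fun c _ ↦ hint c]
  refine Finset.sum_eq_zero fun c _ ↦ integral_divg_of_chart hcov (hρσ c)
    (fun x ↦ (A.H x).smul_mem _ (hH x)) (isClosed_tsupport (ρ c)).isCompact (hρ c) fun x hx ↦ ?_
  rw [image_eq_zero_of_notMem_tsupport hx, zero_smul]

/-- A Lichnerowicz type lower bound for an eigenvalue of the sub-Laplacian. -/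
theorem eigenvalue_lower_bound [CompactSpace M] (hcov : A.IsBiquard cov) {k₀ lam : ℝ} {f : M → ℝ}
    (hLich : ∀ x : M, ∀ X ∈ A.H x,
      k₀ * A.g.inner x X X ≤ 6 * A.S cov x * A.g.inner x X X + 10 * A.T0 cov x X X)
    (hf : A.IsEigenfunction cov lam f) (hP : A.PFunctionNonneg cov f) (hlam : lam ≠ 0) :
    k₀ / 3 ≤ lam := by
  by_contra! hlt
  obtain ⟨hfs, hf0, heig⟩ := hf
  obtain ⟨hPi, hP0⟩ := hP
  -- Global smoothness is checked frame by frame, as the frame domains cover M.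
  have smooth_of (σ : VField M) (h : ∀ F : A.toQCData.LocalFrame, SmoothOn σ F.dom) :
      SmoothOn σ univ := fun x _ ↦
    ((h (A.frameAt x)).contMDiffAt (A.frameAt x).isOpen_dom
      (A.mem_frameAt_dom x)).contMDiffWithinAt
  have hfl : SmoothOn (A.flux cov lam f) univ :=
    smooth_of _ fun F ↦ flux_smoothOn hcov hfs lam
  have hgr : SmoothOn (A.hgrad f) univ := smooth_of _ fun F ↦ smooth_hgrad F hfs.contMDiffOn
  have hdiv := integral_divg hcov hfl (flux_mem_H hcov hfs lam)
  have hdi : Integrable (divg cov (A.flux cov lam f)) A.qcVolume :=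
    (continuous_divg hcov hfl).integrable_of_hasCompactSupport
      (HasCompactSupport.of_compactSpace _)
  set q : M → ℝ := fun x ↦ A.g.inner x (A.hgrad f x) (A.hgrad f x) with hq
  have hqc : Continuous q := by
    rw [← continuousOn_univ]
    exact (FunOn.inner A.g hgr hgr).continuousOn
  have hqi : Integrable q A.qcVolume :=
    hqc.integrable_of_hasCompactSupport (HasCompactSupport.of_compactSpace _)
  have hq0 : 0 ≤ q := fun x ↦ inner_self_nonneg _
  have hmono : ∫ x, 1 / 2 * (k₀ - 3 * lam) * q x ∂A.qcVolume
      ≤ ∫ x, (3 / 4 * A.PFunction cov f x + divg cov (A.flux cov lam f) x) ∂A.qcVolume :=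
    integral_mono (hqi.const_mul _) ((hPi.const_mul _).add hdi) fun x ↦
      pointwise_inequality hcov hfs heig (hLich x)
  rw [integral_const_mul, integral_add (hPi.const_mul _) hdi, integral_const_mul, hdiv] at hmono
  -- If λ < k₀/3 the factor k₀ − 3λ is positive, while the right side of `hmono` is 3/4 of the
  -- integral of the P-function, which is at most zero. A positive integral of |∇f|² is therefore
  -- impossible.
  have hqz : ∫ x, q x ∂A.qcVolume = 0 := by
    refine le_antisymm ?_ (integral_nonneg hq0)
    have hpos : 0 < 1 / 2 * (k₀ - 3 * lam) := by linarith
    by_contra! h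
    have := mul_pos hpos h
    linarith
  have hqe : q = 0 := (Continuous.ae_eq_iff_eq A.qcVolume hqc continuous_const).1
    ((integral_eq_zero_iff_of_nonneg hq0 hqi).1 hqz)
  have hg0 (x : M) : A.hgrad f x = 0 := inner_self_eq_zero (congrFun hqe x)
  refine hf0 (funext fun x ↦ ?_)
  have h1 := heig x
  -- A vanishing gradient gives 0 = △f = λf, so λ ≠ 0 forces f = 0 without any connectedness of M.
  rw [subLaplacian_eq hcov hfs, divg_eq_zero hgr isOpen_univ (mem_univ x) fun y _ ↦ hg0 y,
    neg_zero] at h1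
  exact (mul_eq_zero.1 h1.symm).resolve_left hlam

end QCStructure

end QuaternionicContact

end

theorem theorem1p1 {M : Type*} [TopologicalSpace M] [T2Space M] [CompactSpace M]
    [ChartedSpace (EuclideanSpace ℝ (Fin 7)) M] [IsManifold (𝓡 7) ∞ M]
    [MeasurableSpace M] [BorelSpace M]
    (A : QuaternionicContact.QCStructure M)
    (cov : CovariantDerivative (𝓡 7) (EuclideanSpace ℝ (Fin 7))
      (fun x : M ↦ TangentSpace (𝓡 7) x))
    (hcov : A.IsBiquard cov)
    (k₀ : ℝ) (hk₀ : 0 < k₀)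
    (hLich : ∀ x : M, ∀ X ∈ A.H x,
      k₀ * A.g.inner x X X ≤ 6 * A.S cov x * A.g.inner x X X + 10 * A.T0 cov x X X)
    (hP : ∀ (mu : ℝ) (f : M → ℝ), A.IsEigenfunction cov mu f → A.PFunctionNonneg cov f) :
    ∀ lam : ℝ, lam ≠ 0 → (∃ f : M → ℝ, A.IsEigenfunction cov lam f) → k₀ / 3 ≤ lam := by
  rintro lam hlam ⟨f, hf⟩
  exact QuaternionicContact.QCStructure.eigenvalue_lower_bound hcov hLich hf (hP lam f hf) hlam
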